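/- Let $k$ be an algebraically closed field, let $H$ be a finite-dimensional Hopf algebra over $k$ with comultiplication $\Delta(h)=h_{(1)}\otimes h_{(2)}$, counit $\varepsilon$ and antipode $S$, and let $L$ be a finite-dimensional left $H$-comodule algebra with coaction $\delta(a)=a_{(-1)}\otimes a_{(0)}\in H\otimes L$. For an algebra $A$, write ${}_A\mathrm{Mod}$ for the category of finite-dimensional left $A$-modules. The category ${}_H\mathrm{Mod}$ is monoidal via $\Delta$, with dual objects $X^*$ given by $\langle h f,x\rangle=\langle f,S(h)x\rangle$, and it acts on ${}_L\mathrm{Mod}$ by $X\triangleright M=X\otimes M$ with $a(x\otimes m)=a_{(-1)}x\otimes a_{(0)}m$. Assume that $L$ is exact, i.e. $P\triangleright M$ is projective for every projective $P\in{}_H\mathrm{Mod}$ and every $M\in{}_L\mathrm{Mod}$. Let $\underline{\mathrm{Hom}}(M,N)=\mathrm{Hom}_L(H\triangleright M,N)$ be the internal Hom functor, right adjoint to $-\triangleright M$. Let $\Lambda\in H$ be a right integral ($\Lambda h=\varepsilon(h)\Lambda$) and $\lambda_H:H\to k$ a right cointegral ($\langle\lambda_H,h_{(1)}\rangle h_{(2)}=\langle\lambda_H,h\rangle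 1$) with $\langle\lambda_H,\Lambda\rangle=1$; let $\alpha_H:H\to k$ be the modular function ($h\Lambda=\alpha_H(h)\Lambda$), and let $g_H\in H$ be the distinguished grouplike element, characterised by $h_{(1)}\langle\lambda_H,h_{(2)}\rangle=\langle\lambda_H,h\rangle g_H$ for all $h\in H$. Let $\lambda_L:L\to k$ be a Frobenius form on $L$ (i.e. $a\mapsto\lambda_L(a\,\cdot)$ is a bijection $L\to L^*$), with Nakayama automorphism $\nu_L$ given by $\lambda_L(\nu_L(a)b)=\lambda_L(ba)$. Let $\mathbb{S}:{}_L\mathrm{Mod}\to{}_L\mathrm{Mod}$ be the functor such that $\mathbb{S}(M)$ is the vector space $M$ with the action $a*m=\langle\alpha_H,\nu_L(a)_{(-1)}\rangle\,\nu_L(a)_{(0)}m$. Suppose that $\lambda_L$ is a $g_L$-cointegral for some grouplike element $g_L\in H$, i.e. $a_{(-1)}\langle\lambda_L,a_{(0)}\rangle=\langle\lambda_L,a\rangle g_L$ for all $a\in L$. Then the following holds. The functor $\mathbb{S}$ is a relative Serre functor of ${}_L\mathrm{Mod}$, with natural isomorphism $\phi_{M,N}:\underline{\mathrm{Hom}}(M,N)^*\to\underline{\mathrm{Hom}}(N,\mathbb{S}(M))$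 induced by the pairing $\underline{\mathrm{Hom}}(N,\mathbb{S}(M))\otimes\underline{\mathrm{Hom}}(M,N)\to\underline{\mathrm{Hom}}(M,\mathbb{S}(M))\xrightarrow{\mathrm{tr}_M}k$ made of the composition and the map $\mathrm{tr}_M(\xi)=\sum_i\langle\lambda_L,t^i(\Lambda\otimes\xi(t_i))\rangle$, where $t_i\in H\triangleright M$, $t^i\in\mathrm{Hom}_L(H\triangleright M,L)$ is any finite system with $\sum_i t^i(x)t_i=x$ for all $x\in H\triangleright M$ (such systems exist). Let $$s_{X,M}:\mathbb{S}(X\triangleright M)\to X^{**}\triangleright\mathbb{S}(M)\qquad(X\in{}_H\mathrm{Mod},\ M\in{}_L\mathrm{Mod})$$ be the twisted ${}_H\mathrm{Mod}$-module structure of this relative Serre functor, that is, the unique twisted ${}_H\mathrm{Mod}$-module functor structure on $\mathbb{S}$ for which $\phi$ is an isomorphism of ${}_H\mathrm{Mod}$-bimodule functors, and let $\Phi_X:X\to X^{**}$ be the canonical isomorphism of vector spaces. The general formula $$s_{X,M}(x\otimes m)=\sum_j\Phi_X\big(S^3(S(\Lambda_{(1)})b_{j(-1)})\,S(\Lambda_{(3)})\,x\big)\otimes\langle\lambda_L,b_{j(0)}\rangle\,\langle\lambda_H,a_{j(-1)}\Lambda_{(2)}\rangle\,a_{j(0)}m,$$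 where $\{a_j\}$ is a basis of $L$ and $\{b_j\}$ is its dual basis with respect to $\lambda_L$ (on either side: $\lambda_L(a_ib_j)=\delta_{ij}$ for all $i,j$, or $\lambda_L(b_ia_j)=\delta_{ij}$ for all $i,j$), holds and reduces to $$s_{X,M}(x\otimes m)=\Phi_X(g_L^{-1}g_H\,x)\otimes m\qquad(x\in X,\ m\in M).$$ -/

import Mathlib

open CategoryTheory MonoidalCategory TensorProduct
open scoped MonoidalLeftAction

universe v₁ v₂ u₁ u₂ u

/-! ### Module categories, internal Hom functors and relative Serre functors

For an object `X` of a rigid monoidal category we write `X*` for the object with morphisms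
`ev : X* ⊗ X ⟶ 𝟙` and `coev : 𝟙 ⟶ X ⊗ X*`. (Mathlib calls it the right dual `Xᘁ`; it is called
the left dual by Etingof, Gelaki, Nikshych and Ostrik.) -/

section General

namespace ModCat

section Duals

variable {C : Type u₁} [Category.{v₁} C] [MonoidalCategory C] [RightRigidCategory C]

/-- The dual object `X*`. -/
abbrev dual (X : C) : C := Xᘁ

/-- The dual morphism `f* : Y* ⟶ X*` of `f : X ⟶ Y`. -/
noncomputable def dualMap {X Y : C} (f : X ⟶ Y) : dual Y ⟶ dual X := fᘁ

/-- The evaluation `X* ⊗ X ⟶ 𝟙`. -/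
noncomputable def dualEval (X : C) : dual X ⊗ X ⟶ 𝟙_ C := ε_ X (dual X)

/-- The canonical isomorphism `(X ⊗ Y)* ≅ Y* ⊗ X*`. -/
noncomputable def dualTensor (X Y : C) : dual (X ⊗ Y) ≅ dual Y ⊗ dual X :=
  rightDualTensorIso X Y

/-- The canonical isomorphism `𝟙* ≅ 𝟙`. -/
noncomputable def dualUnit (C : Type u₁) [Category.{v₁} C] [MonoidalCategory C]
    [RightRigidCategory C] : dual (𝟙_ C) ≅ 𝟙_ C :=
  rightDualIso (X := 𝟙_ C)
    (@HasRightDual.exact C _ _ (𝟙_ C) (RightRigidCategory.rightDual (𝟙_ C))) exactPairingUnit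

/-- The canonical isomorphism `(X ⊗ Y)** ⟶ X** ⊗ Y**`. -/
noncomputable def doubleDualTensor (X Y : C) :
    dual (dual (X ⊗ Y)) ⟶ dual (dual X) ⊗ dual (dual Y) :=
  dualMap (dualTensor X Y).inv ≫ (dualTensor (dual Y) (dual X)).hom

/-- The canonical isomorphism `𝟙** ⟶ 𝟙`. -/
noncomputable def doubleDualUnit (C : Type u₁) [Category.{v₁} C] [MonoidalCategory C]
    [RightRigidCategory C] : dual (dual (𝟙_ C)) ⟶ 𝟙_ C :=
  dualMap (dualUnit C).inv ≫ (dualUnit C).hom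

end Duals

variable (C : Type u₁) [Category.{v₁} C] [MonoidalCategory C]
variable (M : Type u₂) [Category.{v₂} M] [MonoidalLeftAction C M]

/-- The exactness condition on a left `C`-module category `M`: the object `P ⊙ₗ m` is projective
for every projective object `P` of `C` and every object `m` of `M`. -/
def IsExact : Prop :=
  ∀ (P : C), Projective P → ∀ m : M, Projective (P ⊙ₗ m : M)

/-- An internal Hom functor of a left `C`-module category `M`: a choice of a right adjoint
`[m, -]` of `- ⊙ₗ m : C ⥤ M` for every object `m`. -/
structure InternalHom where
  /-- The functor `[m, -]`. -/
  obj (m : M) : M ⥤ C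
  /-- The adjunction `- ⊙ₗ m ⊣ [m, -]`. -/
  adj (m : M) : MonoidalLeftAction.actionRight C m ⊣ obj m

variable {C M}

namespace InternalHom

variable (I : InternalHom C M)

/-- The object `[m, n]`. -/
abbrev hom (m n : M) : C := (I.obj m).obj n

/-- The counit `[m, n] ⊙ₗ m ⟶ n`. -/
def ev (m n : M) : (I.hom m n) ⊙ₗ m ⟶ n := (I.adj m).counit.app n

/-- The morphism `X ⟶ [m, n]` corresponding to `X ⊙ₗ m ⟶ n`. -/
def curry {X : C} {m n : M} (f : X ⊙ₗ m ⟶ n) : X ⟶ I.hom m n := (I.adj m).homEquiv X n f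

/-- The contravariant functoriality of `[m, n]` in `m`. -/
def pre {m m' : M} (f : m ⟶ m') (n : M) : I.hom m' n ⟶ I.hom m n :=
  I.curry ((I.hom m' n) ⊴ₗ f ≫ I.ev m' n)

/-- The morphism `𝟙 ⟶ [m, m]` corresponding to the identity. -/
def coev (m : M) : 𝟙_ C ⟶ I.hom m m := I.curry (λₗ m).hom

/-- The composition `[m₂, m₃] ⊗ [m₁, m₂] ⟶ [m₁, m₃]`. -/
def comp (m₁ m₂ m₃ : M) : I.hom m₂ m₃ ⊗ I.hom m₁ m₂ ⟶ I.hom m₁ m₃ :=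
  I.curry ((αₗ _ _ m₁).hom ≫ (I.hom m₂ m₃) ⊴ₗ (I.ev m₁ m₂) ≫ I.ev m₂ m₃)

/-- The left `C`-module structure `X ⊗ [m, n] ⟶ [m, X ⊙ₗ n]`. -/
def leftStr (X : C) (m n : M) : X ⊗ I.hom m n ⟶ I.hom m (X ⊙ₗ n) :=
  I.curry ((αₗ _ _ m).hom ≫ X ⊴ₗ (I.ev m n))

/-- The right `C`-module structure `[m, n] ⊗ X* ⟶ [X ⊙ₗ m, n]`. -/
noncomputable def rightStr [RightRigidCategory C] (X : C) (m n : M) :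
    I.hom m n ⊗ dual X ⟶ I.hom (X ⊙ₗ m) n :=
  I.curry ((αₗ _ _ (X ⊙ₗ m)).hom ≫
    (I.hom m n) ⊴ₗ ((αₗ (dual X) X m).inv ≫ (dualEval X) ⊵ₗ m ≫ (λₗ m).hom) ≫ I.ev m n)

end InternalHom

variable [RightRigidCategory C]

/-- A structure of a relative Serre functor on `S : M ⥤ M`: an isomorphism
`[m, n]* ≅ [n, S m]` natural in `m` and `n`. -/
structure RelativeSerre (I : InternalHom C M) (S : M ⥤ M) where
  /-- The isomorphism `[m, n]* ≅ [n, S m]`. -/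
  iso (m n : M) : dual (I.hom m n) ≅ I.hom n (S.obj m)
  naturality_left {m m' : M} (f : m ⟶ m') (n : M) :
    dualMap (I.pre f n) ≫ (iso m' n).hom = (iso m n).hom ≫ (I.obj n).map (S.map f)
  naturality_right (m : M) {n n' : M} (g : n ⟶ n') :
    dualMap ((I.obj m).map g) ≫ (iso m n).hom = (iso m n').hom ≫ I.pre g (S.obj m)

/-- The trace `[m, S m] ⟶ 𝟙` of a relative Serre functor, that is,
`[m, S m] ≅ [m, m]* ⟶ 𝟙* ≅ 𝟙`. -/
noncomputable def RelativeSerre.trace {I : InternalHom C M} {S : M ⥤ M} (φ : RelativeSerre I S)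
    (m : M) : I.hom m (S.obj m) ⟶ 𝟙_ C :=
  (φ.iso m m).inv ≫ dualMap (I.coev m) ≫ (dualUnit C).hom

/-- The isomorphism `[m, n]* ≅ [n, S m]` is induced by the pairing
`[n, S m] ⊗ [m, n] ⟶ [m, S m] ⟶ 𝟙` made of the composition and the trace. -/
def RelativeSerre.IsInducedByTrace {I : InternalHom C M} {S : M ⥤ M} (φ : RelativeSerre I S) :
    Prop :=
  ∀ m n : M, (φ.iso m n).hom ▷ (I.hom m n) ≫ I.comp m n (S.obj m) ≫ φ.trace m =
    dualEval (I.hom m n)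

/-- A twisted left `C`-module structure on `S : M ⥤ M`, that is, a structure
`S (X ⊙ₗ m) ≅ X** ⊙ₗ S m` of a (strong) left `C`-module functor from `M` to the category `M` on
which `C` acts through the double dual functor. -/
@[ext]
structure TwistedStructure (C : Type u₁) [Category.{v₁} C] [MonoidalCategory C]
    [RightRigidCategory C] {M : Type u₂} [Category.{v₂} M] [MonoidalLeftAction C M]
    (S : M ⥤ M) where
  /-- The structure isomorphism. -/
  str (X : C) (m : M) : S.obj (X ⊙ₗ m) ≅ dual (dual X) ⊙ₗ S.obj m
  naturality_left {X Y : C} (f : X ⟶ Y) (m : M) :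
    S.map (f ⊵ₗ m) ≫ (str Y m).hom = (str X m).hom ≫ dualMap (dualMap f) ⊵ₗ S.obj m
  naturality_right (X : C) {m n : M} (f : m ⟶ n) :
    S.map (X ⊴ₗ f) ≫ (str X n).hom = (str X m).hom ≫ dual (dual X) ⊴ₗ S.map f
  unit (m : M) :
    (str (𝟙_ C) m).hom ≫ doubleDualUnit C ⊵ₗ S.obj m ≫ (λₗ (S.obj m)).hom = S.map (λₗ m).hom
  tensor (X Y : C) (m : M) :
    (str (X ⊗ Y) m).hom ≫ doubleDualTensor X Y ⊵ₗ S.obj m ≫ (αₗ _ _ (S.obj m)).hom =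
      S.map (αₗ X Y m).hom ≫ (str X (Y ⊙ₗ m)).hom ≫ dual (dual X) ⊴ₗ (str Y m).hom

/-- The natural isomorphism `[m, n]* ≅ [n, S m]` is an isomorphism of `C`-bimodule functors, if the
twisted left `C`-module structure of `S` is `t`. A twisted structure `t` with this property is
*the* twisted `C`-module structure of the relative Serre functor `(S, φ)`. -/
structure IsBimoduleIso {I : InternalHom C M} {S : M ⥤ M} (φ : RelativeSerre I S)
    (t : TwistedStructure C S) : Prop where
  left (X : C) (m n : M) :
    (φ.iso (X ⊙ₗ m) n).hom ≫ (I.obj n).map (t.str X m).hom =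
      dualMap (I.rightStr X m n) ≫ (dualTensor (I.hom m n) (dual X)).hom ≫
        dual (dual X) ◁ (φ.iso m n).hom ≫ I.leftStr (dual (dual X)) n (S.obj m)
  right (Y : C) (m n : M) :
    (φ.iso m (Y ⊙ₗ n)).hom =
      dualMap (I.leftStr Y m n) ≫ (dualTensor Y (I.hom m n)).hom ≫
        (φ.iso m n).hom ▷ dual Y ≫ I.rightStr Y n (S.obj m)

end ModCat

end General

/-! ### Finite-dimensional modules over an algebra -/

section TensorAct

variable {k A B D E V W U : Type u} [Field k] [Ring A] [Algebra k A] [Ring B] [Algebra k B]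
  [Ring D] [Algebra k D] [Ring E] [Algebra k E] [AddCommGroup V] [Module k V] [AddCommGroup W]
  [Module k W] [AddCommGroup U] [Module k U]

/-- The action of `B ⊗ D` on `V ⊗ W` given by `(b ⊗ d) (v ⊗ w) = b v ⊗ d w`. -/
noncomputable def tensorAct (ρ : B →ₐ[k] Module.End k V) (σ : D →ₐ[k] Module.End k W) :
    B ⊗[k] D →ₐ[k] Module.End k (V ⊗[k] W) :=
  (Module.endTensorEndAlgHom (R := k) (S := k) (A := k) (M := V) (N := W)).comp
    (Algebra.TensorProduct.map ρ σ)

@[simp] theorem tensorAct_tmul (ρ : B →ₐ[k] Module.End k V) (σ : D →ₐ[k] Module.End k W)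
    (b : B) (d : D) (v : V) (w : W) :
    tensorAct ρ σ (b ⊗ₜ d) (v ⊗ₜ w) = ρ b v ⊗ₜ σ d w := by
  simp only [tensorAct, AlgHom.comp_apply, Algebra.TensorProduct.map_tmul]
  rfl

theorem map_tensorAct {V' W' : Type u} [AddCommGroup V'] [Module k V'] [AddCommGroup W']
    [Module k W'] {ρ : B →ₐ[k] Module.End k V} {σ : D →ₐ[k] Module.End k W}
    {ρ' : B →ₐ[k] Module.End k V'} {σ' : D →ₐ[k] Module.End k W'} {f : V →ₗ[k] V'}
    {g : W →ₗ[k] W'} (hf : ∀ b v, f (ρ b v) = ρ' b (f v)) (hg : ∀ d w, g (σ d w) = σ' d (g w))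
    (z : B ⊗[k] D) (x : V ⊗[k] W) :
    TensorProduct.map f g (tensorAct ρ σ z x) = tensorAct ρ' σ' z (TensorProduct.map f g x) := by
  induction z with
  | zero => simp
  | add z₁ z₂ h₁ h₂ => simp [h₁, h₂]
  | tmul b d =>
    induction x with
    | zero => simp
    | add w₁ w₂ h₁ h₂ => simp only [map_add, h₁, h₂]
    | tmul x y => simp [hf, hg]

theorem tensorAct_left (f : A →ₐ[k] B) (ρ : B →ₐ[k] Module.End k V)
    (σ : D →ₐ[k] Module.End k W) (z : A ⊗[k] D) :
    tensorAct (ρ.comp f) σ z = tensorAct ρ σ (f.toLinearMap.rTensor D z) := by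
  induction z with
  | zero => simp
  | add z₁ z₂ h₁ h₂ => simp only [map_add, h₁, h₂]
  | tmul b d => ext x y; simp

theorem tensorAct_right (f : A →ₐ[k] D) (ρ : B →ₐ[k] Module.End k V)
    (σ : D →ₐ[k] Module.End k W) (z : B ⊗[k] A) :
    tensorAct ρ (σ.comp f) z = tensorAct ρ σ (f.toLinearMap.lTensor B z) := by
  induction z with
  | zero => simp
  | add z₁ z₂ h₁ h₂ => simp only [map_add, h₁, h₂]
  | tmul b d => ext x y; simp

theorem assoc_tensorAct (ρ : B →ₐ[k] Module.End k V) (σ : D →ₐ[k] Module.End k W)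
    (τ : E →ₐ[k] Module.End k U) (z : (B ⊗[k] D) ⊗[k] E) (x : (V ⊗[k] W) ⊗[k] U) :
    TensorProduct.assoc k V W U (tensorAct (tensorAct ρ σ) τ z x) =
      tensorAct ρ (tensorAct σ τ) (TensorProduct.assoc k B D E z)
        (TensorProduct.assoc k V W U x) := by
  have key : (TensorProduct.assoc k V W U).toLinearMap ∘ₗ tensorAct (tensorAct ρ σ) τ z =
      tensorAct ρ (tensorAct σ τ) (TensorProduct.assoc k B D E z) ∘ₗ
        (TensorProduct.assoc k V W U).toLinearMap := by
    induction z with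
    | zero => simp
    | add z₁ z₂ h₁ h₂ => simp only [map_add, LinearMap.comp_add, LinearMap.add_comp, h₁, h₂]
    | tmul y e =>
      induction y with
      | zero => simp
      | add z₁ z₂ h₁ h₂ =>
        simp only [add_tmul, map_add, LinearMap.comp_add, LinearMap.add_comp, h₁, h₂]
      | tmul b d => ext v w u; simp
  exact LinearMap.congr_fun key x

theorem lid_tensorAct (ρ : D →ₐ[k] Module.End k V) (χ : B →ₐ[k] k) (z : B ⊗[k] D)
    (w : k ⊗[k] V) :
    TensorProduct.lid k V (tensorAct ((Algebra.lmul k k).comp χ) ρ z w) =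
      ρ (TensorProduct.lid k D (χ.toLinearMap.rTensor D z)) (TensorProduct.lid k V w) := by
  rw [tensorAct_left]
  generalize χ.toLinearMap.rTensor D z = z
  induction z with
  | zero => simp
  | add z₁ z₂ h₁ h₂ => simp only [map_add, LinearMap.add_apply, h₁, h₂]
  | tmul b d =>
    induction w with
    | zero => simp
    | add w₁ w₂ h₁ h₂ => simp only [map_add, h₁, h₂]
    | tmul x y => simp [smul_smul, mul_comm]

theorem rid_tensorAct (ρ : D →ₐ[k] Module.End k V) (χ : B →ₐ[k] k) (z : D ⊗[k] B)
    (w : V ⊗[k] k) :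
    TensorProduct.rid k V (tensorAct ρ ((Algebra.lmul k k).comp χ) z w) =
      ρ (TensorProduct.rid k D (χ.toLinearMap.lTensor D z)) (TensorProduct.rid k V w) := by
  rw [tensorAct_right]
  generalize χ.toLinearMap.lTensor D z = z
  induction z with
  | zero => simp
  | add z₁ z₂ h₁ h₂ => simp only [map_add, LinearMap.add_apply, h₁, h₂]
  | tmul b d =>
    induction w with
    | zero => simp
    | add w₁ w₂ h₁ h₂ => simp only [map_add, h₁, h₂]
    | tmul x y => simp [smul_smul, mul_comm]

end TensorAct

/-- A finite-dimensional left module over the `k`-algebra `A`. -/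
structure FDMod (k A : Type u) [Field k] [Ring A] [Algebra k A] where
  /-- The underlying vector space. -/
  carrier : Type u
  [addCommGroup : AddCommGroup carrier]
  [module : Module k carrier]
  [finite : FiniteDimensional k carrier]
  /-- The action of the algebra. -/
  act : A →ₐ[k] Module.End k carrier

namespace FDMod

attribute [instance] addCommGroup module finite

section Basic

variable {k A : Type u} [Field k] [Ring A] [Algebra k A]

instance : CoeSort (FDMod k A) (Type u) := ⟨carrier⟩

/-- A morphism of modules. -/
@[ext]
structure Hom (V W : FDMod k A) where
  /-- The underlying linear map. -/
  hom : V →ₗ[k] W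
  comm (a : A) (v : V) : hom (V.act a v) = W.act a (hom v)

instance : Category (FDMod k A) where
  Hom V W := Hom V W
  id V := ⟨LinearMap.id, fun _ _ => rfl⟩
  comp f g := ⟨g.hom ∘ₗ f.hom, fun a v => by simp [f.comm, g.comm]⟩

@[ext]
theorem hom_ext {V W : FDMod k A} {f g : V ⟶ W} (h : Hom.hom f = Hom.hom g) : f = g :=
  Hom.ext h

@[simp] theorem id_hom (V : FDMod k A) : Hom.hom (𝟙 V) = LinearMap.id := rfl

@[simp] theorem comp_hom {U V W : FDMod k A} (f : U ⟶ V) (g : V ⟶ W) :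
    Hom.hom (f ≫ g) = Hom.hom g ∘ₗ Hom.hom f := rfl

/-- An isomorphism of modules from an equivariant linear equivalence. -/
def mkIso {V W : FDMod k A} (e : V ≃ₗ[k] W) (h : ∀ a v, e (V.act a v) = W.act a (e v)) :
    V ≅ W where
  hom := ⟨e.toLinearMap, h⟩
  inv := ⟨e.symm.toLinearMap, fun a w => by
    apply e.injective
    simp [h]⟩
  hom_inv_id := by ext v; exact e.symm_apply_apply v
  inv_hom_id := by ext v; exact e.apply_symm_apply v

@[simp] theorem mkIso_hom_hom {V W : FDMod k A} (e : V ≃ₗ[k] W) (h) :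
    Hom.hom (mkIso (V := V) (W := W) e h).hom = e.toLinearMap := rfl

@[simp] theorem mkIso_inv_hom {V W : FDMod k A} (e : V ≃ₗ[k] W) (h) :
    Hom.hom (mkIso (V := V) (W := W) e h).inv = e.symm.toLinearMap := rfl

/-- The regular module. -/
def regular (k A : Type u) [Field k] [Ring A] [Algebra k A] [FiniteDimensional k A] :
    FDMod k A where
  carrier := A
  act := Algebra.lmul k A

/-- The pullback of a module along an algebra map. -/
def restrict {B : Type u} [Ring B] [Algebra k B] (f : A →ₐ[k] B) (V : FDMod k B) :
    FDMod k A where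
  carrier := V
  act := V.act.comp f

/-- The pullback functor along an algebra map. -/
def restrictFunctor {B : Type u} [Ring B] [Algebra k B] (f : A →ₐ[k] B) :
    FDMod k B ⥤ FDMod k A where
  obj V := restrict f V
  map {V W} g := Hom.mk (V := restrict f V) (W := restrict f W)
    (Hom.hom (V := V) (W := W) g) fun a v => Hom.comm (V := V) (W := W) g (f a) v

/-- The tensor product of a `B`-module and a `D`-module, regarded as an `A`-module via an algebra
map `θ : A → B ⊗ D`: if `θ a = ∑ b ⊗ d`, then `a (x ⊗ y) = ∑ b x ⊗ d y`. -/
noncomputable def tensorAlong {B D : Type u} [Ring B] [Algebra k B] [Ring D] [Algebra k D]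
    (θ : A →ₐ[k] B ⊗[k] D) (X : FDMod k B) (Y : FDMod k D) : FDMod k A where
  carrier := X ⊗[k] Y
  act := (tensorAct X.act Y.act).comp θ

/-- The space of module homomorphisms. -/
def homSpace (V W : FDMod k A) : Submodule k (V →ₗ[k] W) where
  carrier := {f | ∀ a v, f (V.act a v) = W.act a (f v)}
  add_mem' hf hg a v := by simp [hf a v, hg a v]
  zero_mem' a v := by simp
  smul_mem' c f hf a v := by simp [hf a v]

/-- The tensor product of morphisms. -/
noncomputable def tensorAlongMap {B D : Type u} [Ring B] [Algebra k B] [Ring D] [Algebra k D]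
    (θ : A →ₐ[k] B ⊗[k] D) {X X' : FDMod k B} {Y Y' : FDMod k D} (f : X ⟶ X') (g : Y ⟶ Y') :
    tensorAlong θ X Y ⟶ tensorAlong θ X' Y' :=
  Hom.mk (V := tensorAlong θ X Y) (W := tensorAlong θ X' Y')
    (TensorProduct.map (Hom.hom f) (Hom.hom g))
    fun a w => map_tensorAct (Hom.comm f) (Hom.comm g) (θ a) w

@[simp] theorem tensorAlongMap_hom {B D : Type u} [Ring B] [Algebra k B] [Ring D] [Algebra k D]
    (θ : A →ₐ[k] B ⊗[k] D) {X X' : FDMod k B} {Y Y' : FDMod k D} (f : X ⟶ X') (g : Y ⟶ Y') :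
    Hom.hom (tensorAlongMap θ f g) = TensorProduct.map (Hom.hom f) (Hom.hom g) := rfl

variable {B D E B' E' : Type u} [Ring B] [Algebra k B] [Ring D] [Algebra k D] [Ring E]
  [Algebra k E] [Ring B'] [Algebra k B'] [Ring E'] [Algebra k E']

/-- The associator for tensor products, if the algebra maps are coassociative. -/
noncomputable def assocIso (f : A →ₐ[k] B' ⊗[k] E) (g : B' →ₐ[k] B ⊗[k] D)
    (f' : A →ₐ[k] B ⊗[k] E') (g' : E' →ₐ[k] D ⊗[k] E)
    (h : ∀ a, TensorProduct.assoc k B D E (g.toLinearMap.rTensor E (f a)) =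
      g'.toLinearMap.lTensor B (f' a))
    (X : FDMod k B) (Y : FDMod k D) (M : FDMod k E) :
    tensorAlong f (tensorAlong g X Y) M ≅ tensorAlong f' X (tensorAlong g' Y M) :=
  mkIso (V := tensorAlong f (tensorAlong g X Y) M) (W := tensorAlong f' X (tensorAlong g' Y M))
    (TensorProduct.assoc k X Y M) fun a (w : (X ⊗[k] Y) ⊗[k] M) => by
      change TensorProduct.assoc k X Y M (tensorAct ((tensorAct X.act Y.act).comp g) M.act (f a) w)
        = tensorAct X.act ((tensorAct Y.act M.act).comp g') (f' a) (TensorProduct.assoc k X Y M w)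
      rw [tensorAct_left, tensorAct_right, assoc_tensorAct, h]

@[simp] theorem assocIso_hom_hom (f : A →ₐ[k] B' ⊗[k] E) (g : B' →ₐ[k] B ⊗[k] D)
    (f' : A →ₐ[k] B ⊗[k] E') (g' : E' →ₐ[k] D ⊗[k] E) (h)
    (X : FDMod k B) (Y : FDMod k D) (M : FDMod k E) :
    Hom.hom (assocIso f g f' g' h X Y M).hom = (TensorProduct.assoc k X Y M).toLinearMap := rfl

@[simp] theorem assocIso_inv_hom (f : A →ₐ[k] B' ⊗[k] E) (g : B' →ₐ[k] B ⊗[k] D)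
    (f' : A →ₐ[k] B ⊗[k] E') (g' : E' →ₐ[k] D ⊗[k] E) (h)
    (X : FDMod k B) (Y : FDMod k D) (M : FDMod k E) :
    Hom.hom (assocIso f g f' g' h X Y M).inv = (TensorProduct.assoc k X Y M).symm.toLinearMap :=
  rfl

/-- The one-dimensional module given by an algebra map to the base field. -/
def ofCharacter (χ : A →ₐ[k] k) : FDMod k A where
  carrier := k
  act := (Algebra.lmul k k).comp χ

/-- The isomorphism `k ⊗ M ≅ M`, if the algebra map is counital. -/
noncomputable def lidIso (f : A →ₐ[k] B ⊗[k] A) (χ : B →ₐ[k] k)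
    (h : ∀ a, TensorProduct.lid k A (χ.toLinearMap.rTensor A (f a)) = a) (M : FDMod k A) :
    tensorAlong f (ofCharacter χ) M ≅ M :=
  mkIso (V := tensorAlong f (ofCharacter χ) M) (W := M) (TensorProduct.lid k M) fun a w =>
    (lid_tensorAct M.act χ (f a) w).trans (by rw [h]; rfl)

@[simp] theorem lidIso_hom_hom (f : A →ₐ[k] B ⊗[k] A) (χ : B →ₐ[k] k) (h) (M : FDMod k A) :
    Hom.hom (lidIso f χ h M).hom = (TensorProduct.lid k M).toLinearMap := rfl

@[simp] theorem lidIso_inv_hom (f : A →ₐ[k] B ⊗[k] A) (χ : B →ₐ[k] k) (h) (M : FDMod k A) :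
    Hom.hom (lidIso f χ h M).inv = (TensorProduct.lid k M).symm.toLinearMap := rfl

/-- The isomorphism `M ⊗ k ≅ M`, if the algebra map is counital. -/
noncomputable def ridIso (f : A →ₐ[k] A ⊗[k] B) (χ : B →ₐ[k] k)
    (h : ∀ a, TensorProduct.rid k A (χ.toLinearMap.lTensor A (f a)) = a) (M : FDMod k A) :
    tensorAlong f M (ofCharacter χ) ≅ M :=
  mkIso (V := tensorAlong f M (ofCharacter χ)) (W := M) (TensorProduct.rid k M) fun a w =>
    (rid_tensorAct M.act χ (f a) w).trans (by rw [h]; rfl)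

@[simp] theorem ridIso_hom_hom (f : A →ₐ[k] A ⊗[k] B) (χ : B →ₐ[k] k) (h) (M : FDMod k A) :
    Hom.hom (ridIso f χ h M).hom = (TensorProduct.rid k M).toLinearMap := rfl

@[simp] theorem ridIso_inv_hom (f : A →ₐ[k] A ⊗[k] B) (χ : B →ₐ[k] k) (h) (M : FDMod k A) :
    Hom.hom (ridIso f χ h M).inv = (TensorProduct.rid k M).symm.toLinearMap := rfl

end Basic

end FDMod

/-! ### Comodule algebras -/

/-- A left `H`-comodule algebra structure on the algebra `L`. -/
class LeftComoduleAlgebra (k H L : Type u) [Field k] [Ring H] [HopfAlgebra k H] [Ring L]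
    [Algebra k L] where
  /-- The coaction. -/
  coaction : L →ₐ[k] H ⊗[k] L
  coassoc (a : L) :
    TensorProduct.assoc k H H L ((Coalgebra.comul (R := k) (A := H)).rTensor L (coaction a)) =
      coaction.toLinearMap.lTensor H (coaction a)
  counit_coaction (a : L) :
    TensorProduct.lid k L ((Coalgebra.counit (R := k) (A := H)).rTensor L (coaction a)) = a

section DualAct

variable {k H V : Type u} [Field k] [Ring H] [HopfAlgebra k H] [AddCommGroup V] [Module k V]

/-- The action on the dual space: `⟨h f, x⟩ = ⟨f, S(h) x⟩`. -/
noncomputable def dualAct (ρ : H →ₐ[k] Module.End k V) :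
    H →ₐ[k] Module.End k (Module.Dual k V) :=
  AlgHom.ofLinearMap
    { toFun := fun h => Module.Dual.transpose (R := k) (ρ (HopfAlgebra.antipode k h))
      map_add' := fun a b => by simp
      map_smul' := fun c a => by simp }
    (by ext f x; simp [Module.Dual.transpose_apply])
    (fun a b => by
      ext f x
      simp [Module.Dual.transpose_apply, HopfAlgebra.antipode_mul_antidistrib])

@[simp] theorem dualAct_apply (ρ : H →ₐ[k] Module.End k V) (h : H) (f : Module.Dual k V) (x : V) :
    dualAct ρ h f x = f (ρ (HopfAlgebra.antipode k h) x) := rfl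

theorem contractLeft_equivariant (ρ : H →ₐ[k] Module.End k V) (h : H)
    (w : Module.Dual k V ⊗[k] V) :
    contractLeft k V (tensorAct (dualAct ρ) ρ (Coalgebra.comul (R := k) h) w) =
      Coalgebra.counit (R := k) h * contractLeft k V w := by
  have key : ∀ (z : H ⊗[k] H) (f : Module.Dual k V) (x : V),
      contractLeft k V (tensorAct (dualAct ρ) ρ z (f ⊗ₜ x)) =
        f (ρ (LinearMap.mul' k H ((HopfAlgebra.antipode k).rTensor H z)) x) := by
    intro z f x
    induction z with
    | zero => simp
    | add z₁ z₂ h₁ h₂ => simp only [map_add, LinearMap.add_apply, h₁, h₂]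
    | tmul b d => simp
  induction w with
  | zero => simp
  | add w₁ w₂ h₁ h₂ => simp only [map_add, h₁, h₂, mul_add]
  | tmul f x =>
    rw [key, HopfAlgebra.mul_antipode_rTensor_comul_apply]
    simp [Algebra.algebraMap_eq_smul_one]

theorem coevaluation_equivariant [FiniteDimensional k V] (ρ : H →ₐ[k] Module.End k V) (h : H)
    (c : k) :
    coevaluation k V (Coalgebra.counit (R := k) h * c) =
      tensorAct ρ (dualAct ρ) (Coalgebra.comul (R := k) h) (coevaluation k V c) := by
  let J : V ⊗[k] Module.Dual k V ≃ₗ[k] (V →ₗ[k] V) :=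
    (TensorProduct.comm k V (Module.Dual k V)).trans (dualTensorHomEquiv k V V)
  have hJ : ∀ (x : V) (f : Module.Dual k V) (y : V), J (x ⊗ₜ f) y = f y • x := by
    intro x f y
    simp [J]
  have hc : ∀ (c : k) (y : V), J (coevaluation k V c) y = c • y := by
    intro c y
    have : coevaluation k V c = c • coevaluation k V 1 := by
      rw [← map_smul, smul_eq_mul, mul_one]
    rw [this, map_smul, coevaluation_apply_one, LinearMap.smul_apply, map_sum,
      LinearMap.sum_apply]
    simp only [hJ]
    congr 1
    exact (Module.Basis.ofVectorSpace k V).sum_repr y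
  have key : ∀ (z : H ⊗[k] H) (w : V ⊗[k] Module.Dual k V) (hw : ∀ y, J w y = c • y) (y : V),
      J (tensorAct ρ (dualAct ρ) z w) y =
        c • ρ (LinearMap.mul' k H ((HopfAlgebra.antipode k).lTensor H z)) y := by
    intro z w hw y
    induction z with
    | zero => simp
    | add z₁ z₂ h₁ h₂ => simp only [map_add, LinearMap.add_apply, h₁, h₂, smul_add]
    | tmul b d =>
      have : J (tensorAct ρ (dualAct ρ) (b ⊗ₜ d) w) y =
          ρ b (J w (ρ (HopfAlgebra.antipode k d) y)) := by
        clear hw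
        induction w with
        | zero => simp
        | add w₁ w₂ h₁ h₂ => simp only [map_add, LinearMap.add_apply, h₁, h₂]
        | tmul x f => simp [hJ]
      rw [this, hw]
      simp
  apply J.injective
  ext y
  rw [hc, key _ _ (hc c), HopfAlgebra.mul_antipode_lTensor_comul_apply]
  simp [Algebra.algebraMap_eq_smul_one, mul_smul, smul_comm c]

end DualAct

namespace FDMod

section Hopf

variable {k H L : Type u} [Field k] [Ring H] [HopfAlgebra k H] [Ring L] [Algebra k L]

/-- The tensor product of modules over a Hopf algebra: `h (x ⊗ y) = h₁ x ⊗ h₂ y`, the unit object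
is the trivial module. -/
noncomputable instance : MonoidalCategoryStruct (FDMod k H) where
  tensorObj X Y := tensorAlong (Bialgebra.comulAlgHom k H) X Y
  tensorUnit := ofCharacter (Bialgebra.counitAlgHom k H)
  tensorHom f g := tensorAlongMap (Bialgebra.comulAlgHom k H) f g
  whiskerLeft X _ _ f := tensorAlongMap (Bialgebra.comulAlgHom k H) (𝟙 X) f
  whiskerRight f Y := tensorAlongMap (Bialgebra.comulAlgHom k H) f (𝟙 Y)
  associator X Y Z := assocIso (Bialgebra.comulAlgHom k H) (Bialgebra.comulAlgHom k H)
    (Bialgebra.comulAlgHom k H) (Bialgebra.comulAlgHom k H) (fun a => Coalgebra.coassoc_apply a)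
    X Y Z
  leftUnitor X := lidIso (Bialgebra.comulAlgHom k H) (Bialgebra.counitAlgHom k H)
    (fun a => by
      have := Coalgebra.rTensor_counit_comul (R := k) a
      exact (congrArg (TensorProduct.lid k H) this).trans (by simp)) X
  rightUnitor X := ridIso (Bialgebra.comulAlgHom k H) (Bialgebra.counitAlgHom k H)
    (fun a => by
      have := Coalgebra.lTensor_counit_comul (R := k) a
      exact (congrArg (TensorProduct.rid k H) this).trans (by simp)) X

noncomputable instance : MonoidalCategory (FDMod k H) where
  tensorHom_def f g := by
    apply hom_ext; exact TensorProduct.ext' fun x y => rfl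
  id_tensorHom_id X Y := by
    apply hom_ext; exact TensorProduct.ext' fun x y => rfl
  tensorHom_comp_tensorHom f₁ f₂ g₁ g₂ := by
    apply hom_ext; exact TensorProduct.ext' fun x y => rfl
  whiskerLeft_id X Y := by
    apply hom_ext; exact TensorProduct.ext' fun x y => rfl
  id_whiskerRight X Y := by
    apply hom_ext; exact TensorProduct.ext' fun x y => rfl
  associator_naturality f g h := by
    apply hom_ext; exact TensorProduct.ext_threefold fun x y z => rfl
  leftUnitor_naturality f := by
    apply hom_ext
    exact TensorProduct.ext' fun (c : k) x => (LinearMap.map_smul (Hom.hom f) c x).symm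
  rightUnitor_naturality f := by
    apply hom_ext
    exact TensorProduct.ext' fun x (c : k) => (LinearMap.map_smul (Hom.hom f) c x).symm
  pentagon W X Y Z := by
    apply hom_ext; exact TensorProduct.ext_fourfold fun w x y z => rfl
  triangle X Y := by
    apply hom_ext
    exact TensorProduct.ext_threefold fun x (c : k) y => (TensorProduct.smul_tmul c x y).symm

/-- The action of `H`-modules on `L`-modules for a left `H`-comodule algebra `L`:
`X ⊙ₗ M` is the vector space `X ⊗ M` with the action `a (x ⊗ m) = a₍₋₁₎ x ⊗ a₍₀₎ m`. -/
noncomputable instance [LeftComoduleAlgebra k H L] :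
    MonoidalLeftActionStruct (FDMod k H) (FDMod k L) where
  actionObj X M := tensorAlong (LeftComoduleAlgebra.coaction (k := k) (H := H) (L := L)) X M
  actionHomLeft f M := tensorAlongMap LeftComoduleAlgebra.coaction f (𝟙 M)
  actionHomRight X _ _ f := tensorAlongMap LeftComoduleAlgebra.coaction (𝟙 X) f
  actionHom f g := tensorAlongMap LeftComoduleAlgebra.coaction f g
  actionAssocIso X Y M := assocIso LeftComoduleAlgebra.coaction (Bialgebra.comulAlgHom k H)
    LeftComoduleAlgebra.coaction LeftComoduleAlgebra.coaction
    (fun a => LeftComoduleAlgebra.coassoc a) X Y M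
  actionUnitIso M := lidIso LeftComoduleAlgebra.coaction (Bialgebra.counitAlgHom k H)
    (fun a => LeftComoduleAlgebra.counit_coaction (H := H) a) M

noncomputable instance [LeftComoduleAlgebra k H L] :
    MonoidalLeftAction (FDMod k H) (FDMod k L) where
  actionHom_def f g := by
    apply hom_ext; exact TensorProduct.ext' fun x y => rfl
  actionHomRight_id X M := by
    apply hom_ext; exact TensorProduct.ext' fun x y => rfl
  id_actionHomLeft X M := by
    apply hom_ext; exact TensorProduct.ext' fun x y => rfl
  actionHom_comp f₁ f₂ g₁ g₂ := by
    apply hom_ext; exact TensorProduct.ext' fun x y => rfl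
  actionAssocIso_hom_naturality f g h := by
    apply hom_ext; exact TensorProduct.ext_threefold fun x y z => rfl
  actionUnitIso_hom_naturality f := by
    apply hom_ext
    exact TensorProduct.ext' fun (c : k) x => LinearMap.map_smul (Hom.hom f) c x
  whiskerLeft_actionHomLeft X _ _ f M := by
    apply hom_ext; exact TensorProduct.ext_threefold fun x y z => rfl
  whiskerRight_actionHomLeft X f M := by
    apply hom_ext; exact TensorProduct.ext_threefold fun x y z => rfl
  associator_actionHom X Y Z M := by
    apply hom_ext; exact TensorProduct.ext_fourfold fun w x y z => rfl
  leftUnitor_actionHom X M := by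
    apply hom_ext
    exact TensorProduct.ext_threefold fun (c : k) x y => rfl
  rightUnitor_actionHom X M := by
    apply hom_ext
    exact TensorProduct.ext_threefold fun x (c : k) y => TensorProduct.smul_tmul c x y

/-- The dual module: `⟨h f, x⟩ = ⟨f, S(h) x⟩`. -/
noncomputable def dualModule (X : FDMod k H) : FDMod k H where
  carrier := Module.Dual k X
  act := dualAct X.act

noncomputable instance (X : FDMod k H) : ExactPairing X (dualModule X) where
  coevaluation' := Hom.mk (V := 𝟙_ (FDMod k H)) (W := X ⊗ dualModule X) (coevaluation k X)
    fun h c => coevaluation_equivariant X.act h c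
  evaluation' := Hom.mk (V := dualModule X ⊗ X) (W := 𝟙_ (FDMod k H)) (contractLeft k X)
    fun h w => contractLeft_equivariant X.act h w
  coevaluation_evaluation' := by
    apply hom_ext
    exact contractLeft_assoc_coevaluation k X
  evaluation_coevaluation' := by
    apply hom_ext
    exact contractLeft_assoc_coevaluation' k X

noncomputable instance : RightRigidCategory (FDMod k H) where
  rightDual X := { rightDual := dualModule X }

section IHom

/-- The space of `L`-module maps `H ⊙ₗ M ⟶ N`, where `H` is the regular `H`-module. -/
noncomputable def ihomSpace (H : Type u) [Ring H] [HopfAlgebra k H] [LeftComoduleAlgebra k H L]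
    (M N : FDMod k L) : Submodule k (H ⊗[k] M →ₗ[k] N) where
  carrier := {f | ∀ (a : L) (w : H ⊗[k] M),
    f (tensorAct (Algebra.lmul k H) M.act (LeftComoduleAlgebra.coaction a) w) = N.act a (f w)}
  add_mem' hf hg a w := by simp [hf a w, hg a w]
  zero_mem' a w := by simp
  smul_mem' c f hf a w := by simp [hf a w]

theorem mulRight_tensorAct (M : FDMod k L) (h : H) (z : H ⊗[k] L) (w : H ⊗[k] M) :
    (LinearMap.mulRight k h).rTensor M (tensorAct (Algebra.lmul k H) M.act z w) =
      tensorAct (Algebra.lmul k H) M.act z ((LinearMap.mulRight k h).rTensor M w) :=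
  map_tensorAct (f := LinearMap.mulRight k h) (g := LinearMap.id)
    (fun b v => by simp [mul_assoc]) (fun _ _ => rfl) z w

/-- The `H`-module of `L`-module maps `H ⊙ₗ M ⟶ N` with the action
`(h f) (h' ⊗ m) = f (h' h ⊗ m)`. -/
noncomputable def ihomModule (H : Type u) [Ring H] [HopfAlgebra k H] [FiniteDimensional k H]
    [LeftComoduleAlgebra k H L] (M N : FDMod k L) : FDMod k H where
  carrier := ihomSpace H M N
  act := AlgHom.ofLinearMap
    { toFun := fun h =>
        { toFun := fun f => ⟨f.1 ∘ₗ (LinearMap.mulRight k h).rTensor M, fun a w => by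
            rw [LinearMap.comp_apply, mulRight_tensorAct, f.2]; rfl⟩
          map_add' := fun f g => by ext; rfl
          map_smul' := fun c f => by ext; rfl }
      map_add' := fun a b => by
        ext f h m
        simp [mul_add, add_tmul]
      map_smul' := fun c a => by
        ext f h m
        simp [← smul_tmul'] }
    (by ext f h m; simp)
    (fun a b => by ext f h m; simp [mul_assoc])

/-- The functor `N ↦ Hom_L (H ⊙ₗ M, N)`. -/
noncomputable def ihomFunctor (H : Type u) [Ring H] [HopfAlgebra k H] [FiniteDimensional k H]
    [LeftComoduleAlgebra k H L] (M : FDMod k L) : FDMod k L ⥤ FDMod k H where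
  obj N := ihomModule H M N
  map {N N'} g := Hom.mk (V := ihomModule H M N) (W := ihomModule H M N')
    { toFun := fun (f : ihomSpace H M N) =>
        (⟨Hom.hom g ∘ₗ f.1, fun a w => by
          rw [LinearMap.comp_apply, f.2, Hom.comm g]; rfl⟩ : ihomSpace H M N')
      map_add' := fun f f' => by
        apply Subtype.ext; exact LinearMap.comp_add _ _ _
      map_smul' := fun c f => by
        apply Subtype.ext; exact LinearMap.comp_smul _ _ _ }
    (fun h f => rfl)

variable [FiniteDimensional k H] [LeftComoduleAlgebra k H L]

/-- The map `X ⊙ₗ M ⟶ N` sending `x ⊗ m` to `G x (1 ⊗ m)`. -/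
noncomputable def ihomUncurry {X : FDMod k H} {M N : FDMod k L} (G : X ⟶ ihomModule H M N) :
    X ⊙ₗ M ⟶ N :=
  Hom.mk (V := X ⊙ₗ M) (W := N)
    (TensorProduct.lift
      (((TensorProduct.mk k H M 1).lcomp k N) ∘ₗ (ihomSpace H M N).subtype ∘ₗ Hom.hom G))
    fun a w => by
      have key : ∀ (z : H ⊗[k] L) (x : X) (m : M),
          TensorProduct.lift
            (((TensorProduct.mk k H M 1).lcomp k N) ∘ₗ (ihomSpace H M N).subtype ∘ₗ Hom.hom G)
            (tensorAct X.act M.act z (x ⊗ₜ m)) =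
          (Hom.hom G x : ihomSpace H M N).1
            (tensorAct (Algebra.lmul k H) M.act z (1 ⊗ₜ m)) := by
        intro z x m
        induction z with
        | zero => simp
        | add z₁ z₂ h₁ h₂ => simp only [map_add, LinearMap.add_apply, h₁, h₂]
        | tmul b d =>
          have := congrArg (fun f : ihomSpace H M N => f.1 ((1 : H) ⊗ₜ M.act d m)) (Hom.comm G b x)
          simp only [tensorAct_tmul, TensorProduct.lift.tmul]
          refine this.trans ?_
          change (Hom.hom G x : ihomSpace H M N).1 ((1 * b) ⊗ₜ M.act d m) = _
          simp
      change TensorProduct.lift _ (tensorAct X.act M.act (LeftComoduleAlgebra.coaction a) w) = _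
      refine TensorProduct.induction_on (motive := fun w : X ⊗[k] M => TensorProduct.lift
            (((TensorProduct.mk k H M 1).lcomp k N) ∘ₗ (ihomSpace H M N).subtype ∘ₗ Hom.hom G)
            (tensorAct X.act M.act (LeftComoduleAlgebra.coaction a) w) = N.act a
              (TensorProduct.lift (((TensorProduct.mk k H M 1).lcomp k N) ∘ₗ
                (ihomSpace H M N).subtype ∘ₗ Hom.hom G) w)) w ?_ ?_ ?_
      · simp
      · intro x m
        rw [key]
        exact (Hom.hom G x : ihomSpace H M N).2 a _
      · intro x y hx hy
        simp only [map_add, hx, hy]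

/-- The map `X ⟶ Hom_L (H ⊙ₗ M, N)` sending `x` to `h ⊗ m ↦ F (h x ⊗ m)`. -/
noncomputable def ihomCurry {X : FDMod k H} {M N : FDMod k L} (F : X ⊙ₗ M ⟶ N) :
    X ⟶ ihomModule H M N :=
  Hom.mk (V := X) (W := ihomModule H M N)
    { toFun := fun x =>
        (⟨(Hom.hom F : X ⊗[k] M →ₗ[k] N) ∘ₗ (X.act.toLinearMap.flip x).rTensor M, fun a w => by
          refine (congrArg (Hom.hom F : X ⊗[k] M →ₗ[k] N)
            (map_tensorAct (ρ' := X.act) (σ' := M.act) (g := LinearMap.id)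
              (fun b v => by simp) (fun _ _ => rfl) _ w)).trans ?_
          exact Hom.comm F a _⟩ : ihomSpace H M N)
      map_add' := fun x y => by
        apply Subtype.ext
        apply TensorProduct.ext'
        intro h m
        change (Hom.hom F : X ⊗[k] M →ₗ[k] N) (X.act h (x + y) ⊗ₜ m) =
          (Hom.hom F : X ⊗[k] M →ₗ[k] N) (X.act h x ⊗ₜ m) +
            (Hom.hom F : X ⊗[k] M →ₗ[k] N) (X.act h y ⊗ₜ m)
        rw [map_add, add_tmul]
        exact map_add (Hom.hom F) _ _
      map_smul' := fun c x => by
        apply Subtype.ext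
        apply TensorProduct.ext'
        intro h m
        change (Hom.hom F : X ⊗[k] M →ₗ[k] N) (X.act h (c • x) ⊗ₜ m) =
          c • (Hom.hom F : X ⊗[k] M →ₗ[k] N) (X.act h x ⊗ₜ m)
        rw [map_smul, ← smul_tmul']
        exact map_smul (Hom.hom F) _ _ }
    fun h x => by
      apply Subtype.ext
      apply TensorProduct.ext'
      intro h' m
      change (Hom.hom F : X ⊗[k] M →ₗ[k] N) (X.act h' (X.act h x) ⊗ₜ m) =
        (Hom.hom F : X ⊗[k] M →ₗ[k] N) (X.act (h' * h) x ⊗ₜ m)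
      simp

/-- The adjunction `- ⊙ₗ M ⊣ Hom_L (H ⊙ₗ M, -)`. -/
noncomputable def ihomAdj (H : Type u) [Ring H] [HopfAlgebra k H] [FiniteDimensional k H]
    [LeftComoduleAlgebra k H L] (M : FDMod k L) :
    MonoidalLeftAction.actionRight (FDMod k H) M ⊣ ihomFunctor H M :=
  Adjunction.mkOfHomEquiv
    { homEquiv := fun X N =>
        { toFun := fun F => ihomCurry (X := X) (M := M) (N := N) F
          invFun := fun G => ihomUncurry (X := X) (M := M) (N := N) G
          left_inv := fun F => by
            apply hom_ext
            apply TensorProduct.ext'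
            intro x m
            change (Hom.hom F : X ⊗[k] M →ₗ[k] N) (X.act 1 x ⊗ₜ m) = _
            rw [map_one]
            rfl
          right_inv := fun G => by
            apply hom_ext
            apply LinearMap.ext
            intro x
            apply Subtype.ext
            apply TensorProduct.ext'
            intro h m
            change (Hom.hom G (X.act h x) : ihomSpace H M N).1 ((1 : H) ⊗ₜ m) =
              (Hom.hom G x : ihomSpace H M N).1 (h ⊗ₜ m)
            rw [Hom.comm G]
            change (Hom.hom G x : ihomSpace H M N).1 ((1 * h : H) ⊗ₜ m) = _
            rw [one_mul] }
      homEquiv_naturality_left_symm := fun {X' X N} f G => by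
        apply hom_ext; exact TensorProduct.ext' fun x m => rfl
      homEquiv_naturality_right := fun {X N N'} F g => by
        apply hom_ext; apply LinearMap.ext; intro x
        rfl }

/-- The internal Hom functor of the category of finite-dimensional `L`-modules, regarded as a
module category over the category of finite-dimensional `H`-modules. -/
noncomputable def internalHom (k H L : Type u) [Field k] [Ring H] [HopfAlgebra k H]
    [FiniteDimensional k H] [Ring L] [Algebra k L] [LeftComoduleAlgebra k H L] :
    ModCat.InternalHom (FDMod k H) (FDMod k L) where
  obj M := ihomFunctor H M
  adj M := ihomAdj H M

end IHom

end Hopf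

end FDMod

/-! ### Integrals, cointegrals and Frobenius forms -/

section Integrals

variable {k H L : Type u} [Field k] [Ring H] [HopfAlgebra k H] [Ring L] [Algebra k L]

/-- `Λ` is a right integral in `H`: `Λ h = ε(h) Λ` for all `h`. -/
def IsRightIntegral (k : Type u) {H : Type u} [Field k] [Ring H] [HopfAlgebra k H] (Λ : H) :
    Prop :=
  ∀ h : H, Λ * h = Coalgebra.counit (R := k) h • Λ

/-- `μ` is a right cointegral on `H`: `⟨μ, h₁⟩ h₂ = ⟨μ, h⟩ 1` for all `h`. -/
def IsRightCointegral (μ : H →ₗ[k] k) : Prop :=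
  ∀ h : H, TensorProduct.lid k H (μ.rTensor H (Coalgebra.comul h)) = μ h • (1 : H)

/-- `α` is the right modular function on `H`: `h Λ = α(h) Λ` for all `h`, where `Λ` is a non-zero
right integral in `H`. -/
def IsModularFunction (Λ : H) (α : H →ₐ[k] k) : Prop :=
  ∀ h : H, h * Λ = α h • Λ

/-- `g` is the distinguished grouplike element of `H`: `h₁ ⟨μ, h₂⟩ = ⟨μ, h⟩ g` for all `h`, where
`μ` is a non-zero right cointegral on `H`. -/
def IsDistinguishedGrouplike (μ : H →ₗ[k] k) (g : H) : Prop :=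
  ∀ h : H, TensorProduct.rid k H (μ.lTensor H (Coalgebra.comul h)) = μ h • g

/-- `μ` is a `g`-cointegral on the left `H`-comodule algebra `L`: `a₍₋₁₎ ⟨μ, a₍₀₎⟩ = ⟨μ, a⟩ g` for
all `a`. -/
def IsGrouplikeCointegral [LeftComoduleAlgebra k H L] (g : GroupLike k H) (μ : L →ₗ[k] k) : Prop :=
  ∀ a : L, TensorProduct.rid k H (μ.lTensor H (LeftComoduleAlgebra.coaction a)) = μ a • (g : H)

/-- The map `L → L*`, `a ↦ (b ↦ μ (a b))`. -/
noncomputable def frobeniusMap (μ : L →ₗ[k] k) : L →ₗ[k] Module.Dual k L :=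
  (LinearMap.mul k L).compr₂ μ

@[simp] theorem frobeniusMap_apply (μ : L →ₗ[k] k) (a b : L) :
    frobeniusMap μ a b = μ (a * b) := rfl

/-- `μ` is a Frobenius form on `L`. -/
def IsFrobeniusForm (μ : L →ₗ[k] k) : Prop :=
  Function.Bijective (frobeniusMap μ)

namespace IsFrobeniusForm

variable {μ : L →ₗ[k] k} (hμ : IsFrobeniusForm μ)

/-- The linear map `ν` with `μ (ν(a) b) = μ (b a)`. -/
noncomputable def nakayamaLinear : L →ₗ[k] L :=
  (LinearEquiv.ofBijective (frobeniusMap μ) hμ).symm.toLinearMap ∘ₗ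
    (LinearMap.mul k L).flip.compr₂ μ

theorem nakayamaLinear_spec (a b : L) : μ (hμ.nakayamaLinear a * b) = μ (b * a) := by
  have := (LinearEquiv.ofBijective (frobeniusMap μ) hμ).apply_symm_apply
    ((LinearMap.mul k L).flip.compr₂ μ a)
  exact LinearMap.congr_fun this b

theorem eq_of_forall {μ : L →ₗ[k] k} (hμ : IsFrobeniusForm μ) {a a' : L} (h : ∀ b, μ (a * b) = μ (a' * b)) : a = a' :=
  hμ.1 (LinearMap.ext h)

/-- The Nakayama automorphism of `L` with respect to the Frobenius form `μ`: the algebra map `ν`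
with `μ (ν(a) b) = μ (b a)`. -/
noncomputable def nakayama : L →ₐ[k] L :=
  AlgHom.ofLinearMap hμ.nakayamaLinear
    (hμ.eq_of_forall fun b => by rw [nakayamaLinear_spec, mul_one, one_mul])
    (fun x y => hμ.eq_of_forall fun b => by
      rw [nakayamaLinear_spec, mul_assoc, nakayamaLinear_spec, mul_assoc, nakayamaLinear_spec,
        mul_assoc])

theorem nakayama_spec (a b : L) : μ (hμ.nakayama a * b) = μ (b * a) := hμ.nakayamaLinear_spec a b

/-- The algebra map `a ↦ ⟨α, ν(a)₍₋₁₎⟩ ν(a)₍₀₎`, where `ν` is the Nakayama automorphism. -/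
noncomputable def twistedNakayama [LeftComoduleAlgebra k H L] (α : H →ₐ[k] k) : L →ₐ[k] L :=
  ((Algebra.TensorProduct.lid k L).toAlgHom.comp
    ((Algebra.TensorProduct.map α (AlgHom.id k L)).comp LeftComoduleAlgebra.coaction)).comp
    hμ.nakayama

/-- The functor `S` with `S(M) = M` as a vector space, where `a ∈ L` acts on `S(M)` as
`⟨α, ν(a)₍₋₁₎⟩ ν(a)₍₀₎` acts on `M`. -/
noncomputable def serreFunctor [LeftComoduleAlgebra k H L] (α : H →ₐ[k] k) :
    FDMod k L ⥤ FDMod k L :=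
  FDMod.restrictFunctor (hμ.twistedNakayama α)

end IsFrobeniusForm

/-- The elements `t i` of the `L`-module `P` and the `L`-module maps `t' i : P ⟶ L` satisfy
`∑ i, t' i (x) • t i = x` for all `x`. -/
def IsDualBasis [FiniteDimensional k L] {P : FDMod k L} {n : ℕ} (t : Fin n → P)
    (t' : Fin n → (P ⟶ FDMod.regular k L)) : Prop :=
  ∀ x : P, ∑ i, P.act (FDMod.Hom.hom (t' i) x : L) (t i) = x

/-- For every `L`-module `M`, the `L`-module `H ⊙ₗ M` has a dual basis, and the trace on `M` is
given by `ξ ↦ ∑ i, ⟨μ, t' i (Λ ⊗ ξ (t i))⟩` for every dual basis `t`, `t'` of `H ⊙ₗ M`. -/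
def HasTraceFormula [FiniteDimensional k H] [FiniteDimensional k L] [LeftComoduleAlgebra k H L]
    {μ : L →ₗ[k] k} {hμ : IsFrobeniusForm μ} {α : H →ₐ[k] k} (Λ : H)
    (φ : ModCat.RelativeSerre (FDMod.internalHom k H L) (hμ.serreFunctor α)) : Prop :=
  ∀ M : FDMod k L,
    (∃ (n : ℕ) (t : Fin n → (FDMod.regular k H ⊙ₗ M : FDMod k L))
      (t' : Fin n → ((FDMod.regular k H ⊙ₗ M : FDMod k L) ⟶ FDMod.regular k L)),
      IsDualBasis t t') ∧
    ∀ (n : ℕ) (t : Fin n → (FDMod.regular k H ⊙ₗ M : FDMod k L))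
      (t' : Fin n → ((FDMod.regular k H ⊙ₗ M : FDMod k L) ⟶ FDMod.regular k L)),
      IsDualBasis t t' →
        ∀ ξ : FDMod.ihomSpace H M ((hμ.serreFunctor α).obj M),
          (FDMod.Hom.hom (φ.trace M) ξ : k) =
            ∑ i, μ (FDMod.Hom.hom (t' i) (Λ ⊗ₜ[k] (ξ.1 (t i) : M)) : L)

end Integrals

/-! ### Sweedler calculus with integrals and cointegrals -/

namespace TensorProduct

variable {k V W : Type*} [Field k] [AddCommGroup V] [Module k V] [AddCommGroup W] [Module k W]

/-! Write `g` for `g_L` and call `w ↦ F(w) n`, with `F : H ⊙ₗ M ⟶ L`, a rank-one map. Exactness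
makes `H ⊙ₗ M` projective, so rank-one maps span `[M, N]`. On them the trace has the value `λ_L(F(Λ
⊗ y))`, whatever the dual basis (`traceOf_rankOne`): the Nakayama automorphism and `h Λ = α(h) Λ`
are what makes the sum collapse. Right invariance of `Λ` makes the trace `H`-linear. The module `H
⊙ₗ L` is free on `H ⊗ 1`, and the cointegral property says that its coordinates followed by `λ_L`
are `h ⊗ b ↦ ⟨p, g⁻¹ h⟩ λ_L(b)`. Splitting a composite through `H ⊙ₗ L` gives the key formula `⟨ζ,
F(-) n⟩ = λ_L(F(Λ₂ ⊗ ζ(g⁻¹ Λ₁ ⊗ n)))` (`pairing_rankOne`). The functionals `λ_L ∘ F` separate the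
points of `H ⊗ M`, and each leg of `Δ(Λ)` spans `H`, so the pairing is perfect; `φ` is its inverse.
For `θ ∈ X*` let `ζ_θ` represent the functional `ξ ↦ ⟨ζ, ξ ⊗ θ⟩`. The key formula turns this into
`Λ₂ ⊗ ζ_θ(g⁻¹ Λ₁ ⊗ n) = Λ₂ ⊗ θ(S(Λ₃) ζ(g⁻¹ Λ₁ ⊗ n))`, where `θ` contracts the factor `X`. The
identity `Λ₁ ⊗ S(Λ₂) = Λ₂ ⊗ S³(Λ₁) g_H` solves it: `ζ_θ(h ⊗ n) = θ(S³(h₁) g⁻¹ g_H ζ(h₂ ⊗ n))`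
(`slice_serreLin`). Summing over a dual basis of `X`, with `h` acting on `X**` through `S²`, the
product `S²(h₁) S³(h₂) = S²(h₁ S(h₂))` cancels and `x ⊗ m ↦ Φ(g⁻¹ g_H x) ⊗ m` remains. As `g⁻¹ g_H`
is grouplike, this is monoidal in `X`. The general formula is not derived independently: under the
cointegral hypothesis its right-hand side is evaluated and equals the same map (`sum_eval_tmul_eq`).
-/

/-- Elements of `V ⊗ W` are separated by the functionals on `V`. -/
theorem eq_of_forall_rTensor {z w : V ⊗[k] W}
    (h : ∀ p : V →ₗ[k] k, TensorProduct.lid k W (p.rTensor W z) =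
      TensorProduct.lid k W (p.rTensor W w)) : z = w := by
  classical
  let b := Module.Basis.ofVectorSpace k V
  apply (TensorProduct.equivFinsuppOfBasisLeft (N := W) b).injective
  ext i
  have key : ∀ z : V ⊗[k] W, TensorProduct.equivFinsuppOfBasisLeft (N := W) b z i =
      TensorProduct.lid k W ((b.coord i).rTensor W z) := by
    intro z
    induction z with
    | zero => simp
    | add x y hx hy => simp only [map_add, Finsupp.add_apply, hx, hy]
    | tmul x y => simp
  rw [key, key, h]

end TensorProduct

section Cancel

variable {k H V : Type*} [Field k] [Ring H] [HopfAlgebra k H] [AddCommGroup V] [Module k V]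

/-- If `m (h₁ ⊗ h₂) = ε(h) 1` for all `h`, then `m (v₍₋₂₎ ⊗ v₍₋₁₎) ⊗ v₍₀₎ = 1 ⊗ v` in a
left comodule. -/
theorem rTensor_coaction_cancel {δ : V →ₗ[k] H ⊗[k] V}
    (hδ : ∀ v, TensorProduct.assoc k H H V ((Coalgebra.comul (R := k)).rTensor V (δ v)) =
      δ.lTensor H (δ v))
    (hε : ∀ v, TensorProduct.lid k V ((Coalgebra.counit (R := k)).rTensor V (δ v)) = v)
    (m : H ⊗[k] H →ₗ[k] H)
    (hm : ∀ h : H, m (Coalgebra.comul (R := k) h) = Coalgebra.counit (R := k) h • (1 : H)) (v : V) :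
    m.rTensor V ((TensorProduct.assoc k H H V).symm (δ.lTensor H (δ v))) = 1 ⊗ₜ v := by
  rw [← hδ, LinearEquiv.symm_apply_apply, ← LinearMap.comp_apply, ← LinearMap.rTensor_comp]
  conv_rhs => rw [← hε v]
  generalize δ v = z
  induction z with
  | zero => simp
  | add x y hx hy => simp only [map_add, tmul_add, hx, hy]
  | tmul h w => simp [hm, smul_tmul]

/-- If `m (h₁ ⊗ h₂) = ε(h) 1` for all `h`, then `h₁ ⊗ m (h₂ ⊗ h₃) = h ⊗ 1`. -/
theorem lTensor_comul_cancel (m : H ⊗[k] H →ₗ[k] H)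
    (hm : ∀ h : H, m (Coalgebra.comul (R := k) h) = Coalgebra.counit (R := k) h • (1 : H)) (h : H) :
    m.lTensor H (TensorProduct.assoc k H H H
      ((Coalgebra.comul (R := k)).rTensor H (Coalgebra.comul (R := k) h))) = h ⊗ₜ 1 := by
  rw [Coalgebra.coassoc_apply, ← LinearMap.comp_apply, ← LinearMap.lTensor_comp]
  have hε : TensorProduct.rid k H ((Coalgebra.counit (R := k)).lTensor H
      (Coalgebra.comul (R := k) h)) = h := by simp
  conv_rhs => rw [← hε]
  generalize Coalgebra.comul (R := k) h = z
  induction z with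
  | zero => simp
  | add x y hx hy => simp only [map_add, add_tmul, hx, hy]
  | tmul h w => simp [hm, smul_tmul]

end Cancel

/-! ### Integrals and cointegrals of a Hopf algebra -/

section HopfIntegrals

variable {k H : Type u} [Field k] [Ring H] [HopfAlgebra k H]

open HopfAlgebra Coalgebra

/-- The map `a ⊗ b ↦ S(a) b`. -/
noncomputable def antipodeMul (k H : Type u) [Field k] [Ring H] [HopfAlgebra k H] :
    H ⊗[k] H →ₗ[k] H :=
  LinearMap.mul' k H ∘ₗ (antipode k).rTensor H

/-- The map `a ⊗ b ↦ a S(b)`. -/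
noncomputable def mulAntipode (k H : Type u) [Field k] [Ring H] [HopfAlgebra k H] :
    H ⊗[k] H →ₗ[k] H :=
  LinearMap.mul' k H ∘ₗ (antipode k).lTensor H

@[simp] theorem antipodeMul_tmul (a b : H) : antipodeMul k H (a ⊗ₜ b) = antipode k a * b := by
  simp [antipodeMul]

@[simp] theorem mulAntipode_tmul (a b : H) : mulAntipode k H (a ⊗ₜ b) = a * antipode k b := by
  simp [mulAntipode]

theorem antipodeMul_comul (h : H) :
    antipodeMul k H (comul (R := k) h) = counit (R := k) h • (1 : H) := by
  simp [antipodeMul, Algebra.algebraMap_eq_smul_one]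

theorem mulAntipode_comul (h : H) :
    mulAntipode k H (comul (R := k) h) = counit (R := k) h • (1 : H) := by
  simp [mulAntipode, Algebra.algebraMap_eq_smul_one]

/-- The identity `h₁ ⊗ h₂ S(h₃) = h ⊗ 1`, with the first two legs grouped as a coproduct. It
rewrites `Δ(Λ)(h ⊗ 1)` as `Δ(Λ h₁)(1 ⊗ S(h₂))`, where invariance of `Λ` applies. -/
theorem sum_comul_mul_antipode {ι : Type*} {s : Finset ι} {x y : ι → H} {h : H}
    (hxy : ∑ i ∈ s, x i ⊗ₜ[k] y i = comul (R := k) h) :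
    ∑ i ∈ s, comul (R := k) (x i) * (1 ⊗ₜ[k] antipode k (y i)) = h ⊗ₜ 1 := by
  rw [← lTensor_comul_cancel (mulAntipode k H) mulAntipode_comul h, ← hxy]
  simp only [map_sum, LinearMap.rTensor_tmul]
  refine Finset.sum_congr rfl fun i _ => ?_
  generalize comul (R := k) (x i) = z
  induction z with
  | zero => simp
  | add x y hx hy => simp only [map_add, add_mul, add_tmul, hx, hy]
  | tmul h w => simp

/-- The mirror cancellation `S(v₍₋₂₎) v₍₋₁₎ ⊗ v₍₀₎ = 1 ⊗ v`, with the last two legs grouped as a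
coaction. -/
theorem sum_antipode_mul_coaction {V : Type*} [Ring V] [Algebra k V] {δ : V →ₗ[k] H ⊗[k] V}
    (hδ : ∀ v, TensorProduct.assoc k H H V ((Coalgebra.comul (R := k)).rTensor V (δ v)) =
      δ.lTensor H (δ v))
    (hε : ∀ v, TensorProduct.lid k V ((Coalgebra.counit (R := k)).rTensor V (δ v)) = v)
    {ι : Type*} {s : Finset ι} {x : ι → H} {y : ι → V} {v : V}
    (hxy : ∑ i ∈ s, x i ⊗ₜ[k] y i = δ v) :
    ∑ i ∈ s, (antipode k (x i) ⊗ₜ[k] 1) * δ (y i) = 1 ⊗ₜ v := by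
  rw [← rTensor_coaction_cancel hδ hε (antipodeMul k H) antipodeMul_comul v, ← hxy]
  simp only [map_sum, LinearMap.lTensor_tmul]
  refine Finset.sum_congr rfl fun i _ => ?_
  generalize δ (y i) = z
  induction z with
  | zero => simp
  | add x y hx hy => simp only [map_add, mul_add, tmul_add, hx, hy]
  | tmul h w => simp

theorem sum_antipode_mul_comul {ι : Type*} {s : Finset ι} {x y : ι → H} {h : H}
    (hxy : ∑ i ∈ s, x i ⊗ₜ[k] y i = comul (R := k) h) :
    ∑ i ∈ s, (antipode k (x i) ⊗ₜ[k] 1) * comul (R := k) (y i) = 1 ⊗ₜ h :=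
  sum_antipode_mul_coaction (δ := comul (R := k)) (fun v => Coalgebra.coassoc_apply v)
    (fun v => by simp) hxy

/-- `⟨μ, Λ₁ h⟩ Λ₂ = S(h)` for a right integral `Λ` and a right cointegral `μ`. -/
theorem IsRightIntegral.sum_cointegral_smul_right {Λ : H} (hΛ : IsRightIntegral k Λ)
    {μ : H →ₗ[k] k} (hμ : IsRightCointegral μ) (hn : μ Λ = 1) {ι : Type*} {s : Finset ι}
    {x y : ι → H} (hxy : ∑ i ∈ s, x i ⊗ₜ[k] y i = comul (R := k) Λ) (h : H) :
    ∑ i ∈ s, μ (x i * h) • y i = antipode k h := by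
  have key : ∀ (z : H ⊗[k] H) (c : H), TensorProduct.lid k H (μ.rTensor H (z * (1 ⊗ₜ[k] c))) =
      TensorProduct.lid k H (μ.rTensor H z) * c := by
    intro z c
    induction z with
    | zero => simp
    | add x y hx hy => simp only [map_add, add_mul, hx, hy]
    | tmul u v => simp
  have hL : ∑ i ∈ s, μ (x i * h) • y i =
      TensorProduct.lid k H (μ.rTensor H (comul (R := k) Λ * (h ⊗ₜ[k] 1))) := by
    rw [← hxy]
    simp [Finset.sum_mul]
  -- `Δ(Λ)(h ⊗ 1) = Δ(Λ h₁)(1 ⊗ S(h₂)) = Δ(Λ)(1 ⊗ S(h))`; contracting the first leg with the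
  -- cointegral leaves `S(h)`.
  rw [hL, ← sum_comul_mul_antipode (ℛ k h).eq, Finset.mul_sum]
  simp only [← mul_assoc, ← Bialgebra.comul_mul, map_sum, key]
  simp only [hμ _, hΛ _, map_smul, hn, smul_mul_assoc, one_mul]
  conv_rhs => rw [← Coalgebra.sum_counit_smul (ℛ k h)]
  simp

/-- `⟨μ, Λ₂ h⟩ S(Λ₁) g = h` for a right integral `Λ` and a right cointegral `μ` with distinguished
grouplike element `g`. -/
theorem IsRightIntegral.sum_cointegral_smul_antipode_left {Λ : H} (hΛ : IsRightIntegral k Λ)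
    {μ : H →ₗ[k] k} (hn : μ Λ = 1) {g : H}
    (hg : IsDistinguishedGrouplike μ g) {ι : Type*} {s : Finset ι}
    {x y : ι → H} (hxy : ∑ i ∈ s, x i ⊗ₜ[k] y i = comul (R := k) Λ) (h : H) :
    ∑ i ∈ s, μ (y i * h) • (antipode k (x i) * g) = h := by
  have key : ∀ (z : H ⊗[k] H) (c : H), TensorProduct.rid k H (μ.lTensor H ((c ⊗ₜ[k] 1) * z)) =
      c * TensorProduct.rid k H (μ.lTensor H z) := by
    intro z c
    induction z with
    | zero => simp
    | add x y hx hy => simp only [map_add, mul_add, hx, hy]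
    | tmul u v => simp
  -- Two evaluations of `(1 ⊗ Λ) Δ(h)` under `id ⊗ μ` are compared. Here `h₁ μ(Λ h₂) = h₁ ε(h₂) =
  -- h`.
  have hR : TensorProduct.rid k H (μ.lTensor H ((1 ⊗ₜ[k] Λ) * comul (R := k) h)) = h := by
    rw [← (ℛ k h).eq, Finset.mul_sum]
    simp only [Algebra.TensorProduct.tmul_mul_tmul, one_mul, hΛ _, map_sum, LinearMap.lTensor_tmul,
      TensorProduct.rid_tmul, map_smul, hn, smul_eq_mul, mul_one]
    have := congrArg (TensorProduct.rid k H) (Coalgebra.sum_tmul_counit_eq (R := k) (ℛ k h))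
    simpa only [map_sum, TensorProduct.rid_tmul, one_smul] using this
  -- For the second evaluation `1 ⊗ Λ = S(Λ₁) Λ₂ ⊗ Λ₃`, so the element is `(S(Λ₁) ⊗ 1) Δ(Λ₂ h)`, and
  -- `μ` on the last leg produces `g`.
  rw [← sum_antipode_mul_comul hxy, Finset.sum_mul] at hR
  conv_rhs => rw [← hR]
  simp only [mul_assoc, ← Bialgebra.comul_mul, map_sum, key, hg _, mul_smul_comm]

/-- The distinguished grouplike element is grouplike. -/
theorem IsDistinguishedGrouplike.isGroupLikeElem {Λ : H} {μ : H →ₗ[k] k} (hn : μ Λ = 1) {g : H}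
    (hg : IsDistinguishedGrouplike μ g) : IsGroupLikeElem k g where
  counit_eq_one := by
    have h1 := congrArg (counit (R := k)) (hg Λ)
    rw [hn, one_smul] at h1
    rw [← h1, ← (ℛ k Λ).eq]
    have := congrArg (fun z => μ (TensorProduct.lid k H z))
      (Coalgebra.sum_counit_tmul_eq (R := k) (ℛ k Λ))
    simp only [map_sum, TensorProduct.lid_tmul, map_smul, smul_eq_mul, one_mul, hn] at this
    simp only [map_sum, LinearMap.lTensor_tmul, TensorProduct.rid_tmul, map_smul, smul_eq_mul]
    rw [← this]
    exact Finset.sum_congr rfl fun i _ => mul_comm _ _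
  comul_eq_tmul_self := by
    -- Since `g = Λ₁ μ(Λ₂)`, coassociativity gives `Δ(g) = Λ₁ ⊗ Λ₂ μ(Λ₃) = Λ₁ μ(Λ₂) ⊗ g = g ⊗ g`.
    have h1 := hg Λ
    rw [hn, one_smul] at h1
    have e1 : ∀ z : H ⊗[k] H, comul (R := k) (TensorProduct.rid k H (μ.lTensor H z)) =
        (TensorProduct.rid k H ∘ₗ μ.lTensor H).lTensor H
          (TensorProduct.assoc k H H H ((comul (R := k)).rTensor H z)) := by
      intro z
      induction z with
      | zero => simp
      | add x y hx hy => simp only [map_add, hx, hy]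
      | tmul u v =>
        simp only [LinearMap.lTensor_tmul, TensorProduct.rid_tmul, map_smul,
          LinearMap.rTensor_tmul]
        generalize comul (R := k) u = w
        induction w with
        | zero => simp
        | add x y hx hy => simp only [map_add, smul_add, add_tmul, hx, hy]
        | tmul a b => simp
    have e2 : (TensorProduct.rid k H ∘ₗ μ.lTensor H) ∘ₗ comul (R := k) = μ.smulRight g :=
      LinearMap.ext fun h => hg h
    have e3 : ∀ z : H ⊗[k] H, (μ.smulRight g).lTensor H z =
        TensorProduct.rid k H (μ.lTensor H z) ⊗ₜ g := by
      intro z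
      induction z with
      | zero => simp
      | add x y hx hy => simp only [map_add, add_tmul, hx, hy]
      | tmul a b => simp [smul_tmul]
    conv_lhs => rw [← h1, e1, Coalgebra.coassoc_apply, ← LinearMap.comp_apply,
      ← LinearMap.lTensor_comp, e2, e3, h1]

/-! ### Consequences of the reconstruction formulas: both legs of `Δ(Λ)` span `H` -/

section Frobenius

variable {Λ : H} {μ : H →ₗ[k] k} {g : H}

/-- Reconstruction applied to `h g` writes it as a combination of elements `S(Λ₁) g`; cancelling `g`
by `S(g)` puts `h` in the image of `S`. -/
theorem IsRightIntegral.antipode_surjective (hΛ : IsRightIntegral k Λ) (hn : μ Λ = 1)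
    (hg : IsDistinguishedGrouplike μ g) : Function.Surjective (antipode k : H →ₗ[k] H) := by
  intro h
  have hgl := hg.isGroupLikeElem hn
  refine ⟨∑ i ∈ (ℛ k Λ).index, μ ((ℛ k Λ).right i * (h * g)) • (ℛ k Λ).left i, ?_⟩
  have h1 := hΛ.sum_cointegral_smul_antipode_left hn hg (ℛ k Λ).eq (h * g)
  have h2 := congrArg (· * antipode k g) h1
  simp only [Finset.sum_mul, smul_mul_assoc, mul_assoc, hgl.mul_antipode_cancel, mul_one] at h2
  simpa using h2

theorem IsRightIntegral.antipode_bijective [FiniteDimensional k H] (hΛ : IsRightIntegral k Λ)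
    (hn : μ Λ = 1) (hg : IsDistinguishedGrouplike μ g) :
    Function.Bijective (antipode k : H →ₗ[k] H) :=
  ⟨LinearMap.injective_iff_surjective.2 (hΛ.antipode_surjective hn hg),
    hΛ.antipode_surjective hn hg⟩

/-- Every functional on `H` has the form `⟨μ, - h⟩` for a right cointegral `μ`. -/
theorem IsRightIntegral.exists_eq_cointegral_mul [FiniteDimensional k H]
    (hΛ : IsRightIntegral k Λ) (hn : μ Λ = 1) (hg : IsDistinguishedGrouplike μ g)
    (p : H →ₗ[k] k) : ∃ h, ∀ z, p z = μ (z * h) := by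
  let F : H →ₗ[k] Module.Dual k H := (LinearMap.mul k H).flip.compr₂ μ
  -- Reconstruction recovers `h` from the scalars `μ(Λ₂ h)`, so `F` has no kernel; dimensions do the
  -- rest.
  have hF : Function.Injective F := by
    rw [← LinearMap.ker_eq_bot, LinearMap.ker_eq_bot']
    intro h hh
    rw [← hΛ.sum_cointegral_smul_antipode_left hn hg (ℛ k Λ).eq h]
    refine Finset.sum_eq_zero fun i _ => ?_
    have : μ ((ℛ k Λ).right i * h) = 0 := LinearMap.congr_fun hh _
    rw [this, zero_smul]
  have hF' : Function.Surjective F :=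
    (LinearMap.injective_iff_surjective_of_finrank_eq_finrank
      (Subspace.dual_finrank_eq (K := k) (V := H)).symm).1 hF
  obtain ⟨h, hh⟩ := hF' p
  exact ⟨h, fun z => (LinearMap.congr_fun hh z).symm⟩

/-- `Λ₁ ⊗ S(Λ₂) = Λ₂ ⊗ S³(Λ₁) g`. -/
theorem IsRightIntegral.sum_tmul_antipode [FiniteDimensional k H]
    (hΛ : IsRightIntegral k Λ) (hμ : IsRightCointegral μ) (hn : μ Λ = 1)
    (hg : IsDistinguishedGrouplike μ g) {ι : Type*} {s : Finset ι}
    {x y : ι → H} (hxy : ∑ i ∈ s, x i ⊗ₜ[k] y i = comul (R := k) Λ) :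
    ∑ i ∈ s, x i ⊗ₜ[k] antipode k (y i) =
      ∑ i ∈ s, y i ⊗ₜ[k] (antipode k (antipode k (antipode k (x i))) * g) := by
  have hgl := hg.isGroupLikeElem hn
  apply TensorProduct.eq_of_forall_rTensor
  intro p
  -- Against `μ(- h)` both sides become `S²(h)`: the left one is `S` applied to `μ(Λ₁ h) Λ₂ = S(h)`,
  -- the right one is `S²` applied to `μ(Λ₂ h) S(Λ₁) g = h`, using `S²(g) = g`.
  obtain ⟨h, hp⟩ := hΛ.exists_eq_cointegral_mul hn hg p
  simp only [map_sum, LinearMap.rTensor_tmul, TensorProduct.lid_tmul, hp]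
  have h1 := congrArg (antipode k) (hΛ.sum_cointegral_smul_right hμ hn hxy h)
  simp only [map_sum, map_smul] at h1
  have h2 := congrArg (fun z => antipode k (antipode k z))
    (hΛ.sum_cointegral_smul_antipode_left hn hg hxy h)
  simp only [map_sum, map_smul, antipode_mul_antidistrib, hgl.antipode_antipode] at h2
  rw [h1, ← h2]

/-- The first legs of `Δ(Λ)` span `H`: reconstruction of `S(h) g` and injectivity of `S` give `h =
μ(Λ₂ S(h) g) Λ₁`. Contracting the second leg with such functionals therefore recovers all values. -/
theorem IsRightIntegral.ext_left [FiniteDimensional k H]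
    (hΛ : IsRightIntegral k Λ) (hn : μ Λ = 1)
    (hg : IsDistinguishedGrouplike μ g) {V : Type*} [AddCommGroup V] [Module k V]
    {f f' : H →ₗ[k] V} (hf : f.rTensor H (comul (R := k) Λ) = f'.rTensor H (comul (R := k) Λ)) :
    f = f' := by
  ext h
  have hgl := hg.isGroupLikeElem hn
  have h0 : ∑ i ∈ (ℛ k Λ).index, μ ((ℛ k Λ).right i * (antipode k h * g)) • (ℛ k Λ).left i = h := by
    apply (hΛ.antipode_bijective hn hg).1
    have h1 := hΛ.sum_cointegral_smul_antipode_left hn hg (ℛ k Λ).eq (antipode k h * g)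
    have h2 := congrArg (· * antipode k g) h1
    simp only [Finset.sum_mul, smul_mul_assoc, mul_assoc, hgl.mul_antipode_cancel, mul_one] at h2
    simpa using h2
  have h1 := congrArg (TensorProduct.rid k V)
    (congrArg ((μ ∘ₗ LinearMap.mulRight k (antipode k h * g)).lTensor V) hf)
  rw [← (ℛ k Λ).eq] at h1
  simp only [map_sum, LinearMap.rTensor_tmul, LinearMap.lTensor_tmul, TensorProduct.rid_tmul,
    LinearMap.comp_apply, LinearMap.mulRight_apply, ← map_smul] at h1
  rwa [← map_sum, ← map_sum, h0] at h1

/-- The second legs span as well, because `S(h) = μ(Λ₁ h) Λ₂` and `S` is surjective. -/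
theorem IsRightIntegral.ext_right [FiniteDimensional k H]
    (hΛ : IsRightIntegral k Λ) (hμ : IsRightCointegral μ) (hn : μ Λ = 1)
    (hg : IsDistinguishedGrouplike μ g) {V : Type*} [AddCommGroup V] [Module k V]
    {f f' : H →ₗ[k] V} (hf : f.lTensor H (comul (R := k) Λ) = f'.lTensor H (comul (R := k) Λ)) :
    f = f' := by
  ext h
  obtain ⟨h, rfl⟩ := hΛ.antipode_surjective hn hg h
  have h0 := hΛ.sum_cointegral_smul_right hμ hn (ℛ k Λ).eq h
  have h1 := congrArg (TensorProduct.lid k V)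
    (congrArg ((μ ∘ₗ LinearMap.mulRight k h).rTensor V) hf)
  rw [← (ℛ k Λ).eq] at h1
  simp only [map_sum, LinearMap.rTensor_tmul, LinearMap.lTensor_tmul, TensorProduct.lid_tmul,
    LinearMap.comp_apply, LinearMap.mulRight_apply, ← map_smul] at h1
  rwa [← map_sum, ← map_sum, h0] at h1

end Frobenius

end HopfIntegrals

/-! ### Projective modules and dual bases -/

namespace FDMod

section Projective

variable {k A : Type u} [Field k] [Ring A] [Algebra k A]

/-- The quotient of a module by the image of a morphism. -/
noncomputable def cokernel {V W : FDMod k A} (f : V ⟶ W) : FDMod k A where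
  carrier := W ⧸ LinearMap.range (Hom.hom f)
  act :=
    have h (a : A) : LinearMap.range (Hom.hom f) ≤
        (LinearMap.range (Hom.hom f)).comap (W.act a) := by
      rintro _ ⟨v, rfl⟩
      exact ⟨V.act a v, Hom.comm f a v⟩
    AlgHom.ofLinearMap
      { toFun := fun a => Submodule.mapQ _ _ (W.act a) (h a)
        map_add' := fun a b => by apply Submodule.linearMap_qext; ext w; simp
        map_smul' := fun c a => by apply Submodule.linearMap_qext; ext w; simp }
      (by apply Submodule.linearMap_qext; ext w; simp)
      (fun a b => by apply Submodule.linearMap_qext; ext w; simp)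

/-- An epimorphism cannot distinguish the quotient map onto its cokernel from zero, so the cokernel
vanishes. -/
theorem surjective_of_epi {V W : FDMod k A} (f : V ⟶ W) [Epi f] :
    Function.Surjective (Hom.hom f) := by
  let π : W ⟶ cokernel f := Hom.mk (W := cokernel f)
    (Submodule.mkQ (LinearMap.range (Hom.hom f))) fun a w => rfl
  let o : W ⟶ cokernel f := Hom.mk (W := cokernel f) 0 fun a w => (map_zero _).symm
  have h : π = o := by
    rw [← cancel_epi f]
    apply hom_ext
    ext v
    exact (Submodule.Quotient.mk_eq_zero _).2 ⟨v, rfl⟩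
  have h' : Submodule.mkQ (LinearMap.range (Hom.hom f)) = 0 := congrArg Hom.hom h
  rw [← LinearMap.range_eq_top, ← Submodule.ker_mkQ (LinearMap.range (Hom.hom f)), h',
    LinearMap.ker_zero]

theorem epi_of_surjective {V W : FDMod k A} (f : V ⟶ W) (hf : Function.Surjective (Hom.hom f)) :
    Epi f where
  left_cancellation g h e := by
    apply hom_ext
    ext w
    obtain ⟨v, rfl⟩ := hf w
    exact LinearMap.congr_fun (congrArg Hom.hom e) v

/-- The morphism from the regular module sending `1` to `v`. -/
def ofElement [FiniteDimensional k A] {V : FDMod k A} (v : V) : regular k A ⟶ V :=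
  Hom.mk (V := regular k A) (V.act.toLinearMap.flip v : A →ₗ[k] V) fun a (b : A) => by
    change V.act (a * b) v = V.act a (V.act b v)
    simp

theorem projective_regular [FiniteDimensional k A] : Projective (regular k A) where
  factors {V W} f e _ := by
    let one : regular k A := (1 : A)
    obtain ⟨v, hv⟩ := surjective_of_epi e (Hom.hom f one)
    refine ⟨ofElement v, ?_⟩
    apply hom_ext
    apply LinearMap.ext
    intro (a : A)
    change Hom.hom e (V.act a v) = Hom.hom f a
    rw [Hom.comm, hv, ← Hom.comm]
    exact congrArg (Hom.hom f) (mul_one a)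

/-- A `k`-basis of `P` generates it over `A`, giving an epimorphism from a free module of rank `dim
P`. Projectivity splits it, and the components of the section are the dual functionals. -/
theorem exists_isDualBasis [FiniteDimensional k A] (P : FDMod k A) [Projective P] :
    ∃ (n : ℕ) (t : Fin n → P) (t' : Fin n → (P ⟶ regular k A)), IsDualBasis t t' := by
  let b := Module.finBasis k P
  let n := Module.finrank k P
  let F : FDMod k A :=
    { carrier := Fin n → A
      act := AlgHom.ofLinearMap
        { toFun := fun a => (LinearMap.mulLeft k a).compLeft (Fin n)
          map_add' := fun a a' => by ext; simp [add_mul]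
          map_smul' := fun c a => by ext; simp }
        (by ext; simp)
        (fun a a' => by ext; simp) }
  let π : F ⟶ P := Hom.mk (V := F)
    (∑ i, (P.act.toLinearMap.flip (b i)) ∘ₗ LinearMap.proj (φ := fun _ : Fin n => A) i)
    fun a (c : Fin n → A) => by
      rw [LinearMap.sum_apply, LinearMap.sum_apply, map_sum]
      refine Finset.sum_congr rfl fun i _ => ?_
      change P.act (a * c i) (b i) = P.act a (P.act (c i) (b i))
      simp
  have hπ : ∀ c : Fin n → A, (Hom.hom π : (Fin n → A) →ₗ[k] P) c = ∑ i, P.act (c i) (b i) :=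
    fun c => LinearMap.sum_apply _ _ _
  have : Epi π := epi_of_surjective π fun p => by
    refine ⟨(fun i => algebraMap k A (b.repr p i) : Fin n → A), ?_⟩
    rw [hπ]
    simp only [AlgHom.commutes, Module.algebraMap_end_apply]
    exact b.sum_repr p
  let s : P ⟶ F := Projective.factorThru (𝟙 P) π
  have hs : s ≫ π = 𝟙 P := Projective.factorThru_comp _ _
  refine ⟨n, b, fun i => Hom.mk (W := regular k A)
    (LinearMap.proj (φ := fun _ : Fin n => A) i ∘ₗ Hom.hom s) fun a p =>
      congrFun (Hom.comm s a p) i, fun x => ?_⟩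
  have := LinearMap.congr_fun (congrArg Hom.hom hs) x
  exact (hπ _).symm.trans this

end Projective

/-- If the module category is exact, then `X ⊙ₗ M` has a dual basis, where `X` is the regular
`H`-module. -/
theorem exists_isDualBasis_of_isExact {k H L : Type u} [Field k] [Ring H] [HopfAlgebra k H]
    [FiniteDimensional k H] [Ring L] [Algebra k L] [FiniteDimensional k L]
    [LeftComoduleAlgebra k H L] (hexact : ModCat.IsExact (FDMod k H) (FDMod k L)) (M : FDMod k L) :
    ∃ (n : ℕ) (t : Fin n → (regular k H ⊙ₗ M : FDMod k L))
      (t' : Fin n → ((regular k H ⊙ₗ M : FDMod k L) ⟶ regular k L)), IsDualBasis t t' :=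
  have := hexact (regular k H) projective_regular M
  exists_isDualBasis _

end FDMod

/-! ### The trace and the pairing of internal Hom spaces -/

namespace FDMod

section Comp

variable {k H L : Type u} [Field k] [Ring H] [HopfAlgebra k H] [FiniteDimensional k H]
  [Ring L] [Algebra k L] [LeftComoduleAlgebra k H L]

theorem tensorAct_lmul_lmul {A B : Type u} [Ring A] [Algebra k A] [Ring B] [Algebra k B]
    (z w : A ⊗[k] B) : tensorAct (Algebra.lmul k A) (Algebra.lmul k B) z w = z * w := by
  induction z with
  | zero => simp
  | add x y hx hy => simp only [map_add, LinearMap.add_apply, add_mul, hx, hy]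
  | tmul a b =>
    induction w with
    | zero => simp
    | add x y hx hy => simp only [map_add, mul_add, hx, hy]
    | tmul c d => simp

/-- The comultiplication as a module map `H ⟶ H ⊗ H`. -/
noncomputable def comulHom (k H : Type u) [Field k] [Ring H] [HopfAlgebra k H]
    [FiniteDimensional k H] : regular k H ⟶ regular k H ⊗ regular k H :=
  Hom.mk (V := regular k H) (W := regular k H ⊗ regular k H) (Coalgebra.comul (R := k) (A := H))
    fun a (b : H) => by
      change Coalgebra.comul (R := k) (a * b) = tensorAct (Algebra.lmul k H) (Algebra.lmul k H)
        (Coalgebra.comul (R := k) a) (Coalgebra.comul (R := k) b)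
      rw [tensorAct_lmul_lmul, Bialgebra.comul_mul]

/-- The map `h ⊗ m ↦ h₁ ⊗ ξ (h₂ ⊗ m)`. -/
noncomputable def comulComp {M N : FDMod k L} (ξ : regular k H ⊙ₗ M ⟶ N) :
    (regular k H ⊙ₗ M : FDMod k L) ⟶ regular k H ⊙ₗ N :=
  comulHom k H ⊵ₗ M ≫ (αₗ _ _ M).hom ≫ regular k H ⊴ₗ ξ

/-- An element of the internal Hom, regarded as a morphism. -/
def ofIHom {M N : FDMod k L} (ξ : ihomSpace H M N) : regular k H ⊙ₗ M ⟶ N :=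
  Hom.mk (V := regular k H ⊙ₗ M) ξ.1 ξ.2

/-- A morphism `H ⊙ₗ M ⟶ N`, regarded as an element of the internal Hom. -/
def toIHom {M N : FDMod k L} (ξ : regular k H ⊙ₗ M ⟶ N) : ihomSpace H M N :=
  ⟨Hom.hom ξ, Hom.comm ξ⟩

@[simp] theorem toIHom_ofIHom {M N : FDMod k L} (ξ : ihomSpace H M N) :
    toIHom (ofIHom ξ) = ξ := rfl

theorem comulComp_hom {M N : FDMod k L} (ξ : regular k H ⊙ₗ M ⟶ N) (w : H ⊗[k] M) :
    (Hom.hom (comulComp ξ) : H ⊗[k] M →ₗ[k] H ⊗[k] N) w =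
      (toIHom ξ).1.lTensor H (TensorProduct.assoc k H H M
        ((Coalgebra.comul (R := k)).rTensor M w)) := rfl

/-- Currying lets `h` act on `ζ ⊗ ξ` through `Δ(h)`, so the abstract composition becomes the map `h
⊗ m ↦ ζ(h₁ ⊗ ξ(h₂ ⊗ m))`. -/
theorem comp_apply {M₁ M₂ M₃ : FDMod k L} (ζ : ihomSpace H M₂ M₃) (ξ : ihomSpace H M₁ M₂) :
    (Hom.hom ((internalHom k H L).comp M₁ M₂ M₃) (ζ ⊗ₜ[k] ξ : ihomSpace H M₂ M₃ ⊗[k] ihomSpace H M₁ M₂)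
      : ihomSpace H M₁ M₃) = toIHom (comulComp (ofIHom ξ) ≫ ofIHom ζ) := by
  obtain ⟨F, hF, hF'⟩ : ∃ F : (ihomModule H M₂ M₃ ⊗[k] ihomModule H M₁ M₂) ⊗[k] M₁ →ₗ[k] M₃,
      F = Hom.hom ((αₗ ((internalHom k H L).hom M₂ M₃)
        ((internalHom k H L).hom M₁ M₂) M₁).hom ≫ ((internalHom k H L).hom M₂ M₃) ⊴ₗ
        ((internalHom k H L).ev M₁ M₂) ≫ (internalHom k H L).ev M₂ M₃) ∧
      ∀ (ζ : ihomModule H M₂ M₃) (ξ : ihomModule H M₁ M₂) m, F ((ζ ⊗ₜ ξ) ⊗ₜ m) =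
        (ζ : ihomSpace H M₂ M₃).1 (1 ⊗ₜ (ξ : ihomSpace H M₁ M₂).1 (1 ⊗ₜ m)) :=
    ⟨_, rfl, fun _ _ _ => rfl⟩
  have key (z : H ⊗[k] H) (m : M₁) :
      F (tensorAct (ihomModule H M₂ M₃).act (ihomModule H M₁ M₂).act z
        ((ζ : ihomModule H M₂ M₃) ⊗ₜ (ξ : ihomModule H M₁ M₂)) ⊗ₜ m) =
      ζ.1 (ξ.1.lTensor H (TensorProduct.assoc k H H M₁ (z ⊗ₜ m))) := by
    induction z with
    | zero => simp
    | add x y hx hy => simp only [map_add, LinearMap.add_apply, add_tmul, hx, hy]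
    | tmul a b =>
      refine (hF' _ _ _).trans ?_
      change ζ.1 ((1 * a) ⊗ₜ ξ.1 ((1 * b) ⊗ₜ m)) = ζ.1 (a ⊗ₜ ξ.1 (b ⊗ₜ m))
      rw [one_mul, one_mul]
  apply Subtype.ext
  apply TensorProduct.ext'
  intro h m
  refine Eq.trans ?_ (key (Coalgebra.comul (R := k) h) m)
  rw [hF]
  rfl

end Comp

end FDMod

/-! ### The trace and its independence of the dual basis -/

namespace FDMod

section Trace

variable {k H L : Type u} [Field k] [Ring H] [HopfAlgebra k H] [FiniteDimensional k H]
  [Ring L] [Algebra k L] [FiniteDimensional k L] [LeftComoduleAlgebra k H L]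

/-- The map `w ↦ F(w) n`, where `F` takes values in `L`. -/
noncomputable def rankOne {M N : FDMod k L} (F : regular k H ⊙ₗ M ⟶ regular k L) (n : N) :
    regular k H ⊙ₗ M ⟶ N :=
  F ≫ ofElement n

/-- The linear map `H ⊗ M → L` underlying a module map. -/
def toLin {M : FDMod k L} (F : regular k H ⊙ₗ M ⟶ regular k L) : H ⊗[k] M →ₗ[k] L := Hom.hom F

/-- The action of `L` on `H ⊗ M`. -/
noncomputable def regAct (H : Type u) [Ring H] [HopfAlgebra k H] [LeftComoduleAlgebra k H L]
    (M : FDMod k L) (a : L) : H ⊗[k] M →ₗ[k] H ⊗[k] M :=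
  tensorAct (Algebra.lmul k H) M.act (LeftComoduleAlgebra.coaction a)

omit [FiniteDimensional k H] [FiniteDimensional k L] in
theorem ihomSpace_regAct {M N : FDMod k L} (ξ : ihomSpace H M N) (a : L) (w : H ⊗[k] M) :
    ξ.1 (regAct H M a w) = N.act a (ξ.1 w) := ξ.2 a w

theorem toLin_regAct {M : FDMod k L} (F : regular k H ⊙ₗ M ⟶ regular k L) (a : L)
    (w : H ⊗[k] M) : toLin F (regAct H M a w) = a * toLin F w := Hom.comm F a w

theorem isDualBasis_iff {M : FDMod k L} {r : ℕ} (t : Fin r → H ⊗[k] M)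
    (t' : Fin r → ((regular k H ⊙ₗ M : FDMod k L) ⟶ regular k L)) :
    IsDualBasis (P := regular k H ⊙ₗ M) t t' ↔
      ∀ w : H ⊗[k] M, ∑ i, regAct H M (toLin (t' i) w) (t i) = w := Iff.rfl

/-- Apply the `L`-linear map `ξ` to `w = ∑ t' i (w) • t i`. Thus rank-one maps span the internal
Hom, and all later identities are tested on them. -/
theorem eq_sum_rankOne {M N : FDMod k L} {r : ℕ} {t : Fin r → H ⊗[k] M}
    {t' : Fin r → ((regular k H ⊙ₗ M : FDMod k L) ⟶ regular k L)}
    (ht : IsDualBasis (P := regular k H ⊙ₗ M) t t')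
    (ξ : ihomSpace H M N) : ξ = ∑ i, toIHom (rankOne (t' i) (ξ.1 (t i))) := by
  apply Subtype.ext
  rw [AddSubmonoidClass.coe_finsetSum]
  refine LinearMap.ext fun w => ?_
  rw [LinearMap.sum_apply]
  conv_lhs => rw [← (isDualBasis_iff t t').1 ht w]
  rw [map_sum]
  exact Finset.sum_congr rfl fun i _ => ihomSpace_regAct ξ _ _

/-- Linear maps on the internal Hom space are determined by the values on maps `w ↦ F(w) n`. -/
theorem ihomSpace_hom_ext {M N : FDMod k L} {r : ℕ}
    {t : Fin r → H ⊗[k] M} {t' : Fin r → ((regular k H ⊙ₗ M : FDMod k L) ⟶ regular k L)}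
    (ht : IsDualBasis (P := regular k H ⊙ₗ M) t t')
    {V : Type*} [AddCommGroup V] [Module k V] {f f' : ihomSpace H M N →ₗ[k] V}
    (h : ∀ F n, f (toIHom (rankOne F n)) = f' (toIHom (rankOne F n))) : f = f' := by
  ext ξ
  rw [eq_sum_rankOne ht ξ, map_sum, map_sum]
  exact Finset.sum_congr rfl fun i _ => h _ _

variable {μ : L →ₗ[k] k} (hμ : IsFrobeniusForm μ) (α : H →ₐ[k] k) {Λ : H}

omit [FiniteDimensional k H] [FiniteDimensional k L] in
-- Left multiplication on `Λ` is the scalar `α`. The twist by `α` in `S(M)` is therefore exactly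
-- what turns `y ↦ Λ ⊗ y` into a map that carries the action of `a` to that of `ν(a)`.
theorem integral_tmul_twistedNakayama (hα : IsModularFunction Λ α) {M : FDMod k L} (a : L)
    (y : M) : Λ ⊗ₜ[k] M.act (hμ.twistedNakayama α a) y =
      regAct H M (hμ.nakayama a) (Λ ⊗ₜ[k] y) := by
  change Λ ⊗ₜ[k] M.act (TensorProduct.lid k L (α.toLinearMap.rTensor L
    (LeftComoduleAlgebra.coaction (hμ.nakayama a)))) y =
    tensorAct (Algebra.lmul k H) M.act (LeftComoduleAlgebra.coaction (hμ.nakayama a)) (Λ ⊗ₜ[k] y)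
  generalize (LeftComoduleAlgebra.coaction (hμ.nakayama a) : H ⊗[k] L) = z
  induction z with
  | zero => simp
  | add x y hx hy => simp only [map_add, LinearMap.add_apply, tmul_add, hx, hy]
  | tmul h b => simp [hα h, smul_tmul']

/-- The identity map from the module `S(M)` to `M`. -/
noncomputable def untwist (M : FDMod k L) : (hμ.serreFunctor α).obj M ≃ₗ[k] M :=
  LinearEquiv.refl k M

variable (Λ) in
/-- The functional `ξ ↦ ∑ i, μ (t' i (Λ ⊗ ξ (t i)))`. -/
noncomputable def traceOf {M : FDMod k L} {r : ℕ} (t : Fin r → H ⊗[k] M)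
    (t' : Fin r → ((regular k H ⊙ₗ M : FDMod k L) ⟶ regular k L)) :
    ihomSpace H M ((hμ.serreFunctor α).obj M) →ₗ[k] k where
  toFun ξ := ∑ i, μ (toLin (t' i) (Λ ⊗ₜ[k] untwist hμ α M (ξ.1 (t i))))
  map_add' ξ ξ' := by
    rw [← Finset.sum_add_distrib]
    refine Finset.sum_congr rfl fun i _ => ?_
    rw [← map_add, ← map_add, ← tmul_add, ← map_add]
    rfl
  map_smul' c ξ := by
    rw [RingHom.id_apply, Finset.smul_sum]
    refine Finset.sum_congr rfl fun i _ => ?_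
    rw [← map_smul, ← map_smul, ← tmul_smul, ← map_smul]
    rfl

theorem traceOf_apply {M : FDMod k L} {r : ℕ} (t : Fin r → H ⊗[k] M)
    (t' : Fin r → ((regular k H ⊙ₗ M : FDMod k L) ⟶ regular k L))
    (ξ : ihomSpace H M ((hμ.serreFunctor α).obj M)) :
    traceOf hμ α Λ t t' ξ = ∑ i, μ (toLin (t' i) (Λ ⊗ₜ[k] untwist hμ α M (ξ.1 (t i)))) := rfl

/-- The `i`-th term is `μ(ν(F(t i)) t' i (Λ ⊗ y)) = μ(t' i (Λ ⊗ y) F(t i))`, which is `μ ∘ F` of the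
`i`-th term in the expansion of `Λ ⊗ y`. The sum collapses and no trace of the dual basis is left.
-/
theorem traceOf_rankOne (hα : IsModularFunction Λ α) {M : FDMod k L} {r : ℕ}
    {t : Fin r → H ⊗[k] M} {t' : Fin r → ((regular k H ⊙ₗ M : FDMod k L) ⟶ regular k L)}
    (ht : IsDualBasis (P := regular k H ⊙ₗ M) t t')
    (F : regular k H ⊙ₗ M ⟶ regular k L)
    (y : (hμ.serreFunctor α).obj M) :
    traceOf hμ α Λ t t' (toIHom (rankOne F y)) = μ (toLin F (Λ ⊗ₜ[k] untwist hμ α M y)) := by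
  have h := (isDualBasis_iff t t').1 ht (Λ ⊗ₜ[k] untwist hμ α M y)
  refine Eq.trans ?_ (congrArg (fun w : H ⊗[k] M => μ (toLin F w)) h)
  rw [traceOf_apply, map_sum (toLin F), map_sum μ]
  refine Finset.sum_congr rfl fun i _ => ?_
  rw [toLin_regAct, ← hμ.nakayama_spec, ← toLin_regAct, ← integral_tmul_twistedNakayama hμ α hα]
  rfl

variable (k H L) in
/-- Every module `H ⊙ₗ M` has a dual basis. -/
def HasDualBases : Prop :=
  ∀ M : FDMod k L, ∃ (n : ℕ) (t : Fin n → H ⊗[k] M)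
    (t' : Fin n → ((regular k H ⊙ₗ M : FDMod k L) ⟶ regular k L)),
      IsDualBasis (P := regular k H ⊙ₗ M) t t'

variable (hb : HasDualBases k H L)

variable (Λ) in
/-- The trace as a linear functional. -/
noncomputable def traceLinear (M : FDMod k L) :
    ihomSpace H M ((hμ.serreFunctor α).obj M) →ₗ[k] k :=
  traceOf hμ α Λ (hb M).choose_spec.choose (hb M).choose_spec.choose_spec.choose

theorem traceLinear_rankOne (hα : IsModularFunction Λ α) {M : FDMod k L}
    (F : regular k H ⊙ₗ M ⟶ regular k L)
    (y : (hμ.serreFunctor α).obj M) :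
    traceLinear hμ α Λ hb M (toIHom (rankOne F y)) =
      μ (toLin F (Λ ⊗ₜ[k] untwist hμ α M y)) :=
  traceOf_rankOne hμ α hα (hb M).choose_spec.choose_spec.choose_spec F y

theorem traceLinear_eq_traceOf (hα : IsModularFunction Λ α) {M : FDMod k L} {r : ℕ}
    {t : Fin r → H ⊗[k] M} {t' : Fin r → ((regular k H ⊙ₗ M : FDMod k L) ⟶ regular k L)}
    (ht : IsDualBasis (P := regular k H ⊙ₗ M) t t') :
    traceLinear hμ α Λ hb M = traceOf hμ α Λ t t' :=
  ihomSpace_hom_ext ht fun F n => (traceLinear_rankOne hμ α hb hα F n).trans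
    (traceOf_rankOne hμ α hα ht F n).symm

/-- Right multiplication by `h` as a module map `H ⟶ H`. -/
def mulRightHom (h : H) : regular k H ⟶ regular k H :=
  Hom.mk (V := regular k H) (W := regular k H) (LinearMap.mulRight k h : H →ₗ[k] H)
    fun a (b : H) => show (a * b) * h = a * (b * h) from mul_assoc a b h

/-- The trace is a module map. -/
noncomputable def traceHom (hΛ : IsRightIntegral k Λ) (hα : IsModularFunction Λ α)
    (M : FDMod k L) :
    (internalHom k H L).hom M ((hμ.serreFunctor α).obj M) ⟶ 𝟙_ (FDMod k H) :=
  Hom.mk (V := ihomModule H M ((hμ.serreFunctor α).obj M))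
    (W := ofCharacter (Bialgebra.counitAlgHom k H)) (traceLinear hμ α Λ hb M) fun h ξ => by
      obtain ⟨r, t, t', ht⟩ := hb M
      have key : traceLinear hμ α Λ hb M ∘ₗ
          (ihomModule H M ((hμ.serreFunctor α).obj M)).act h =
          Coalgebra.counit (R := k) h • traceLinear hμ α Λ hb M := by
        apply ihomSpace_hom_ext ht
        intro F y
        -- Acting by `h` on a rank-one map precomposes `F` with right multiplication by `h`, so `Λ`
        -- is replaced by `Λ h = ε(h) Λ`.
        refine (traceLinear_rankOne hμ α hb hα (mulRightHom h ⊵ₗ M ≫ F) y).trans ?_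
        refine Eq.trans ?_ (congrArg (Coalgebra.counit (R := k) h • ·)
          (traceLinear_rankOne hμ α hb hα F y)).symm
        change μ (toLin F ((Λ * h) ⊗ₜ[k] untwist hμ α M y)) = Coalgebra.counit (R := k) h • _
        rw [hΛ, ← smul_tmul', map_smul, map_smul]
      exact LinearMap.congr_fun key ξ

end Trace

end FDMod

/-! ### The free module `H ⊙ₗ L` and its coordinates -/

namespace FDMod

section Free

variable {k H L : Type u} [Field k] [Ring H] [HopfAlgebra k H] [FiniteDimensional k H]
  [Ring L] [Algebra k L] [FiniteDimensional k L] [LeftComoduleAlgebra k H L]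

omit [FiniteDimensional k H] [FiniteDimensional k L] in
/-- `a₍₋₁₎ S⁻¹(a₍₋₂₎) ⊗ a₍₀₎ = 1 ⊗ a`. -/
theorem sum_coaction_mul_antipode_symm (hS : Function.Bijective (HopfAlgebra.antipode k : H →ₗ[k] H))
    {ι : Type*} {s : Finset ι} {x : ι → H} {y : ι → L} {a : L}
    (hxy : ∑ i ∈ s, x i ⊗ₜ[k] y i = LeftComoduleAlgebra.coaction a) :
    ∑ i ∈ s, LeftComoduleAlgebra.coaction (y i) *
      ((LinearEquiv.ofBijective _ hS).symm (x i) ⊗ₜ[k] (1 : L)) = (1 : H) ⊗ₜ[k] a := by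
  let T : H →ₗ[k] H := (LinearEquiv.ofBijective _ hS).symm.toLinearMap
  have hT (h : H) : HopfAlgebra.antipode k (T h) = h :=
    (LinearEquiv.ofBijective _ hS).apply_symm_apply h
  -- Here `m(u ⊗ v) = v S⁻¹(u)`; applying `S` turns `h₂ S⁻¹(h₁)` into `h₁ S(h₂)`.
  let m : H ⊗[k] H →ₗ[k] H := LinearMap.mul' k H ∘ₗ T.lTensor H ∘ₗ
    (TensorProduct.comm k H H).toLinearMap
  have hm (h : H) : m (Coalgebra.comul (R := k) h) = Coalgebra.counit (R := k) h • (1 : H) := by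
    apply hS.1
    rw [map_smul, HopfAlgebra.antipode_one, ← mulAntipode_comul]
    generalize Coalgebra.comul (R := k) h = z
    induction z with
    | zero => simp
    | add x y hx hy => simp only [map_add, hx, hy]
    | tmul u v => simp [m, HopfAlgebra.antipode_mul_antidistrib, hT]
  rw [← rTensor_coaction_cancel (δ := (LeftComoduleAlgebra.coaction (k := k) (H := H) (L := L)).toLinearMap)
    (fun a => LeftComoduleAlgebra.coassoc a) (fun a => LeftComoduleAlgebra.counit_coaction a) m hm a]
  rw [AlgHom.toLinearMap_apply, ← hxy]
  simp only [map_sum, LinearMap.lTensor_tmul, AlgHom.toLinearMap_apply]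
  refine Finset.sum_congr rfl fun i _ => ?_
  generalize (LeftComoduleAlgebra.coaction (y i) : H ⊗[k] L) = z
  induction z with
  | zero => simp
  | add x y hx hy => simp only [map_add, add_mul, tmul_add, hx, hy]
  | tmul h w => simp [m, T]

/-- The map `c ⊗ b ↦ b₍₋₁₎ c ⊗ b₍₀₎`. -/
noncomputable def freeMap (k H L : Type u) [Field k] [Ring H] [HopfAlgebra k H]
    [Ring L] [Algebra k L] [LeftComoduleAlgebra k H L] :
    H ⊗[k] L →ₗ[k] H ⊗[k] L :=
  TensorProduct.lift (((LinearMap.mul k (H ⊗[k] L)).compl₁₂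
    (LeftComoduleAlgebra.coaction (k := k) (H := H) (L := L)).toLinearMap
    ((TensorProduct.mk k H L).flip 1)).flip)

omit [FiniteDimensional k H] [FiniteDimensional k L] in
@[simp] theorem freeMap_tmul (c : H) (b : L) :
    freeMap k H L (c ⊗ₜ b) = LeftComoduleAlgebra.coaction b * (c ⊗ₜ 1) := rfl

/-- The element `S⁻¹(b₍₋₁₎) h ⊗ b₍₀₎` is a preimage of `h ⊗ b`, and surjectivity suffices in finite
dimension. Consequently `H ⊙ₗ L` is a free `L`-module with the space of generators `H ⊗ 1`. -/
theorem freeMap_bijective (hS : Function.Bijective (HopfAlgebra.antipode k : H →ₗ[k] H)) :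
    Function.Bijective (freeMap k H L) := by
  have h : Function.Surjective (freeMap k H L) := by
    rw [← LinearMap.range_eq_top, eq_top_iff]
    rintro w -
    induction w with
    | zero => exact zero_mem _
    | add x y hx hy => exact add_mem hx hy
    | tmul h b =>
      obtain ⟨s, hs⟩ := TensorProduct.exists_finset
        (LeftComoduleAlgebra.coaction b : H ⊗[k] L)
      refine ⟨∑ i ∈ s, ((LinearEquiv.ofBijective _ hS).symm i.1 * h) ⊗ₜ i.2, ?_⟩
      have := congrArg (· * (h ⊗ₜ[k] (1 : L))) (sum_coaction_mul_antipode_symm hS hs.symm)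
      simp only [Finset.sum_mul, mul_assoc, Algebra.TensorProduct.tmul_mul_tmul, mul_one,
        one_mul] at this
      simpa only [map_sum, freeMap_tmul] using this
  exact ⟨LinearMap.injective_iff_surjective.2 h, h⟩

omit [FiniteDimensional k H] [FiniteDimensional k L] in
theorem lid_rTensor_mul_left {V : Type*} [Ring V] [Algebra k V] (p : H →ₗ[k] k) (a : V)
    (z : H ⊗[k] V) : TensorProduct.lid k V (p.rTensor V ((1 ⊗ₜ a) * z)) =
      a * TensorProduct.lid k V (p.rTensor V z) := by
  induction z with
  | zero => simp
  | add x y hx hy => simp only [map_add, mul_add, hx, hy]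
  | tmul h w => simp

omit [FiniteDimensional k H] [FiniteDimensional k L] in
theorem freeMap_mul (a : L) (z : H ⊗[k] L) :
    freeMap k H L ((1 ⊗ₜ a) * z) = LeftComoduleAlgebra.coaction a * freeMap k H L z := by
  induction z with
  | zero => simp
  | add x y hx hy => simp only [map_add, mul_add, hx, hy]
  | tmul h w => simp [mul_assoc]

omit [FiniteDimensional k H] [FiniteDimensional k L] in
theorem freeMap_symm_mul (hJ : Function.Bijective (freeMap k H L)) (a : L) (z : H ⊗[k] L) :
    (LinearEquiv.ofBijective _ hJ).symm (LeftComoduleAlgebra.coaction a * z) =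
      (1 ⊗ₜ a) * (LinearEquiv.ofBijective _ hJ).symm z := by
  apply (LinearEquiv.ofBijective _ hJ).injective
  rw [LinearEquiv.apply_symm_apply, LinearEquiv.ofBijective_apply, freeMap_mul]
  congr 1
  exact ((LinearEquiv.ofBijective _ hJ).apply_symm_apply z).symm

/-- The coordinate map `b₍₋₁₎ c ⊗ b₍₀₎ ↦ ⟨p, c⟩ b` of the free module `H ⊙ₗ L`. -/
noncomputable def freeCoord (hJ : Function.Bijective (freeMap k H L)) (p : H →ₗ[k] k) :
    (regular k H ⊙ₗ regular k L : FDMod k L) ⟶ regular k L :=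
  Hom.mk (V := regular k H ⊙ₗ regular k L) (W := regular k L)
    ((TensorProduct.lid k L).toLinearMap ∘ₗ p.rTensor L ∘ₗ
      (LinearEquiv.ofBijective _ hJ).symm.toLinearMap : H ⊗[k] L →ₗ[k] L)
    fun a (w : H ⊗[k] L) => by
      change TensorProduct.lid k L (p.rTensor L ((LinearEquiv.ofBijective _ hJ).symm
        (tensorAct (Algebra.lmul k H) (Algebra.lmul k L) (LeftComoduleAlgebra.coaction a) w))) =
        a * TensorProduct.lid k L (p.rTensor L ((LinearEquiv.ofBijective _ hJ).symm w))
      rw [tensorAct_lmul_lmul, freeMap_symm_mul, lid_rTensor_mul_left]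

theorem freeCoord_apply (hJ : Function.Bijective (freeMap k H L)) (p : H →ₗ[k] k)
    (z : H ⊗[k] L) :
    toLin (freeCoord hJ p) (freeMap k H L z) = TensorProduct.lid k L (p.rTensor L z) := by
  change TensorProduct.lid k L (p.rTensor L ((LinearEquiv.ofBijective _ hJ).symm
    ((LinearEquiv.ofBijective _ hJ) z))) = _
  rw [LinearEquiv.symm_apply_apply]

/-- Through `freeMap`, a basis of `H` becomes an `L`-basis of `H ⊙ₗ L`. This explicit dual basis is
the one on which the cointegral property can be used. -/
theorem isDualBasis_freeCoord (hJ : Function.Bijective (freeMap k H L)) {r : ℕ}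
    (e : Module.Basis (Fin r) k H) :
    IsDualBasis (P := regular k H ⊙ₗ regular k L) (fun i => e i ⊗ₜ[k] (1 : L))
      (fun i => freeCoord hJ (e.coord i)) := by
  refine (isDualBasis_iff (M := regular k L) (fun i => e i ⊗ₜ[k] (1 : L)) _).2 fun w => ?_
  obtain ⟨z, rfl⟩ := hJ.2 w
  have key : ∀ z : H ⊗[k] L, ∑ i, LeftComoduleAlgebra.coaction
      (TensorProduct.lid k L ((e.coord i).rTensor L z)) * (e i ⊗ₜ[k] (1 : L)) =
      freeMap k H L z := by
    intro z
    induction z with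
    | zero => simp
    | add x y hx hy => simp only [map_add, add_mul, Finset.sum_add_distrib, hx, hy]
    | tmul h w =>
      simp only [LinearMap.rTensor_tmul, TensorProduct.lid_tmul, map_smul, freeMap_tmul,
        Module.Basis.coord_apply, smul_mul_assoc]
      conv_rhs => rw [← e.sum_repr h, sum_tmul, Finset.mul_sum]
      simp only [← smul_tmul', mul_smul_comm]
  refine Eq.trans (Finset.sum_congr rfl fun i _ => ?_) (key z)
  rw [freeCoord_apply]
  exact tensorAct_lmul_lmul _ _

/-- If `μ` is a `g`-cointegral, then the coordinate maps `t` of `H ⊙ₗ L` satisfy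
`μ(t(h ⊗ b)) = ⟨p, g⁻¹ h⟩ μ(b)`. -/
theorem cointegral_freeCoord {μ : L →ₗ[k] k} {g : GroupLike k H} (hg : IsGrouplikeCointegral g μ)
    (hJ : Function.Bijective (freeMap k H L)) (p : H →ₗ[k] k) (h : H) (b : L) :
    μ (toLin (M := regular k L) (freeCoord hJ p) (h ⊗ₜ[k] b)) = p ((g⁻¹ : GroupLike k H) * h) * μ b := by
  -- On the generator `b₍₋₁₎ c ⊗ b₍₀₎` the claimed functional is `⟨p, g⁻¹ b₍₋₁₎ c⟩ μ(b₍₀₎)`; the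
  -- cointegral property replaces `b₍₋₁₎` by `g` and leaves `⟨p, c⟩ μ(b)`.
  have key : ∀ z : H ⊗[k] L, μ (TensorProduct.lid k L (p.rTensor L z)) =
      TensorProduct.lid k k (TensorProduct.map (p ∘ₗ LinearMap.mulLeft k ((g⁻¹ : GroupLike k H) : H)) μ
        (freeMap k H L z)) := by
    intro z
    induction z with
    | zero => simp
    | add x y hx hy => simp only [map_add, hx, hy]
    | tmul c b =>
      have e : ∀ w : H ⊗[k] L, TensorProduct.lid k k (TensorProduct.map
          (p ∘ₗ LinearMap.mulLeft k ((g⁻¹ : GroupLike k H) : H)) μ (w * (c ⊗ₜ 1))) =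
          p ((g⁻¹ : GroupLike k H) * TensorProduct.rid k H (μ.lTensor H w) * c) := by
        intro w
        induction w with
        | zero => simp
        | add x y hx hy => simp only [map_add, add_mul, mul_add, hx, hy]
        | tmul h b => simp [mul_assoc, mul_comm]
      rw [freeMap_tmul, e, hg b, mul_smul_comm, ← GroupLike.val_mul, inv_mul_cancel]
      simp [mul_comm]
  obtain ⟨z, hz⟩ := hJ.2 (h ⊗ₜ b)
  refine (congrArg (fun w : H ⊗[k] L => μ (toLin (M := regular k L) (freeCoord hJ p) w)) hz.symm).trans ?_
  rw [freeCoord_apply, key, hz]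
  simp

end Free

end FDMod

/-! ### The composition pairing and its nondegeneracy -/

namespace FDMod

section PairingInvariance

variable {k H : Type u} [Field k] [Ring H] [HopfAlgebra k H]

/-- The linear map underlying a morphism `X ⊗ Y ⟶ 𝟙`. -/
def formLin {X Y : FDMod k H} (p : X ⊗ Y ⟶ 𝟙_ (FDMod k H)) : X ⊗[k] Y →ₗ[k] k := Hom.hom p

theorem formLin_comul {X Y : FDMod k H} (p : X ⊗ Y ⟶ 𝟙_ (FDMod k H)) (h : H) (w : X ⊗[k] Y) :
    formLin p (tensorAct X.act Y.act (Coalgebra.comul (R := k) h) w) =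
      Coalgebra.counit (R := k) h * formLin p w := Hom.comm p h w

/-- Write `h x ⊗ y = h₁ x ⊗ h₂ S(h₃) y` and let the invariant form absorb the coproduct of the first
two legs. This is why the adjoint of an invariant pairing is a module map into the dual. -/
theorem formLin_act {X Y : FDMod k H} (p : X ⊗ Y ⟶ 𝟙_ (FDMod k H)) (h : H) (x : X) (y : Y) :
    formLin p (X.act h x ⊗ₜ y) = formLin p (x ⊗ₜ Y.act (HopfAlgebra.antipode k h) y) := by
  have h1 := congrArg (fun z => formLin p (tensorAct X.act Y.act z (x ⊗ₜ y)))
    (sum_comul_mul_antipode (Coalgebra.Repr.arbitrary k h).eq)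
  simp only [map_sum, LinearMap.sum_apply, map_mul, Module.End.mul_apply, formLin_comul,
    tensorAct_tmul, map_one, Module.End.one_apply] at h1
  rw [← h1]
  conv_rhs => rw [← Coalgebra.sum_counit_smul (Coalgebra.Repr.arbitrary k h)]
  simp only [map_sum, map_smul, LinearMap.sum_apply, tmul_sum, LinearMap.smul_apply, tmul_smul,
    smul_eq_mul]

end PairingInvariance

section Pairing

variable {k H L : Type u} [Field k] [Ring H] [HopfAlgebra k H] [FiniteDimensional k H]
  [Ring L] [Algebra k L] [FiniteDimensional k L] [LeftComoduleAlgebra k H L]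
  {μ : L →ₗ[k] k} (hμ : IsFrobeniusForm μ) (α : H →ₐ[k] k) {Λ : H}
  (hb : HasDualBases k H L) (hΛ : IsRightIntegral k Λ) (hα : IsModularFunction Λ α)

/-- The pairing `[N, S M] ⊗ [M, N] ⟶ [M, S M] ⟶ 𝟙`. -/
noncomputable def pairingHom (M N : FDMod k L) :
    ihomModule H N ((hμ.serreFunctor α).obj M) ⊗ ihomModule H M N ⟶ 𝟙_ (FDMod k H) :=
  (internalHom k H L).comp M N ((hμ.serreFunctor α).obj M) ≫ traceHom hμ α hb hΛ hα M

/-- The pairing `[N, S M] ⊗ [M, N] ⟶ k` as a bilinear map. -/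
noncomputable def pairing (M N : FDMod k L) :
    ihomModule H N ((hμ.serreFunctor α).obj M) →ₗ[k] ihomModule H M N →ₗ[k] k :=
  (TensorProduct.mk k _ _).compr₂ (formLin (pairingHom hμ α hb hΛ hα M N))

theorem pairing_apply {M N : FDMod k L} (ζ : regular k H ⊙ₗ N ⟶ (hμ.serreFunctor α).obj M)
    (ξ : regular k H ⊙ₗ M ⟶ N) :
    pairing hμ α hb hΛ hα M N (toIHom ζ) (toIHom ξ) =
      traceLinear hμ α Λ hb M (toIHom (comulComp ξ ≫ ζ)) :=
  congrArg (traceLinear hμ α Λ hb M) (comp_apply (toIHom ζ) (toIHom ξ))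

theorem pairing_act {M N : FDMod k L} (h : H) (ζ : ihomModule H N ((hμ.serreFunctor α).obj M))
    (ξ : ihomModule H M N) :
    pairing hμ α hb hΛ hα M N ((ihomModule H N ((hμ.serreFunctor α).obj M)).act h ζ) ξ =
      pairing hμ α hb hΛ hα M N ζ
        ((ihomModule H M N).act (HopfAlgebra.antipode k h) ξ) :=
  formLin_act (pairingHom hμ α hb hΛ hα M N) h ζ ξ

/-- The map `h ↦ ζ(h ⊗ n)`, with values in `M`. -/
noncomputable def slice {M N : FDMod k L} (ζ : ihomSpace H N ((hμ.serreFunctor α).obj M))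
    (n : N) : H →ₗ[k] M :=
  (untwist hμ α M).toLinearMap ∘ₗ ζ.1 ∘ₗ (TensorProduct.mk k H N).flip n

theorem toLin_comulComp {M : FDMod k L} {ι : Type*} {s : Finset ι}
    {x y : ι → H} {h : H} (hxy : ∑ i ∈ s, x i ⊗ₜ[k] y i = Coalgebra.comul (R := k) h)
    {N : FDMod k L} (ξ : regular k H ⊙ₗ M ⟶ N) (G : regular k H ⊙ₗ N ⟶ regular k L) (m : M) :
    toLin (comulComp ξ ≫ G) (h ⊗ₜ m) = ∑ i ∈ s, toLin G (x i ⊗ₜ (toIHom ξ).1 (y i ⊗ₜ m)) := by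
  refine (congrArg (toLin G) (comulComp_hom ξ (h ⊗ₜ m))).trans ?_
  rw [LinearMap.rTensor_tmul, ← hxy]
  simp only [sum_tmul, map_sum, TensorProduct.assoc_tmul, LinearMap.lTensor_tmul]

/-- The composite factors through `H ⊙ₗ L`, and a dual basis there splits the remaining map `H ⊙ₗ L
⟶ K` into rank-one maps. Its trace is then known term by term. -/
theorem comulComp_rankOne {M N K : FDMod k L} {r : ℕ} {t : Fin r → H ⊗[k] L}
    {t' : Fin r → ((regular k H ⊙ₗ regular k L : FDMod k L) ⟶ regular k L)}
    (ht : IsDualBasis (P := regular k H ⊙ₗ regular k L) t t')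
    (F : regular k H ⊙ₗ M ⟶ regular k L) (n : N) (ζ : regular k H ⊙ₗ N ⟶ K) :
    toIHom (comulComp (rankOne F n) ≫ ζ) = ∑ i, toIHom (rankOne (comulComp F ≫ t' i)
      ((toIHom (regular k H ⊴ₗ ofElement n ≫ ζ)).1 (t i))) := by
  have h0 : comulComp (rankOne F n) ≫ ζ = comulComp F ≫ (regular k H ⊴ₗ ofElement n ≫ ζ) := by
    simp [comulComp, rankOne, MonoidalLeftAction.actionHomRight_comp]
  rw [h0]
  have h1 := eq_sum_rankOne (M := regular k L) ht (toIHom (regular k H ⊴ₗ ofElement n ≫ ζ))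
  have h2 := congrArg Subtype.val h1
  rw [AddSubmonoidClass.coe_finsetSum] at h2
  apply Subtype.ext
  rw [AddSubmonoidClass.coe_finsetSum]
  refine LinearMap.ext fun w => ?_
  have h3 (v : H ⊗[k] (regular k L : FDMod k L)) := LinearMap.congr_fun h2 v
  simp only [LinearMap.sum_apply] at h3 ⊢
  exact h3 (Hom.hom (comulComp F) w)

/-- The value of the pairing at `ζ` and `w ↦ F(w) n` is `μ (F (Λ₂ ⊗ ζ(g⁻¹ Λ₁ ⊗ n)))`. -/
theorem pairing_rankOne (hS : Function.Bijective (HopfAlgebra.antipode k : H →ₗ[k] H))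
    {g : GroupLike k H} (hg : IsGrouplikeCointegral g μ) {ι : Type*} {s : Finset ι}
    {x y : ι → H} (hxy : ∑ i ∈ s, x i ⊗ₜ[k] y i = Coalgebra.comul (R := k) Λ) {M N : FDMod k L}
    (ζ : ihomSpace H N ((hμ.serreFunctor α).obj M))
    (F : regular k H ⊙ₗ M ⟶ regular k L) (n : N) :
    pairing hμ α hb hΛ hα M N ζ (toIHom (rankOne F n)) =
      μ (toLin F (∑ i ∈ s, y i ⊗ₜ slice hμ α ζ n ((g⁻¹ : GroupLike k H) * x i))) := by
  have hJ := freeMap_bijective (L := L) hS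
  let e := Module.finBasis k H
  refine (pairing_apply hμ α hb hΛ hα (ofIHom ζ) (rankOne F n)).trans ?_
  rw [comulComp_rankOne (t := fun i => e i ⊗ₜ[k] (1 : L)) (isDualBasis_freeCoord hJ e) F n
    (ofIHom ζ), map_sum]
  simp only [traceLinear_rankOne hμ α hb hα, toLin_comulComp hxy, map_sum]
  rw [Finset.sum_comm]
  refine Finset.sum_congr rfl fun j _ => ?_
  -- The cointegral property evaluates `λ_L` of the `i`-th free coordinate of `Λ₁ ⊗ F(Λ₂ ⊗ ζ(e i ⊗
  -- n))`.
  have h1 : ∀ i, μ (toLin (M := regular k L) (freeCoord hJ (e.coord i)) (x j ⊗ₜ[k] (toIHom F).1 (y j ⊗ₜ[k]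
      untwist hμ α M ((toIHom (regular k H ⊴ₗ ofElement n ≫ ofIHom ζ)).1 (e i ⊗ₜ[k] (1 : L)))))) =
      e.coord i ((g⁻¹ : GroupLike k H) * x j) * μ (toLin F (y j ⊗ₜ slice hμ α ζ n (e i))) := by
    intro i
    refine (cointegral_freeCoord hg hJ _ _ _).trans ?_
    have h2 : slice hμ α ζ (N.act 1 n) (e i) = slice hμ α ζ n (e i) := by
      rw [map_one, Module.End.one_apply]
    rw [← h2]
    rfl
  refine (Finset.sum_congr rfl fun i _ => h1 i).trans ?_
  -- The coefficients just obtained are the coordinates of `g⁻¹ Λ₁`, so the sum over `i` reassembles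
  -- it inside `ζ`.
  conv_rhs => rw [← e.sum_repr ((g⁻¹ : GroupLike k H) * x j)]
  simp only [map_sum, map_smul, tmul_sum, tmul_smul, smul_eq_mul, Module.Basis.coord_apply]

/-- Elements of `H ⊗ M` are separated by the functionals `w ↦ μ(F(w))`. -/
theorem eq_of_forall_frobenius (hμ : IsFrobeniusForm μ) {M : FDMod k L} {r : ℕ} {t : Fin r → H ⊗[k] M}
    {t' : Fin r → ((regular k H ⊙ₗ M : FDMod k L) ⟶ regular k L)}
    (ht : IsDualBasis (P := regular k H ⊙ₗ M) t t') {w w' : H ⊗[k] M}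
    (h : ∀ F : regular k H ⊙ₗ M ⟶ regular k L, μ (toLin F w) = μ (toLin F w')) : w = w' := by
  rw [← (isDualBasis_iff t t').1 ht w, ← (isDualBasis_iff t t').1 ht w']
  refine Finset.sum_congr rfl fun i _ => ?_
  refine congrArg (fun a => regAct H M a (t i)) ?_
  refine hμ.eq_of_forall fun b => ?_
  -- Right multiplication by `b` is `L`-linear, so the hypothesis also controls `μ(t' i (w) b)` for
  -- all `b`; the Frobenius property then determines `t' i (w)`.
  let R : regular k L ⟶ regular k L :=
    Hom.mk (V := regular k L) (W := regular k L) (LinearMap.mulRight k b : L →ₗ[k] L)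
      fun a (c : L) => show (a * c) * b = a * (c * b) from mul_assoc a c b
  exact h (t' i ≫ R)

/-- The pairing is non-degenerate in the first variable. -/
theorem pairing_injective
    (hS : Function.Bijective (HopfAlgebra.antipode k : H →ₗ[k] H))
    {g : GroupLike k H} (hg : IsGrouplikeCointegral g μ)
    {lamH : H →ₗ[k] k} (hn : lamH Λ = 1) {gH : H} (hgH : IsDistinguishedGrouplike lamH gH)
    (M N : FDMod k L) : Function.Injective (pairing hμ α hb hΛ hα M N) := by
  rw [← LinearMap.ker_eq_bot, LinearMap.ker_eq_bot']
  intro (ζ : ihomSpace H N ((hμ.serreFunctor α).obj M)) hζ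
  obtain ⟨r, t, t', ht⟩ := hb M
  -- Vanishing on rank-one maps says `Λ₂ ⊗ ζ(g⁻¹ Λ₁ ⊗ n) = 0`, and the first legs of `Δ(Λ)` span.
  have h1 (n : N) : slice hμ α ζ n ∘ₗ LinearMap.mulLeft k ((g⁻¹ : GroupLike k H) : H) = 0 := by
    apply hΛ.ext_left hn hgH
    apply (TensorProduct.comm k M H).injective
    refine eq_of_forall_frobenius hμ ht fun F => ?_
    have h2 : (0 : k) = _ := (LinearMap.congr_fun hζ (toIHom (rankOne F n))).symm.trans
      (pairing_rankOne hμ α hb hΛ hα hS hg (Coalgebra.Repr.arbitrary k Λ).eq ζ F n)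
    rw [← (Coalgebra.Repr.arbitrary k Λ).eq]
    simpa using h2.symm
  apply Subtype.ext
  apply TensorProduct.ext'
  intro h n
  have h2 := LinearMap.congr_fun (h1 n) (g * h)
  have h3 : ((g⁻¹ : GroupLike k H) : H) * (g * h) = h := by
    rw [← mul_assoc, ← GroupLike.val_mul, inv_mul_cancel, GroupLike.val_one, one_mul]
  rw [LinearMap.comp_apply, LinearMap.mulLeft_apply, h3] at h2
  exact h2

/-- The pairing is non-degenerate in the second variable. -/
theorem pairing_flip_injective {lamH : H →ₗ[k] k} (hlamH : IsRightCointegral lamH)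
    (hn : lamH Λ = 1) {gH : H} (hgH : IsDistinguishedGrouplike lamH gH)
    (M N : FDMod k L) : Function.Injective (pairing hμ α hb hΛ hα M N).flip := by
  rw [← LinearMap.ker_eq_bot, LinearMap.ker_eq_bot']
  intro (ξ : ihomSpace H M N) hξ
  obtain ⟨r, t, t', ht⟩ := hb N
  -- Now the rank-one map stands in the other argument: the pairing equals `μ(F(Λ₁ ⊗ ξ(Λ₂ ⊗ m)))`
  -- directly from the trace formula, without the cointegral property of `μ`.
  have h1 (m : M) : ξ.1 ∘ₗ (TensorProduct.mk k H M).flip m = 0 := by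
    apply hΛ.ext_right hlamH hn hgH
    refine eq_of_forall_frobenius hμ ht fun F => ?_
    have h2 := pairing_apply hμ α hb hΛ hα
      (rankOne F ((untwist hμ α M).symm m)) (ofIHom ξ)
    have h3 : comulComp (ofIHom ξ) ≫ rankOne F ((untwist hμ α M).symm m) =
        rankOne (comulComp (ofIHom ξ) ≫ F) ((untwist hμ α M).symm m) := by
      simp [rankOne]
    rw [h3, traceLinear_rankOne hμ α hb hα, LinearEquiv.apply_symm_apply,
      toLin_comulComp (Coalgebra.Repr.arbitrary k Λ).eq] at h2
    rw [← (Coalgebra.Repr.arbitrary k Λ).eq]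
    have h4 : (0 : k) = _ := (LinearMap.congr_fun hξ
      (toIHom (rankOne F ((untwist hμ α M).symm m)))).symm.trans h2
    simp only [map_sum] at h4
    simpa using h4.symm
  apply Subtype.ext
  apply TensorProduct.ext'
  intro h n
  exact LinearMap.congr_fun (h1 n) h

end Pairing

end FDMod

/-! ### Explicit formulas for duals -/

namespace ModCat

section

variable {C : Type u₁} [Category.{v₁} C] [MonoidalCategory C] [RightRigidCategory C]

theorem dualMap_eval {X Y : C} (f : X ⟶ Y) :
    dualMap f ▷ X ≫ dualEval X = dual Y ◁ f ≫ dualEval Y :=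
  rightAdjointMate_comp_evaluation f

omit [RightRigidCategory C] in
theorem tensor_evaluation_eq {X₁ X₂ Y₁ Y₂ : C} [ExactPairing X₁ Y₁] [ExactPairing X₂ Y₂] :
    ε_ (X₁ ⊗ X₂) (Y₂ ⊗ Y₁) = (α_ Y₂ Y₁ (X₁ ⊗ X₂)).hom ≫
      Y₂ ◁ ((α_ Y₁ X₁ X₂).inv ≫ ε_ X₁ Y₁ ▷ X₂ ≫ (λ_ X₂).hom) ≫ ε_ X₂ Y₂ := by
  rw [ExactPairing.tensor_evaluation]
  monoidal

/-- The isomorphism compares two duals of `X ⊗ Y`, so it is the mate of the identity. Compatibility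
with evaluations characterises it and makes it computable on functionals. -/
theorem dualTensor_eval (X Y : C) :
    (dualTensor X Y).hom ▷ (X ⊗ Y) ≫ (α_ (dual Y) (dual X) (X ⊗ Y)).hom ≫
      dual Y ◁ ((α_ (dual X) X Y).inv ≫ dualEval X ▷ Y ≫ (λ_ Y).hom) ≫ dualEval Y =
    dualEval (X ⊗ Y) := by
  have h := @rightAdjointMate_comp_evaluation C _ _ (X ⊗ Y) (X ⊗ Y)
    (@HasRightDual.mk _ _ _ _ (dual Y ⊗ dual X) ExactPairing.tensor) _ (𝟙 (X ⊗ Y))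
  rw [whiskerLeft_id, Category.id_comp] at h
  exact (congrArg (fun t => (dualTensor X Y).hom ▷ (X ⊗ Y) ≫ t)
    (tensor_evaluation_eq (X₁ := X) (X₂ := Y) (Y₁ := dual X) (Y₂ := dual Y)).symm).trans h

theorem dualUnit_eval : (dualUnit C).hom ▷ (𝟙_ C) ≫ (ρ_ (𝟙_ C)).hom = dualEval (𝟙_ C) := by
  have h := @rightAdjointMate_comp_evaluation C _ _ (𝟙_ C) (𝟙_ C)
    (@HasRightDual.mk _ _ _ _ (𝟙_ C) exactPairingUnit) (RightRigidCategory.rightDual (𝟙_ C)) (𝟙 (𝟙_ C))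
  rw [whiskerLeft_id, Category.id_comp] at h
  exact h

end

end ModCat

namespace FDMod

section DualFormulas

variable {k H : Type u} [Field k] [Ring H] [HopfAlgebra k H]

/-- The linear map underlying `f* : Y* ⟶ X*`. -/
noncomputable def dualMapLin {X Y : FDMod k H} (f : X ⟶ Y) : Module.Dual k Y →ₗ[k] Module.Dual k X :=
  Hom.hom (ModCat.dualMap f)

theorem dualMapLin_apply {X Y : FDMod k H} (f : X ⟶ Y) (ω : Module.Dual k Y) (x : X) :
    dualMapLin f ω x = ω (Hom.hom f x) :=
  LinearMap.congr_fun (congrArg Hom.hom (ModCat.dualMap_eval f)) (ω ⊗ₜ[k] x : Module.Dual k Y ⊗[k] X)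

/-- The linear equivalence underlying `(X ⊗ Y)* ≅ Y* ⊗ X*`. -/
noncomputable def dualTensorLin (X Y : FDMod k H) :
    Module.Dual k (X ⊗[k] Y) ≃ₗ[k] Module.Dual k Y ⊗[k] Module.Dual k X :=
  LinearEquiv.ofLinearMap
    (Hom.hom (ModCat.dualTensor X Y).hom :
      Module.Dual k (X ⊗[k] Y) →ₗ[k] Module.Dual k Y ⊗[k] Module.Dual k X)
    (Hom.hom (ModCat.dualTensor X Y).inv :
      Module.Dual k Y ⊗[k] Module.Dual k X →ₗ[k] Module.Dual k (X ⊗[k] Y))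
    (congrArg Hom.hom (ModCat.dualTensor X Y).inv_hom_id)
    (congrArg Hom.hom (ModCat.dualTensor X Y).hom_inv_id)

/-- The inverse takes values in functionals, so evaluation determines it. The forward map is then
read off from a dual basis of either factor. -/
theorem dualTensorLin_symm_apply (X Y : FDMod k H) (g : Module.Dual k Y) (f : Module.Dual k X)
    (x : X) (y : Y) : (dualTensorLin X Y).symm (g ⊗ₜ f) (x ⊗ₜ y) = f x * g y := by
  have h := congrArg (fun e => (ModCat.dualTensor X Y).inv ▷ (X ⊗ Y) ≫ e)
    (ModCat.dualTensor_eval X Y)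
  simp only [← comp_whiskerRight_assoc, Iso.inv_hom_id, id_whiskerRight, Category.id_comp] at h
  have h2 := LinearMap.congr_fun (congrArg Hom.hom h)
    ((g ⊗ₜ[k] f) ⊗ₜ[k] (x ⊗ₜ[k] y) :
      (Module.Dual k Y ⊗[k] Module.Dual k X) ⊗[k] (X ⊗[k] Y))
  refine h2.symm.trans ?_
  change g (f x • y) = _
  simp

theorem dualTensorLin_apply_left {X Y : FDMod k H} {ι : Type*} {s : Finset ι} {b : ι → X}
    {b' : ι → Module.Dual k X} (hb : ∀ x, ∑ i ∈ s, b' i x • b i = x)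
    (ω : Module.Dual k (X ⊗[k] Y)) :
    dualTensorLin X Y ω = ∑ i ∈ s, (ω ∘ₗ TensorProduct.mk k X Y (b i)) ⊗ₜ b' i := by
  rw [← LinearEquiv.eq_symm_apply]
  apply TensorProduct.ext'
  intro x y
  rw [map_sum, LinearMap.sum_apply]
  simp only [dualTensorLin_symm_apply]
  conv_lhs => rw [← hb x, sum_tmul, map_sum]
  simp [← smul_tmul']

theorem dualTensorLin_apply_right {X Y : FDMod k H} {ι : Type*} {s : Finset ι} {b : ι → Y}
    {b' : ι → Module.Dual k Y} (hb : ∀ y, ∑ i ∈ s, b' i y • b i = y)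
    (ω : Module.Dual k (X ⊗[k] Y)) :
    dualTensorLin X Y ω = ∑ i ∈ s, b' i ⊗ₜ (ω ∘ₗ (TensorProduct.mk k X Y).flip (b i)) := by
  rw [← LinearEquiv.eq_symm_apply]
  apply TensorProduct.ext'
  intro x y
  rw [map_sum, LinearMap.sum_apply]
  simp only [dualTensorLin_symm_apply]
  conv_lhs => rw [← hb y, tmul_sum, map_sum]
  simp [mul_comm]

/-- The linear equivalence underlying `𝟙* ≅ 𝟙`. -/
noncomputable def dualUnitLin (k H : Type u) [Field k] [Ring H] [HopfAlgebra k H] :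
    Module.Dual k k ≃ₗ[k] k :=
  LinearEquiv.ofLinearMap
    (Hom.hom (ModCat.dualUnit (FDMod k H)).hom : Module.Dual k k →ₗ[k] k)
    (Hom.hom (ModCat.dualUnit (FDMod k H)).inv : k →ₗ[k] Module.Dual k k)
    (congrArg Hom.hom (ModCat.dualUnit (FDMod k H)).inv_hom_id)
    (congrArg Hom.hom (ModCat.dualUnit (FDMod k H)).hom_inv_id)

theorem dualUnitLin_apply (ω : Module.Dual k k) : dualUnitLin k H ω = ω 1 := by
  have h := LinearMap.congr_fun (congrArg Hom.hom (ModCat.dualUnit_eval (C := FDMod k H)))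
    (ω ⊗ₜ[k] (1 : k) : Module.Dual k k ⊗[k] k)
  refine Eq.trans ?_ h
  exact (one_smul k (dualUnitLin k H ω)).symm

theorem dualUnitLin_symm_apply (c d : k) : (dualUnitLin k H).symm c d = c * d := by
  have h : (dualUnitLin k H).symm c = c • LinearMap.id := by
    rw [LinearEquiv.symm_apply_eq, dualUnitLin_apply]
    simp
  rw [h]
  simp

/-- The linear map underlying `𝟙** ⟶ 𝟙`. -/
noncomputable def doubleDualUnitLin (k H : Type u) [Field k] [Ring H] [HopfAlgebra k H] :
    Module.Dual k (Module.Dual k k) →ₗ[k] k :=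
  Hom.hom (ModCat.doubleDualUnit (FDMod k H))

theorem doubleDualUnitLin_apply (c : k) :
    doubleDualUnitLin k H (Module.Dual.eval k k c) = c := by
  change dualUnitLin k H (dualMapLin (X := 𝟙_ (FDMod k H)) (ModCat.dualUnit (FDMod k H)).inv
    (Module.Dual.eval k k c)) = c
  refine (dualUnitLin_apply (H := H) _).trans ?_
  refine (dualMapLin_apply (X := 𝟙_ (FDMod k H)) (ModCat.dualUnit (FDMod k H)).inv
    (Module.Dual.eval k k c) (1 : k)).trans ?_
  exact (dualUnitLin_symm_apply (H := H) 1 c).trans (one_mul c)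

/-- The linear map underlying `(X ⊗ Y)** ⟶ X** ⊗ Y**`. -/
noncomputable def doubleDualTensorLin (X Y : FDMod k H) :
    Module.Dual k (Module.Dual k (X ⊗[k] Y)) →ₗ[k]
      Module.Dual k (Module.Dual k X) ⊗[k] Module.Dual k (Module.Dual k Y) :=
  Hom.hom (ModCat.doubleDualTensor X Y)

/-- Under `Φ` the canonical isomorphism of double duals is the identity, so the tensor axiom of a
twisted structure becomes a statement about `X ⊗ Y` itself. -/
theorem doubleDualTensorLin_apply (X Y : FDMod k H) (x : X) (y : Y) :
    doubleDualTensorLin X Y (Module.Dual.eval k (X ⊗[k] Y) (x ⊗ₜ y)) =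
      Module.Dual.eval k X x ⊗ₜ Module.Dual.eval k Y y := by
  refine (LinearEquiv.eq_symm_apply (dualTensorLin (dualModule Y) (dualModule X))).1 ?_
  apply TensorProduct.ext'
  intro g f
  refine (dualMapLin_apply (X := dualModule Y ⊗ dualModule X) (Y := dualModule (X ⊗ Y))
    (ModCat.dualTensor X Y).inv (Module.Dual.eval k (X ⊗[k] Y) (x ⊗ₜ y)) (g ⊗ₜ[k] f)).trans ?_
  refine (dualTensorLin_symm_apply X Y g f x y).trans ?_
  refine Eq.trans ?_ (dualTensorLin_symm_apply (dualModule Y) (dualModule X)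
    (Module.Dual.eval k X x) (Module.Dual.eval k Y y) g f).symm
  exact mul_comm _ _

end DualFormulas

end FDMod

/-! ### The relative Serre functor -/

namespace FDMod

section Serre

variable {k H L : Type u} [Field k] [Ring H] [HopfAlgebra k H] [FiniteDimensional k H]
  [Ring L] [Algebra k L] [FiniteDimensional k L] [LeftComoduleAlgebra k H L]

omit [FiniteDimensional k L] in
theorem pre_apply {M M' N : FDMod k L} (f : M ⟶ M') (ξ : regular k H ⊙ₗ M' ⟶ N) :
    (Hom.hom ((internalHom k H L).pre f N) (toIHom ξ) : ihomSpace H M N) =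
      toIHom (regular k H ⊴ₗ f ≫ ξ) := by
  apply Subtype.ext
  apply TensorProduct.ext'
  intro h m
  change (toIHom ξ).1 ((1 * h) ⊗ₜ Hom.hom f m) = (toIHom ξ).1 (h ⊗ₜ Hom.hom f m)
  rw [one_mul]

/-- Composition with `g`, as a linear map between internal Hom spaces. -/
noncomputable def mapLin (M : FDMod k L) {N N' : FDMod k L} (g : N ⟶ N') :
    ihomSpace H M N →ₗ[k] ihomSpace H M N' :=
  Hom.hom (((internalHom k H L).obj M).map g)

/-- Precomposition with `f`, as a linear map between internal Hom spaces. -/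
noncomputable def preLin {M M' : FDMod k L} (f : M ⟶ M') (N : FDMod k L) :
    ihomSpace H M' N →ₗ[k] ihomSpace H M N :=
  Hom.hom ((internalHom k H L).pre f N)

omit [FiniteDimensional k L] in
-- The coevaluation is the map `h ⊗ m ↦ ε(h) m`, so `h₁ ε(h₂) = h` gives the identity.
theorem comulComp_coev (M : FDMod k L) :
    comulComp (ofIHom (Hom.hom ((internalHom k H L).coev M) (1 : k) : ihomSpace H M M)) =
      𝟙 (regular k H ⊙ₗ M) := by
  apply hom_ext
  apply TensorProduct.ext'
  intro (h : H) m
  have hc (a : H) (m : M) : (show ihomSpace H M M from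
      Hom.hom ((internalHom k H L).coev M) (1 : k)).1 (a ⊗ₜ m) = Coalgebra.counit (R := k) a • m := by
    change (Coalgebra.counit (R := k) a * 1) • m = _
    rw [mul_one]
  have h1 : ∀ z : H ⊗[k] H, (show ihomSpace H M M from
      Hom.hom ((internalHom k H L).coev M) (1 : k)).1.lTensor H
      (TensorProduct.assoc k H H M (z ⊗ₜ m)) =
      TensorProduct.rid k H ((Coalgebra.counit (R := k)).lTensor H z) ⊗ₜ m := by
    intro z
    induction z with
    | zero => simp
    | add x y hx hy => simp only [map_add, add_tmul, hx, hy]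
    | tmul a b =>
      rw [TensorProduct.assoc_tmul, LinearMap.lTensor_tmul, hc]
      simp [smul_tmul]
  refine (comulComp_hom _ (h ⊗ₜ m)).trans ((h1 _).trans ?_)
  rw [Coalgebra.lTensor_counit_comul, TensorProduct.rid_tmul, one_smul]
  rfl

variable {μ : L →ₗ[k] k} (hμ : IsFrobeniusForm μ) (α : H →ₐ[k] k) {Λ : H}
  (hb : HasDualBases k H L) (hΛ : IsRightIntegral k Λ) (hα : IsModularFunction Λ α)

include hα in
-- On a rank-one map both sides are `μ(F(Λ ⊗ f(n)))`. This cyclicity yields the naturality of `φ` in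
-- its first argument.
theorem traceLinear_map {M M' : FDMod k L} (f : M ⟶ M')
    (χ : regular k H ⊙ₗ M' ⟶ (hμ.serreFunctor α).obj M) :
    traceLinear hμ α Λ hb M' (toIHom (χ ≫ (hμ.serreFunctor α).map f)) =
      traceLinear hμ α Λ hb M (toIHom (regular k H ⊴ₗ f ≫ χ)) := by
  obtain ⟨r, t, t', ht⟩ := hb M'
  have key : traceLinear hμ α Λ hb M' ∘ₗ mapLin M' ((hμ.serreFunctor α).map f) =
      traceLinear hμ α Λ hb M ∘ₗ preLin f ((hμ.serreFunctor α).obj M) := by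
    apply ihomSpace_hom_ext ht
    intro F n
    have h1 : mapLin M' ((hμ.serreFunctor α).map f) (toIHom (rankOne F n)) =
        toIHom (rankOne F (Hom.hom ((hμ.serreFunctor α).map f) n)) := by
      apply Subtype.ext
      refine LinearMap.ext fun w => ?_
      exact Hom.comm ((hμ.serreFunctor α).map f) _ n
    have h2 : preLin f ((hμ.serreFunctor α).obj M) (toIHom (rankOne F n)) =
        toIHom (rankOne (regular k H ⊴ₗ f ≫ F) n) := pre_apply f (rankOne F n)
    rw [LinearMap.comp_apply, LinearMap.comp_apply, h1, h2, traceLinear_rankOne hμ α hb hα,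
      traceLinear_rankOne hμ α hb hα]
    rfl
  exact (LinearMap.congr_fun key (toIHom χ)).trans
    (congrArg (traceLinear hμ α Λ hb M) (pre_apply f χ))

/-- The isomorphism `[N, S M] ≅ [M, N]*`. -/
noncomputable def pairingIso
    (hp : ∀ M N, Function.Bijective (pairing hμ α hb hΛ hα M N)) (M N : FDMod k L) :
    (internalHom k H L).hom N ((hμ.serreFunctor α).obj M) ≅
      ModCat.dual ((internalHom k H L).hom M N) :=
  mkIso (V := ihomModule H N ((hμ.serreFunctor α).obj M)) (W := dualModule (ihomModule H M N))
    (LinearEquiv.ofBijective (pairing hμ α hb hΛ hα M N) (hp M N)) fun h ζ =>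
      LinearMap.ext fun ξ => pairing_act hμ α hb hΛ hα h ζ ξ

omit [FiniteDimensional k L] in
theorem comulComp_pre {M M' N : FDMod k L} (f : M ⟶ M') (ξ : regular k H ⊙ₗ M' ⟶ N) :
    comulComp (regular k H ⊴ₗ f ≫ ξ) = regular k H ⊴ₗ f ≫ comulComp ξ := by
  apply hom_ext
  apply TensorProduct.ext'
  intro (h : H) m
  have key : ∀ z : H ⊗[k] H,
      (toIHom (regular k H ⊴ₗ f ≫ ξ)).1.lTensor H (TensorProduct.assoc k H H M (z ⊗ₜ m)) =
      (toIHom ξ).1.lTensor H (TensorProduct.assoc k H H M' (z ⊗ₜ Hom.hom f m)) := by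
    intro z
    induction z with
    | zero => simp
    | add x y hx hy => simp only [map_add, add_tmul, hx, hy]
    | tmul a b => rfl
  exact key (Coalgebra.comul (R := k) h)

omit [FiniteDimensional k L] in
theorem comulComp_map {M N N' K : FDMod k L} (g : N ⟶ N') (ξ : regular k H ⊙ₗ M ⟶ N)
    (ζ : regular k H ⊙ₗ N' ⟶ K) :
    comulComp (ξ ≫ g) ≫ ζ = comulComp ξ ≫ (regular k H ⊴ₗ g ≫ ζ) := by
  simp [comulComp, MonoidalLeftAction.actionHomRight_comp]

/-- The relative Serre functor structure induced by the trace. -/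
noncomputable def relativeSerre
    (hp : ∀ M N, Function.Bijective (pairing hμ α hb hΛ hα M N)) :
    ModCat.RelativeSerre (internalHom k H L) (hμ.serreFunctor α) where
  iso M N := (pairingIso hμ α hb hΛ hα hp M N).symm
  naturality_left {M M'} f N := by
    -- Only the direction `[N, S M] ⟶ [M, N]*` is explicit, so the square is transposed to the
    -- pairing.
    rw [Iso.symm_hom, Iso.symm_hom, Iso.eq_inv_comp, ← Category.assoc, Iso.comp_inv_eq]
    apply hom_ext
    refine LinearMap.ext fun (ζ : ihomSpace H N ((hμ.serreFunctor α).obj M)) => ?_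
    refine LinearMap.ext fun (ξ : ihomSpace H M' N) => ?_
    have h1 : pairing hμ α hb hΛ hα M N ζ (toIHom (regular k H ⊴ₗ f ≫ ofIHom ξ)) =
        pairing hμ α hb hΛ hα M' N (toIHom (ofIHom ζ ≫ (hμ.serreFunctor α).map f)) ξ := by
      refine (pairing_apply hμ α hb hΛ hα (ofIHom ζ) _).trans ?_
      refine Eq.trans ?_ (pairing_apply hμ α hb hΛ hα _ (ofIHom ξ)).symm
      rw [comulComp_pre, ← Category.assoc, traceLinear_map hμ α hb hα, Category.assoc]
    refine (dualMapLin_apply ((internalHom k H L).pre f N)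
      (pairing hμ α hb hΛ hα M N ζ) ξ).trans ?_
    exact (congrArg (pairing hμ α hb hΛ hα M N ζ) (pre_apply f (ofIHom ξ))).trans h1
  naturality_right M {N N'} g := by
    rw [Iso.symm_hom, Iso.symm_hom, Iso.eq_inv_comp, ← Category.assoc, Iso.comp_inv_eq]
    apply hom_ext
    refine LinearMap.ext fun (ζ : ihomSpace H N' ((hμ.serreFunctor α).obj M)) => ?_
    refine LinearMap.ext fun (ξ : ihomSpace H M N) => ?_
    have h1 : pairing hμ α hb hΛ hα M N' ζ (toIHom (ofIHom ξ ≫ g)) =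
        pairing hμ α hb hΛ hα M N (toIHom (regular k H ⊴ₗ g ≫ ofIHom ζ)) ξ := by
      refine (pairing_apply hμ α hb hΛ hα (ofIHom ζ) _).trans ?_
      refine Eq.trans ?_ (pairing_apply hμ α hb hΛ hα _ (ofIHom ξ)).symm
      rw [comulComp_map]
    refine (dualMapLin_apply (((internalHom k H L).obj M).map g)
      (pairing hμ α hb hΛ hα M N' ζ) ξ).trans ?_
    refine h1.trans ?_
    exact congrArg (fun χ => pairing hμ α hb hΛ hα M N χ ξ) (pre_apply g (ofIHom ζ)).symm

variable (hp : ∀ M N, Function.Bijective (pairing hμ α hb hΛ hα M N))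

/-- The abstract trace of `φ` evaluates `⟨ξ, -⟩` at the coevaluation, and composing with the
coevaluation does nothing; so it returns the functional from which `φ` was built. -/
theorem relativeSerre_trace (M : FDMod k L) :
    (relativeSerre hμ α hb hΛ hα hp).trace M = traceHom hμ α hb hΛ hα M := by
  apply hom_ext
  refine LinearMap.ext fun (ξ : ihomSpace H M ((hμ.serreFunctor α).obj M)) => ?_
  refine (dualUnitLin_apply (k := k) (H := H) (dualMapLin (X := 𝟙_ (FDMod k H))
    ((internalHom k H L).coev M) (pairing hμ α hb hΛ hα M M ξ))).trans ?_
  refine (dualMapLin_apply ((internalHom k H L).coev M) (pairing hμ α hb hΛ hα M M ξ)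
    (1 : k)).trans ?_
  refine (pairing_apply hμ α hb hΛ hα (ofIHom ξ) (ofIHom (Hom.hom ((internalHom k H L).coev M)
    (1 : k) : ihomSpace H M M))).trans ?_
  rw [comulComp_coev, Category.id_comp]
  rfl

theorem relativeSerre_isInducedByTrace :
    (relativeSerre hμ α hb hΛ hα hp).IsInducedByTrace := by
  intro M N
  rw [relativeSerre_trace, ← cancel_epi (((relativeSerre hμ α hb hΛ hα hp).iso M N).inv ▷
    (internalHom k H L).hom M N), ← comp_whiskerRight_assoc, Iso.inv_hom_id, id_whiskerRight,
    Category.id_comp]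
  apply hom_ext
  apply TensorProduct.ext'
  intro ζ ξ
  rfl

theorem relativeSerre_hasTraceFormula :
    HasTraceFormula Λ (relativeSerre hμ α hb hΛ hα hp) := by
  refine fun M => ⟨hb M, fun n t t' ht ξ => ?_⟩
  rw [relativeSerre_trace]
  exact LinearMap.congr_fun (traceLinear_eq_traceOf hμ α hb hα ht) ξ

end Serre

end FDMod

/-! ### The bimodule structure of the internal Hom functor -/

namespace FDMod

section Structures

variable {k H L : Type u} [Field k] [Ring H] [HopfAlgebra k H] [FiniteDimensional k H]
  [Ring L] [Algebra k L] [LeftComoduleAlgebra k H L]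

/-- The left module structure of the internal Hom functor, as a linear map. -/
noncomputable def leftStrLin (X : FDMod k H) (M N : FDMod k L) :
    X ⊗[k] ihomSpace H M N →ₗ[k] ihomSpace H M (X ⊙ₗ N) :=
  Hom.hom ((internalHom k H L).leftStr X M N)

/-- The right module structure of the internal Hom functor, as a linear map. -/
noncomputable def rightStrLin (X : FDMod k H) (M N : FDMod k L) :
    ihomSpace H M N ⊗[k] Module.Dual k X →ₗ[k] ihomSpace H (X ⊙ₗ M) N :=
  Hom.hom ((internalHom k H L).rightStr X M N)

theorem leftStrLin_apply {X : FDMod k H} {M N : FDMod k L} (x : X) (ξ : ihomSpace H M N)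
    (h : H) (m : M) :
    ((leftStrLin X M N (x ⊗ₜ ξ)).1 (h ⊗ₜ m) : X ⊗[k] N) =
      TensorProduct.map (X.act.toLinearMap.flip x) (ξ.1 ∘ₗ (TensorProduct.mk k H M).flip m)
        (Coalgebra.comul (R := k) h) := by
  obtain ⟨F, hF, hF'⟩ : ∃ F : (X ⊗[k] ihomModule H M N) ⊗[k] M →ₗ[k] X ⊗[k] N,
      F = Hom.hom ((αₗ X ((internalHom k H L).hom M N) M).hom ≫
        X ⊴ₗ ((internalHom k H L).ev M N)) ∧
      ∀ (x : X) (ξ : ihomModule H M N) m, F ((x ⊗ₜ ξ) ⊗ₜ m) =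
        x ⊗ₜ (ξ : ihomSpace H M N).1 (1 ⊗ₜ m) :=
    ⟨_, rfl, fun _ _ _ => rfl⟩
  have key (z : H ⊗[k] H) :
      F (tensorAct X.act (ihomModule H M N).act z (x ⊗ₜ (ξ : ihomModule H M N)) ⊗ₜ m) =
      TensorProduct.map (X.act.toLinearMap.flip x) (ξ.1 ∘ₗ (TensorProduct.mk k H M).flip m) z := by
    induction z with
    | zero => simp
    | add x y hx hy => simp only [map_add, LinearMap.add_apply, add_tmul, hx, hy]
    | tmul a b =>
      refine (hF' _ _ _).trans ?_
      change X.act a x ⊗ₜ ξ.1 ((1 * b) ⊗ₜ m) = X.act a x ⊗ₜ ξ.1 (b ⊗ₜ m)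
      rw [one_mul]
  refine Eq.trans ?_ (key (Coalgebra.comul (R := k) h))
  rw [hF]
  rfl

/-- The map `a ↦ θ(S(a) x)`. -/
noncomputable def dualCoeff {X : FDMod k H} (θ : Module.Dual k X) (x : X) : H →ₗ[k] k :=
  θ ∘ₗ X.act.toLinearMap.flip x ∘ₗ HopfAlgebra.antipode k

omit [FiniteDimensional k H] in
@[simp] theorem dualCoeff_apply {X : FDMod k H} (θ : Module.Dual k X) (x : X) (a : H) :
    dualCoeff θ x a = θ (X.act (HopfAlgebra.antipode k a) x) := rfl

/-- Currying lets `h` act on `ξ ⊗ θ` by `Δ(h)`, and the action on `θ` is transposed through `S`. The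
value is `ξ(h₁ ⊗ ⟨θ, S(h₂) x⟩ m)`. -/
theorem rightStrLin_apply {X : FDMod k H} {M N : FDMod k L} (ξ : ihomSpace H M N)
    (θ : Module.Dual k X) (h : H) (x : X) (m : M) :
    (rightStrLin X M N (ξ ⊗ₜ θ)).1 (h ⊗ₜ[k] (x ⊗ₜ[k] m : X ⊗[k] M)) =
      ξ.1 (TensorProduct.rid k H ((dualCoeff θ x).lTensor H (Coalgebra.comul (R := k) h)) ⊗ₜ m) := by
  obtain ⟨F, hF, hF'⟩ : ∃ F : (ihomModule H M N ⊗[k] Module.Dual k X) ⊗[k] (X ⊗[k] M) →ₗ[k] N,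
      F = Hom.hom ((αₗ ((internalHom k H L).hom M N) (ModCat.dual X) (X ⊙ₗ M)).hom ≫
        ((internalHom k H L).hom M N) ⊴ₗ ((αₗ (ModCat.dual X) X M).inv ≫
          (ModCat.dualEval X) ⊵ₗ M ≫ (λₗ M).hom) ≫ (internalHom k H L).ev M N) ∧
      ∀ (ξ : ihomModule H M N) (θ : Module.Dual k X) (x : X) (m : M),
        F ((ξ ⊗ₜ θ) ⊗ₜ (x ⊗ₜ m)) = (ξ : ihomSpace H M N).1 (1 ⊗ₜ (θ x • m)) :=
    ⟨_, rfl, fun _ _ _ _ => rfl⟩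
  have key (z : H ⊗[k] H) :
      F (tensorAct (ihomModule H M N).act (dualAct X.act) z ((ξ : ihomModule H M N) ⊗ₜ θ)
        ⊗ₜ (x ⊗ₜ m)) =
      ξ.1 (TensorProduct.rid k H ((dualCoeff θ x).lTensor H z) ⊗ₜ m) := by
    induction z with
    | zero => simp
    | add x y hx hy => simp only [map_add, LinearMap.add_apply, add_tmul, hx, hy]
    | tmul a b =>
      refine (hF' _ _ _ _).trans ?_
      change ξ.1 ((1 * a) ⊗ₜ (dualCoeff θ x b • m)) = ξ.1 ((dualCoeff θ x b • a) ⊗ₜ m)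
      rw [one_mul, tmul_smul, smul_tmul']
  refine Eq.trans ?_ (key (Coalgebra.comul (R := k) h))
  rw [hF]
  rfl

/-- The left structure is itself a composite with the map `h ↦ h x`, which lets associativity of
composition apply to it. -/
theorem leftStrLin_eq {X : FDMod k H} {M N : FDMod k L} (x : X) (ξ : regular k H ⊙ₗ M ⟶ N) :
    leftStrLin X M N (x ⊗ₜ toIHom ξ) = toIHom (comulComp ξ ≫ ofElement x ⊵ₗ N) := by
  apply Subtype.ext
  apply TensorProduct.ext'
  intro h m
  refine (leftStrLin_apply x (toIHom ξ) h m).trans ?_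
  have key : ∀ z : H ⊗[k] H, TensorProduct.map (X.act.toLinearMap.flip x)
      ((toIHom ξ).1 ∘ₗ (TensorProduct.mk k H M).flip m) z =
      (X.act.toLinearMap.flip x).rTensor N ((toIHom ξ).1.lTensor H
        (TensorProduct.assoc k H H M (z ⊗ₜ m))) := by
    intro z
    induction z with
    | zero => simp
    | add x y hx hy => simp only [map_add, add_tmul, hx, hy]
    | tmul a b => rfl
  exact key (Coalgebra.comul (R := k) h)

/-- Coassociativity of `Δ`: `comulComp` is coKleisli extension for the comonad `H ⊙ₗ -`, and this is
the associativity of coKleisli composition. -/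
theorem comulComp_comulComp {M N K : FDMod k L} (ξ : regular k H ⊙ₗ M ⟶ N)
    (η : regular k H ⊙ₗ N ⟶ K) :
    comulComp (comulComp ξ ≫ η) = comulComp ξ ≫ comulComp η := by
  apply hom_ext
  apply TensorProduct.ext'
  intro (h : H) m
  have h1 : ∀ z : H ⊗[k] H, (toIHom (comulComp ξ ≫ η)).1.lTensor H
      (TensorProduct.assoc k H H M (z ⊗ₜ m)) =
      TensorProduct.map LinearMap.id ((toIHom η).1 ∘ₗ
        ((toIHom ξ).1 ∘ₗ (TensorProduct.mk k H M).flip m).lTensor H)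
        ((Coalgebra.comul (R := k)).lTensor H z) := by
    intro z
    induction z with
    | zero => simp
    | add x y hx hy => simp only [map_add, add_tmul, hx, hy]
    | tmul a b =>
      change a ⊗ₜ (toIHom η).1 ((toIHom ξ).1.lTensor H
        (TensorProduct.assoc k H H M (Coalgebra.comul (R := k) b ⊗ₜ m))) =
        a ⊗ₜ (toIHom η).1 (((toIHom ξ).1 ∘ₗ (TensorProduct.mk k H M).flip m).lTensor H
          (Coalgebra.comul (R := k) b))
      congr 2
      generalize Coalgebra.comul (R := k) b = w
      induction w with
      | zero => simp
      | add x y hx hy => simp only [map_add, add_tmul, hx, hy]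
      | tmul a b => rfl
  obtain ⟨G, hG, hG'⟩ : ∃ G : H ⊗[k] N →ₗ[k] H ⊗[k] K, G = Hom.hom (comulComp η) ∧
      ∀ w, G w = (toIHom η).1.lTensor H (TensorProduct.assoc k H H N
        ((Coalgebra.comul (R := k)).rTensor N w)) := ⟨_, rfl, fun _ => rfl⟩
  have h2 : ∀ z : H ⊗[k] H, G ((toIHom ξ).1.lTensor H (TensorProduct.assoc k H H M (z ⊗ₜ m))) =
      TensorProduct.map LinearMap.id ((toIHom η).1 ∘ₗ
        ((toIHom ξ).1 ∘ₗ (TensorProduct.mk k H M).flip m).lTensor H)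
        (TensorProduct.assoc k H H H ((Coalgebra.comul (R := k)).rTensor H z)) := by
    intro z
    induction z with
    | zero => simp
    | add x y hx hy => simp only [map_add, add_tmul, hx, hy]
    | tmul a b =>
      have h3 : ∀ n : N, ∀ w : H ⊗[k] H, (toIHom ξ).1 (b ⊗ₜ m) = n →
          (toIHom η).1.lTensor H (TensorProduct.assoc k H H N (w ⊗ₜ n)) =
          TensorProduct.map LinearMap.id ((toIHom η).1 ∘ₗ
            ((toIHom ξ).1 ∘ₗ (TensorProduct.mk k H M).flip m).lTensor H)
            (TensorProduct.assoc k H H H (w ⊗ₜ b)) := by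
        intro n w hn
        induction w with
        | zero => simp only [zero_tmul, map_zero]
        | add x y hx hy => simp only [map_add, add_tmul, hx, hy]
        | tmul a c => subst hn; rfl
      exact (hG' _).trans (h3 _ _ rfl)
  refine (h1 (Coalgebra.comul (R := k) h)).trans ?_
  rw [← Coalgebra.coassoc_apply]
  refine (h2 (Coalgebra.comul (R := k) h)).symm.trans ?_
  rw [hG]
  rfl

theorem comulComp_ofElement {Y : FDMod k H} {N K : FDMod k L} (ζ : regular k H ⊙ₗ (Y ⊙ₗ N) ⟶ K)
    (y : Y) (h : H) (n : N) :
    (toIHom (comulComp (ofElement y ⊵ₗ N) ≫ ζ)).1 (h ⊗ₜ n) =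
      (toIHom ζ).1 (((TensorProduct.mk k Y N).flip n).lTensor H
        ((Y.act.toLinearMap.flip y).lTensor H (Coalgebra.comul (R := k) h))) := by
  have key : ∀ z : H ⊗[k] H, (toIHom (ofElement y ⊵ₗ N)).1.lTensor H
      (TensorProduct.assoc k H H N (z ⊗ₜ n)) =
      ((TensorProduct.mk k Y N).flip n).lTensor H ((Y.act.toLinearMap.flip y).lTensor H z) := by
    intro z
    induction z with
    | zero => simp only [zero_tmul, map_zero]; rfl
    | add x y hx hy => simp only [map_add, add_tmul, hx, hy]; rfl
    | tmul a b => rfl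
  exact congrArg (toIHom ζ).1 (key (Coalgebra.comul (R := k) h))

/-- The right module structure reconstructs `ζ` from the maps `h ⊗ n ↦ ζ(h₁ ⊗ h₂ y ⊗ n)`. -/
theorem sum_rightStrLin {Y : FDMod k H} {N K : FDMod k L} (ζ : regular k H ⊙ₗ (Y ⊙ₗ N) ⟶ K)
    {ι : Type*} {s : Finset ι} {b : ι → Y} {b' : ι → Module.Dual k Y}
    (hb : ∀ y, ∑ i ∈ s, b' i y • b i = y) :
    ∑ i ∈ s, rightStrLin Y N K (toIHom (comulComp (ofElement (b i) ⊵ₗ N) ≫ ζ) ⊗ₜ b' i) =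
      toIHom ζ := by
  apply Subtype.ext
  rw [AddSubmonoidClass.coe_finsetSum]
  have key : ∀ (h : H) (y : Y) (n : N), ∑ i ∈ s, (rightStrLin Y N K
      (toIHom (comulComp (ofElement (b i) ⊵ₗ N) ≫ ζ) ⊗ₜ b' i)).1 (h ⊗ₜ[k] (y ⊗ₜ[k] n : Y ⊗[k] N)) =
      (toIHom ζ).1 (h ⊗ₜ[k] (y ⊗ₜ[k] n : Y ⊗[k] N)) := by
    intro h y n
    let T : H ⊗[k] Y →ₗ[k] K := (toIHom ζ).1 ∘ₗ ((TensorProduct.mk k Y N).flip n).lTensor H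
    simp only [rightStrLin_apply]
    have hr := (Coalgebra.Repr.arbitrary k h).eq
    have h1 : ∀ i, TensorProduct.rid k H ((dualCoeff (b' i) y).lTensor H
        (Coalgebra.comul (R := k) h)) = ∑ j ∈ (Coalgebra.Repr.arbitrary k h).index,
        dualCoeff (b' i) y ((Coalgebra.Repr.arbitrary k h).right j) •
          (Coalgebra.Repr.arbitrary k h).left j := by
      intro i
      conv_lhs => rw [← hr]
      simp
    simp only [h1, sum_tmul, map_sum, ← smul_tmul', map_smul, comulComp_ofElement]
    rw [Finset.sum_comm]
    -- The dual basis sum expands `S(c) y`, so each term becomes the value of `T` at `a₁ ⊗ a₂ S(c)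
    -- y`; with `a = h₁`, `c = h₂` this is `h₁ ⊗ h₂ S(h₃) y = h ⊗ y`.
    have h2 : ∀ (a c : H), ∑ i ∈ s, dualCoeff (b' i) y c •
        T ((Y.act.toLinearMap.flip (b i)).lTensor H (Coalgebra.comul (R := k) a)) =
        T ((Y.act.toLinearMap.flip y).lTensor H
          (Coalgebra.comul (R := k) a * (1 ⊗ₜ[k] HopfAlgebra.antipode k c))) := by
      intro a c
      have h3 : (Y.act.toLinearMap.flip (Y.act (HopfAlgebra.antipode k c) y)).lTensor H
          (Coalgebra.comul (R := k) a) = (Y.act.toLinearMap.flip y).lTensor H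
          (Coalgebra.comul (R := k) a * (1 ⊗ₜ[k] HopfAlgebra.antipode k c)) := by
        generalize Coalgebra.comul (R := k) a = w
        induction w with
        | zero => simp
        | add x y hx hy => simp only [map_add, add_mul, hx, hy]
        | tmul a b => simp
      rw [← h3]
      conv_rhs => rw [← hb (Y.act (HopfAlgebra.antipode k c) y)]
      simp only [map_sum, map_smul, dualCoeff_apply]
      generalize Coalgebra.comul (R := k) a = w
      induction w with
      | zero => simp
      | add x y hx hy => simp only [map_add, smul_add, Finset.sum_add_distrib, hx, hy]
      | tmul a b => simp [tmul_sum]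
    refine (Finset.sum_congr rfl fun j _ => h2 _ _).trans ?_
    rw [← map_sum, ← map_sum, sum_comul_mul_antipode hr]
    have h5 : (Y.act.toLinearMap.flip y).lTensor H (h ⊗ₜ 1) = h ⊗ₜ y := by simp
    rw [h5]
    rfl
  have h4 : ∀ (f f' : H ⊗[k] (Y ⊗[k] N) →ₗ[k] K), (∀ h y n, f (h ⊗ₜ (y ⊗ₜ n)) =
      f' (h ⊗ₜ (y ⊗ₜ n))) → f = f' := fun f f' hf =>
    TensorProduct.ext' fun h w => by
      induction w with
      | zero => simp
      | add x y hx hy => simp only [tmul_add, map_add, hx, hy]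
      | tmul y n => exact hf h y n
  refine h4 _ _ fun h y n => ?_
  have h5 : ∀ (F : ι → H ⊗[k] (Y ⊙ₗ N : FDMod k L) →ₗ[k] K) w,
      (∑ i ∈ s, F i) w = ∑ i ∈ s, F i w := fun F w => LinearMap.sum_apply _ _ _
  exact (h5 _ _).trans (key h y n)

end Structures

end FDMod

/-! ### Compatibility of the relative Serre functor with the bimodule structures -/

section HopfIntegrals

variable {k H : Type u} [Field k] [Ring H] [HopfAlgebra k H] [FiniteDimensional k H]

open HopfAlgebra Coalgebra

/-- If `Λ₂ ⊗ v(Λ₁) = Λ₂ ⊗ S(Λ₃) u(Λ₁)`, then `v(h) = S³(h₁) g u(h₂)`. -/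
theorem IsRightIntegral.eq_antipode_smul {Λ : H} {μ : H →ₗ[k] k} {g : H}
    (hΛ : IsRightIntegral k Λ) (hμ : IsRightCointegral μ) (hn : μ Λ = 1)
    (hg : IsDistinguishedGrouplike μ g) {V W : Type*} [AddCommGroup V] [Module k V]
    [AddCommGroup W] [Module k W] (E : H →ₗ[k] W →ₗ[k] V) (u : H →ₗ[k] W) (v : H →ₗ[k] V)
    {ι : Type*} {s : Finset ι} {x y : ι → H} (hxy : ∑ i ∈ s, x i ⊗ₜ[k] y i = comul (R := k) Λ)
    (huv : ∑ i ∈ s, y i ⊗ₜ[k] v (x i) =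
      ∑ i ∈ s, (E.flip (u (x i)) ∘ₗ antipode k).lTensor H (comul (R := k) (y i))) (h : H) :
    v h = TensorProduct.lift ((E ∘ₗ LinearMap.mulRight k g ∘ₗ antipode k ∘ₗ antipode k ∘ₗ
      antipode k).compl₂ u) (comul (R := k) h) := by
  let E' : H →ₗ[k] W →ₗ[k] V :=
    E ∘ₗ LinearMap.mulRight k g ∘ₗ antipode k ∘ₗ antipode k ∘ₗ antipode k
  let G : H ⊗[k] (H ⊗[k] H) →ₗ[k] H ⊗[k] V :=
    TensorProduct.lift ((LinearMap.lTensorHom H).comp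
      (E.flip ∘ₗ u) : H →ₗ[k] H ⊗[k] H →ₗ[k] H ⊗[k] V)
  have hG : ∀ a (z : H ⊗[k] H), G (a ⊗ₜ z) = (E.flip (u a)).lTensor H z := fun _ _ => rfl
  -- Both sides are linear in `h`, and the first legs of `Δ(Λ)` span `H`, so it suffices to compare
  -- them there.
  suffices hv : v = TensorProduct.lift (E'.compl₂ u) ∘ₗ comul (R := k) from LinearMap.congr_fun hv h
  apply hΛ.ext_left hn hg
  apply (TensorProduct.comm k V H).injective
  have hL : TensorProduct.comm k V H (v.rTensor H (comul (R := k) Λ)) =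
      ∑ i ∈ s, y i ⊗ₜ[k] v (x i) := by
    rw [← hxy]
    simp
  have h1 : ∑ i ∈ s, (E.flip (u (x i)) ∘ₗ antipode k).lTensor H (comul (R := k) (y i)) =
      ∑ i ∈ s, G (TensorProduct.assoc k H H H (comul (R := k) (x i) ⊗ₜ antipode k (y i))) := by
    have h2 : ∀ z : H ⊗[k] (H ⊗[k] H), G ((antipode k).lTensor H |>.lTensor H z) =
        (G ∘ₗ ((antipode k).lTensor H).lTensor H) z := fun _ => rfl
    have h3 := Coalgebra.coassoc_apply (R := k) Λ
    rw [← hxy] at h3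
    have h4 := congrArg (G ∘ₗ ((antipode k).lTensor H).lTensor H) h3
    simp only [map_sum, LinearMap.rTensor_tmul, LinearMap.lTensor_tmul, LinearMap.comp_apply,
      hG] at h4
    simp only [LinearMap.lTensor_comp, LinearMap.comp_apply]
    rw [← h4]
    refine Finset.sum_congr rfl fun i _ => ?_
    congr 1
    generalize comul (R := k) (x i) = z
    induction z with
    | zero => simp
    | add x y hx hy => simp only [map_add, add_tmul, hx, hy]
    | tmul a b => simp
  -- After regrouping by coassociativity, `Λ₁ ⊗ S(Λ₂)` is exchanged for `Λ₂ ⊗ S³(Λ₁) g`: thus `Λ₂ ⊗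
  -- S(Λ₃) u(Λ₁)` becomes `Λ₃ ⊗ S³(Λ₁) g u(Λ₂)`.
  have h5 := congrArg (fun z => G (TensorProduct.assoc k H H H
    ((comul (R := k)).rTensor H z))) (hΛ.sum_tmul_antipode hμ hn hg hxy)
  simp only [map_sum, LinearMap.rTensor_tmul] at h5
  rw [hL, huv, h1, h5]
  let G' : H ⊗[k] (H ⊗[k] H) →ₗ[k] H ⊗[k] V :=
    (TensorProduct.comm k V H).toLinearMap ∘ₗ (TensorProduct.lift (E'.compl₂ u)).rTensor H ∘ₗ
      (TensorProduct.assoc k H H H).symm.toLinearMap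
  have h6 : ∀ i, G (TensorProduct.assoc k H H H (comul (R := k) (y i) ⊗ₜ
      (antipode k (antipode k (antipode k (x i))) * g))) = G' (x i ⊗ₜ comul (R := k) (y i)) := by
    intro i
    generalize comul (R := k) (y i) = z
    induction z with
    | zero => simp
    | add x y hx hy => simp only [map_add, add_tmul, tmul_add, hx, hy]
    | tmul a b => simp [hG, G', E']
  simp only [h6]
  have h7 := Coalgebra.coassoc_apply (R := k) Λ
  rw [← hxy] at h7
  have h8 := congrArg G' h7
  simp only [map_sum, LinearMap.lTensor_tmul] at h8
  rw [← h8, ← hxy]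
  simp only [map_sum, G', LinearMap.comp_apply, LinearEquiv.coe_coe,
    LinearEquiv.symm_apply_apply, LinearMap.rTensor_tmul]

end HopfIntegrals

/-! ### Compatibility with the right module structure -/

namespace FDMod

section Bimodule

variable {k H L : Type u} [Field k] [Ring H] [HopfAlgebra k H] [FiniteDimensional k H]
  [Ring L] [Algebra k L] [FiniteDimensional k L] [LeftComoduleAlgebra k H L]
  {μ : L →ₗ[k] k} (hμ : IsFrobeniusForm μ) (α : H →ₐ[k] k) {Λ : H}
  (hb : HasDualBases k H L) (hΛ : IsRightIntegral k Λ) (hα : IsModularFunction Λ α)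
  (hp : ∀ M N, Function.Bijective (pairing hμ α hb hΛ hα M N))

/-- The linear map underlying `[M, N]* ≅ [N, S M]`. -/
noncomputable def serreLin (M N : FDMod k L) :
    Module.Dual k (ihomSpace H M N) →ₗ[k] ihomSpace H N ((hμ.serreFunctor α).obj M) :=
  Hom.hom ((relativeSerre hμ α hb hΛ hα hp).iso M N).hom

theorem serreLin_pairing {M N : FDMod k L} (ζ : ihomSpace H N ((hμ.serreFunctor α).obj M)) :
    serreLin hμ α hb hΛ hα hp M N (pairing hμ α hb hΛ hα M N ζ) = ζ :=
  LinearMap.congr_fun (congrArg Hom.hom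
    ((relativeSerre hμ α hb hΛ hα hp).iso M N).inv_hom_id) ζ

theorem pairing_serreLin {M N : FDMod k L} (ω : Module.Dual k (ihomSpace H M N)) :
    pairing hμ α hb hΛ hα M N (serreLin hμ α hb hΛ hα hp M N ω) = ω :=
  LinearMap.congr_fun (congrArg Hom.hom
    ((relativeSerre hμ α hb hΛ hα hp).iso M N).hom_inv_id) ω

/-- Associativity of composition: the factor `y` moves from the second argument of the pairing into
the first. -/
theorem pairing_leftStrLin {Y : FDMod k H} {M N : FDMod k L}
    (ζ : regular k H ⊙ₗ (Y ⊙ₗ N) ⟶ (hμ.serreFunctor α).obj M) (y : Y)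
    (ξ : regular k H ⊙ₗ M ⟶ N) :
    pairing hμ α hb hΛ hα M (Y ⊙ₗ N) (toIHom ζ) (leftStrLin Y M N (y ⊗ₜ toIHom ξ)) =
      pairing hμ α hb hΛ hα M N (toIHom (comulComp (ofElement y ⊵ₗ N) ≫ ζ)) (toIHom ξ) := by
  rw [leftStrLin_eq, pairing_apply]
  refine Eq.trans ?_ (pairing_apply hμ α hb hΛ hα _ _).symm
  rw [comulComp_comulComp, Category.assoc]

/-- Tested on `⟨ζ, -⟩`, a dual basis of `Y` produces the maps `h ⊗ n ↦ ζ(h₁ ⊗ h₂ e i ⊗ n)`, from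
which `sum_rightStrLin` rebuilds `ζ`. -/
theorem relativeSerre_right (Y : FDMod k H) (M N : FDMod k L) :
    ((relativeSerre hμ α hb hΛ hα hp).iso M (Y ⊙ₗ N)).hom =
      ModCat.dualMap ((internalHom k H L).leftStr Y M N) ≫
        (ModCat.dualTensor Y ((internalHom k H L).hom M N)).hom ≫
        ((relativeSerre hμ α hb hΛ hα hp).iso M N).hom ▷ ModCat.dual Y ≫
        (internalHom k H L).rightStr Y N ((hμ.serreFunctor α).obj M) := by
  rw [← cancel_epi ((relativeSerre hμ α hb hΛ hα hp).iso M (Y ⊙ₗ N)).inv, Iso.inv_hom_id]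
  apply hom_ext
  refine LinearMap.ext fun (ζ : ihomSpace H (Y ⊙ₗ N) ((hμ.serreFunctor α).obj M)) => ?_
  let e := Module.finBasis k Y
  have he : ∀ y, ∑ i, e.coord i y • e i = y := fun y => e.sum_repr y
  have h1 : dualMapLin ((internalHom k H L).leftStr Y M N)
      (pairing hμ α hb hΛ hα M (Y ⊙ₗ N) ζ) =
      (pairing hμ α hb hΛ hα M (Y ⊙ₗ N) ζ ∘ₗ leftStrLin Y M N :
        Y ⊗[k] ihomSpace H M N →ₗ[k] k) :=
    LinearMap.ext fun w => dualMapLin_apply _ _ w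
  have h2 : ∀ i, serreLin hμ α hb hΛ hα hp M N
      ((pairing hμ α hb hΛ hα M (Y ⊙ₗ N) ζ ∘ₗ leftStrLin Y M N :
        Y ⊗[k] ihomSpace H M N →ₗ[k] k) ∘ₗ TensorProduct.mk k Y (ihomSpace H M N) (e i)) =
      toIHom (comulComp (ofElement (e i) ⊵ₗ N) ≫ ofIHom ζ) := by
    intro i
    rw [← serreLin_pairing hμ α hb hΛ hα hp (toIHom (comulComp (ofElement (e i) ⊵ₗ N) ≫ ofIHom ζ))]
    refine congrArg _ (LinearMap.ext fun ξ => ?_)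
    exact pairing_leftStrLin hμ α hb hΛ hα (ofIHom ζ) (e i) (ofIHom ξ)
  have h3 : (serreLin hμ α hb hΛ hα hp M N).rTensor (Module.Dual k Y)
      (dualTensorLin Y (ihomModule H M N) (dualMapLin ((internalHom k H L).leftStr Y M N)
        (pairing hμ α hb hΛ hα M (Y ⊙ₗ N) ζ))) =
      ∑ i, toIHom (comulComp (ofElement (e i) ⊵ₗ N) ≫ ofIHom ζ) ⊗ₜ e.coord i := by
    refine (congrArg _ ((congrArg _ h1).trans (dualTensorLin_apply_left he _))).trans ?_
    refine (map_sum _ _ _).trans (Finset.sum_congr rfl fun i _ => ?_)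
    exact congrArg (· ⊗ₜ[k] e.coord i) (h2 i)
  have h4 : rightStrLin Y N ((hμ.serreFunctor α).obj M)
      ((serreLin hμ α hb hΛ hα hp M N).rTensor (Module.Dual k Y)
      (dualTensorLin Y (ihomModule H M N) (dualMapLin ((internalHom k H L).leftStr Y M N)
        (pairing hμ α hb hΛ hα M (Y ⊙ₗ N) ζ)))) = ζ := by
    rw [h3, map_sum]
    exact sum_rightStrLin (ofIHom ζ) he
  exact h4.symm

end Bimodule

end FDMod

/-! ### Compatibility with the left module structure: the origin of `g⁻¹ g_H` -/

namespace FDMod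

section Twist

variable {k H L : Type u} [Field k] [Ring H] [HopfAlgebra k H] [FiniteDimensional k H]
  [Ring L] [Algebra k L] [FiniteDimensional k L] [LeftComoduleAlgebra k H L]

/-- The map `a ↦ (x ⊗ m ↦ θ(a x) m)`. -/
noncomputable def coeffContract {X : FDMod k H} (θ : Module.Dual k X) (M : FDMod k L) :
    H →ₗ[k] X ⊗[k] M →ₗ[k] M where
  toFun a := (TensorProduct.lid k M).toLinearMap ∘ₗ (θ ∘ₗ X.act a).rTensor M
  map_add' a b := by
    ext x m
    simp [add_smul]
  map_smul' c a := by
    ext x m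
    simp [mul_smul]

omit [FiniteDimensional k H] [FiniteDimensional k L] [LeftComoduleAlgebra k H L] in
@[simp] theorem coeffContract_tmul {X : FDMod k H} (θ : Module.Dual k X) (M : FDMod k L) (a : H)
    (x : X) (m : M) : coeffContract θ M a (x ⊗ₜ m) = θ (X.act a x) • m := by
  simp [coeffContract]

theorem rightStrLin_rankOne {X : FDMod k H} {M N : FDMod k L} (F : regular k H ⊙ₗ M ⟶ regular k L)
    (n : N) (θ : Module.Dual k X) :
    rightStrLin X M N (toIHom (rankOne F n) ⊗ₜ θ) =
      toIHom (rankOne (ofIHom (rightStrLin X M (regular k L) (toIHom F ⊗ₜ θ))) n) := by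
  have h4 : ∀ (f f' : H ⊗[k] (X ⊗[k] M) →ₗ[k] N), (∀ h x m, f (h ⊗ₜ (x ⊗ₜ m)) =
      f' (h ⊗ₜ (x ⊗ₜ m))) → f = f' := fun f f' hf =>
    TensorProduct.ext' fun h w => by
      induction w with
      | zero => simp
      | add x y hx hy => simp only [tmul_add, map_add, hx, hy]
      | tmul y n => exact hf h y n
  apply Subtype.ext
  refine h4 _ _ fun h x m => ?_
  refine (rightStrLin_apply _ θ h x m).trans ?_
  exact congrArg (fun a : L => N.act a n) (rightStrLin_apply (toIHom F) θ h x m).symm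

theorem toLin_rightStrLin {X : FDMod k H} {M : FDMod k L} (F : regular k H ⊙ₗ M ⟶ regular k L)
    (θ : Module.Dual k X) (h : H) (w : X ⊗[k] M) :
    toLin (ofIHom (rightStrLin X M (regular k L) (toIHom F ⊗ₜ θ))) (h ⊗ₜ w) =
      toLin F (((coeffContract θ M).flip w ∘ₗ HopfAlgebra.antipode k).lTensor H
        (Coalgebra.comul (R := k) h)) := by
  obtain ⟨G, hG, hG'⟩ : ∃ G : H ⊗[k] (X ⊗[k] M) →ₗ[k] L,
      G = toLin (ofIHom (rightStrLin X M (regular k L) (toIHom F ⊗ₜ θ))) ∧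
      ∀ h x m, G (h ⊗ₜ (x ⊗ₜ m)) = toLin F (TensorProduct.rid k H ((dualCoeff θ x).lTensor H
        (Coalgebra.comul (R := k) h)) ⊗ₜ m) :=
    ⟨_, rfl, fun h x m => rightStrLin_apply (toIHom F) θ h x m⟩
  have key : G (h ⊗ₜ w) = toLin F (((coeffContract θ M).flip w ∘ₗ
      HopfAlgebra.antipode k).lTensor H (Coalgebra.comul (R := k) h)) := by
    induction w with
    | zero => simp
    | add x y hx hy =>
      rw [tmul_add, map_add, hx, hy, ← map_add, ← LinearMap.add_apply, ← LinearMap.lTensor_add,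
        ← LinearMap.add_comp, ← map_add]
    | tmul x m =>
      rw [hG']
      congr 1
      generalize Coalgebra.comul (R := k) h = z
      induction z with
      | zero => simp
      | add x y hx hy => simp only [map_add, add_tmul, hx, hy]
      | tmul a b => simp [smul_tmul]
  rw [hG] at key
  exact key

variable {μ : L →ₗ[k] k} (hμ : IsFrobeniusForm μ) (α : H →ₐ[k] k) {Λ : H}
  (hb : HasDualBases k H L) (hΛ : IsRightIntegral k Λ) (hα : IsModularFunction Λ α)

/-- The map `h ↦ ζ(h ⊗ n)`, with values in `X ⊗ M`. -/
noncomputable def sliceTensor {X : FDMod k H} {M N : FDMod k L}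
    (ζ : ihomSpace H N ((hμ.serreFunctor α).obj (X ⊙ₗ M))) (n : N) : H →ₗ[k] X ⊗[k] M :=
  slice hμ α ζ n

/-- The functional `ξ ↦ ⟨ζ, ξ ⊗ θ⟩`. -/
noncomputable def pairingRight {X : FDMod k H} {M N : FDMod k L}
    (ζ : ihomSpace H N ((hμ.serreFunctor α).obj (X ⊙ₗ M))) (θ : Module.Dual k X) :
    Module.Dual k (ihomSpace H M N) :=
  pairing hμ α hb hΛ hα (X ⊙ₗ M) N ζ ∘ₗ rightStrLin X M N ∘ₗ
    (TensorProduct.mk k (ihomSpace H M N) (Module.Dual k X)).flip θ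

/-- Tensoring with `θ` keeps a map rank-one, so the key formula applies to `X ⊙ₗ M`; the right
structure then contributes `S(Λ₃)`. The value is `μ(F(Λ₂ ⊗ θ(S(Λ₃) ζ(g⁻¹ Λ₁ ⊗ n))))`. -/
theorem pairingRight_rankOne (hS : Function.Bijective (HopfAlgebra.antipode k : H →ₗ[k] H))
    {g : GroupLike k H} (hg : IsGrouplikeCointegral g μ) {ι : Type*} {s : Finset ι}
    {x y : ι → H} (hxy : ∑ i ∈ s, x i ⊗ₜ[k] y i = Coalgebra.comul (R := k) Λ)
    {X : FDMod k H} {M N : FDMod k L}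
    (ζ : ihomSpace H N ((hμ.serreFunctor α).obj (X ⊙ₗ M))) (θ : Module.Dual k X)
    (F : regular k H ⊙ₗ M ⟶ regular k L) (n : N) :
    pairingRight hμ α hb hΛ hα ζ θ (toIHom (rankOne F n)) =
      μ (toLin F (∑ i ∈ s, ((coeffContract θ M).flip (sliceTensor hμ α ζ n
        ((g⁻¹ : GroupLike k H) * x i)) ∘ₗ HopfAlgebra.antipode k).lTensor H
          (Coalgebra.comul (R := k) (y i)))) := by
  refine (congrArg (pairing hμ α hb hΛ hα (X ⊙ₗ M) N ζ) (rightStrLin_rankOne F n θ)).trans ?_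
  refine (pairing_rankOne hμ α hb hΛ hα hS hg hxy ζ _ n).trans (congrArg μ ?_)
  refine (map_sum _ _ _).trans (Eq.trans ?_ (map_sum (toLin F) _ _).symm)
  exact Finset.sum_congr rfl fun i _ => toLin_rightStrLin F θ (y i) _

/-- Comparing the key formula for the representing element with `pairingRight_rankOne` gives an
equation in the legs of `Λ`, which `eq_antipode_smul` solves. Removing the shift by `g⁻¹` means
evaluating at `g h`, and `S³(g h₁) g_H = S³(h₁) g⁻¹ g_H`. -/
theorem slice_serreLin (hp : ∀ M N, Function.Bijective (pairing hμ α hb hΛ hα M N))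
    (hS : Function.Bijective (HopfAlgebra.antipode k : H →ₗ[k] H))
    {g : GroupLike k H} (hg : IsGrouplikeCointegral g μ) {lamH : H →ₗ[k] k}
    (hlamH : IsRightCointegral lamH) (hn : lamH Λ = 1) {gH : GroupLike k H}
    (hgH : IsDistinguishedGrouplike lamH (gH : H)) {X : FDMod k H} {M N : FDMod k L}
    (ζ : ihomSpace H N ((hμ.serreFunctor α).obj (X ⊙ₗ M))) (θ : Module.Dual k X) (n : N) (h : H) :
    slice hμ α (serreLin hμ α hb hΛ hα hp M N (pairingRight hμ α hb hΛ hα ζ θ)) n h =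
      TensorProduct.lift ((coeffContract θ M ∘ₗ
        LinearMap.mulRight k ((g⁻¹ * gH : GroupLike k H) : H) ∘ₗ HopfAlgebra.antipode k ∘ₗ
        HopfAlgebra.antipode k ∘ₗ HopfAlgebra.antipode k).compl₂ (sliceTensor hμ α ζ n))
        (Coalgebra.comul (R := k) h) := by
  have hinv (a : H) : ((g⁻¹ : GroupLike k H) : H) * (g * a) = a := by
    rw [← mul_assoc, ← GroupLike.val_mul, inv_mul_cancel, GroupLike.val_one, one_mul]
  obtain ⟨r, t, t', ht⟩ := hb M
  set ζ' := serreLin hμ α hb hΛ hα hp M N (pairingRight hμ α hb hΛ hα ζ θ)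
  have hxy := (Coalgebra.Repr.arbitrary k Λ).eq
  have h1 := hΛ.eq_antipode_smul hlamH hn hgH (coeffContract θ M)
    (sliceTensor hμ α ζ n ∘ₗ LinearMap.mulLeft k ((g⁻¹ : GroupLike k H) : H))
    (slice hμ α ζ' n ∘ₗ LinearMap.mulLeft k ((g⁻¹ : GroupLike k H) : H)) hxy
    (eq_of_forall_frobenius hμ ht fun F => by
      refine Eq.trans ?_ (pairingRight_rankOne hμ α hb hΛ hα hS hg hxy ζ θ F n)
      refine (pairing_rankOne hμ α hb hΛ hα hS hg hxy ζ' F n).symm.trans ?_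
      exact LinearMap.congr_fun (pairing_serreLin hμ α hb hΛ hα hp
        (pairingRight hμ α hb hΛ hα ζ θ)) (toIHom (rankOne F n))) (g * h)
  rw [LinearMap.comp_apply, LinearMap.mulLeft_apply, hinv] at h1
  rw [h1, Bialgebra.comul_mul, g.2.comul_eq_tmul_self]
  generalize Coalgebra.comul (R := k) h = z
  induction z with
  | zero => simp
  | add x y hx hy => simp only [map_add, mul_add, hx, hy]
  | tmul a b =>
    simp only [Algebra.TensorProduct.tmul_mul_tmul, TensorProduct.lift.tmul, LinearMap.compl₂_apply,
      LinearMap.comp_apply, LinearMap.mulLeft_apply, LinearMap.mulRight_apply, hinv,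
      HopfAlgebra.antipode_mul_antidistrib, g.2.antipode_antipode, mul_assoc, GroupLike.val_mul]
    rfl

end Twist

end FDMod

/-! ### Reassembling over a dual basis of `X` -/

namespace FDMod

section TwistedStructure

variable {k H L : Type u} [Field k] [Ring H] [HopfAlgebra k H]
  [Ring L] [Algebra k L] [LeftComoduleAlgebra k H L]
  {μ : L →ₗ[k] k} (hμ : IsFrobeniusForm μ) (α : H →ₐ[k] k)

/-- The action of a grouplike element as a linear equivalence. -/
noncomputable def actEquiv (X : FDMod k H) (c : GroupLike k H) : X ≃ₗ[k] X :=
  LinearEquiv.ofLinearMap (X.act c) (X.act (c⁻¹ : GroupLike k H))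
    (by rw [← Module.End.mul_eq_comp, ← map_mul, ← GroupLike.val_mul, mul_inv_cancel,
      GroupLike.val_one, map_one]; rfl)
    (by rw [← Module.End.mul_eq_comp, ← map_mul, ← GroupLike.val_mul, inv_mul_cancel,
      GroupLike.val_one, map_one]; rfl)

/-- The linear equivalence `S(X ⊗ M) → X** ⊗ S(M)`, `x ⊗ m ↦ c x ⊗ m`. -/
noncomputable def twistLin (c : GroupLike k H) (X : FDMod k H) (M : FDMod k L) :
    X ⊗[k] M ≃ₗ[k] Module.Dual k (Module.Dual k X) ⊗[k] (hμ.serreFunctor α).obj M :=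
  TensorProduct.congr ((actEquiv X c).trans (Module.evalEquiv k X)) (untwist hμ α M).symm

omit [LeftComoduleAlgebra k H L] in
theorem sum_eval_coeffContract {X : FDMod k H} (M : FDMod k L) {M' : Type*} [AddCommGroup M']
    [Module k M'] (e : M →ₗ[k] M') {ι : Type*} {s : Finset ι} {b : ι → X}
    {b' : ι → Module.Dual k X} (hbb : ∀ x, ∑ i ∈ s, b' i x • b i = x) (a d : H)
    (w : X ⊗[k] M) :
    ∑ i ∈ s, Module.Dual.eval k X (X.act a (b i)) ⊗ₜ[k] e (coeffContract (b' i) M d w) =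
      TensorProduct.map (Module.Dual.eval k X) e ((X.act (a * d)).rTensor M w) := by
  induction w with
  | zero => simp
  | add x y hx hy => simp only [map_add, tmul_add, Finset.sum_add_distrib, hx, hy]
  | tmul x m =>
    rw [LinearMap.rTensor_tmul, TensorProduct.map_tmul, map_mul, Module.End.mul_apply]
    conv_rhs => rw [← hbb (X.act d x)]
    simp only [coeffContract_tmul, map_sum, map_smul, sum_tmul, smul_tmul]

omit [LeftComoduleAlgebra k H L] in
/-- If `K i (h) = (b' i ⊗ id) (S³(h₁) c U(h₂))` for a dual basis `b`, `b'` of `X`, then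
`∑ i, h₁ Φ(b i) ⊗ K i (h₂) = (Φ ⊗ id) (c U(h))`. -/
theorem sum_map_dualModule {X : FDMod k H} (M : FDMod k L) {M' : Type*} [AddCommGroup M']
    [Module k M'] (e : M →ₗ[k] M') {ι : Type*} {s : Finset ι} {b : ι → X}
    {b' : ι → Module.Dual k X} (hbb : ∀ x, ∑ i ∈ s, b' i x • b i = x) (c : H)
    (U : H →ₗ[k] X ⊗[k] M) (K : ι → H →ₗ[k] M')
    (hK : ∀ i h, K i h = e (TensorProduct.lift ((coeffContract (b' i) M ∘ₗ
      LinearMap.mulRight k c ∘ₗ HopfAlgebra.antipode k ∘ₗ HopfAlgebra.antipode k ∘ₗ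
        HopfAlgebra.antipode k).compl₂ U) (Coalgebra.comul (R := k) h))) (h : H) :
    ∑ i ∈ s, TensorProduct.map
      (Module.Dual.eval k X ∘ₗ X.act.toLinearMap.flip (b i) ∘ₗ HopfAlgebra.antipode k ∘ₗ
        HopfAlgebra.antipode k) (K i) (Coalgebra.comul (R := k) h) =
      TensorProduct.map (Module.Dual.eval k X) e ((X.act c).rTensor M (U h)) := by
  let B : H →ₗ[k] X ⊗[k] M →ₗ[k] X ⊗[k] M := LinearMap.rTensorHom (M : Type u) ∘ₗ
    X.act.toLinearMap ∘ₗ LinearMap.mulRight k c ∘ₗ HopfAlgebra.antipode k ∘ₗ HopfAlgebra.antipode k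
  obtain ⟨J, hJ⟩ : ∃ J : H ⊗[k] H →ₗ[k] Module.Dual k (Module.Dual k X) ⊗[k] M',
      ∀ r q, J (r ⊗ₜ q) = TensorProduct.map (Module.Dual.eval k X) e
        ((X.act (HopfAlgebra.antipode k (HopfAlgebra.antipode k r) * c)).rTensor M (U q)) :=
    ⟨TensorProduct.map (Module.Dual.eval k X) e ∘ₗ TensorProduct.lift (B.compl₂ U),
      fun _ _ => rfl⟩
  -- The double dual action is through `S²`, so `S²(a)` meets `S³(p)` and gives `S²(a S(p))`; for
  -- the legs of `Δ(h)` this collapses to the counit.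
  have h2 : ∀ (a : H) (w : H ⊗[k] H), ∑ i ∈ s,
      Module.Dual.eval k X (X.act (HopfAlgebra.antipode k (HopfAlgebra.antipode k a)) (b i))
        ⊗ₜ[k] e (TensorProduct.lift ((coeffContract (b' i) M ∘ₗ
          LinearMap.mulRight k c ∘ₗ HopfAlgebra.antipode k ∘ₗ HopfAlgebra.antipode k ∘ₗ
            HopfAlgebra.antipode k).compl₂ U) w) =
      J ((mulAntipode k H).rTensor H ((TensorProduct.assoc k H H H).symm (a ⊗ₜ w))) := by
    intro a w
    induction w with
    | zero => simp
    | add x y hx hy => simp only [map_add, tmul_add, Finset.sum_add_distrib, hx, hy]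
    | tmul p q =>
      refine (sum_eval_coeffContract M e hbb _ _ (U q)).trans ?_
      rw [TensorProduct.assoc_symm_tmul, LinearMap.rTensor_tmul, mulAntipode_tmul, hJ]
      simp only [LinearMap.comp_apply, LinearMap.mulRight_apply,
        HopfAlgebra.antipode_mul_antidistrib, mul_assoc]
  have h1 : ∀ z : H ⊗[k] H, ∑ i ∈ s, TensorProduct.map
      (Module.Dual.eval k X ∘ₗ X.act.toLinearMap.flip (b i) ∘ₗ HopfAlgebra.antipode k ∘ₗ
        HopfAlgebra.antipode k) (K i) z =
      J ((mulAntipode k H).rTensor H ((TensorProduct.assoc k H H H).symm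
        ((Coalgebra.comul (R := k)).lTensor H z))) := by
    intro z
    induction z with
    | zero => simp
    | add x y hx hy => simp only [map_add, Finset.sum_add_distrib, hx, hy]
    | tmul a d =>
      rw [LinearMap.lTensor_tmul, ← h2]
      refine Finset.sum_congr rfl fun i _ => ?_
      rw [TensorProduct.map_tmul, hK]
      rfl
  have h3 := rTensor_coaction_cancel (δ := Coalgebra.comul (R := k) (A := H))
    (fun v => Coalgebra.coassoc_apply v) (fun v => by simp) (mulAntipode k H) mulAntipode_comul h
  rw [h1, h3, hJ, HopfAlgebra.antipode_one, HopfAlgebra.antipode_one,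
    one_mul]

variable [FiniteDimensional k H] [FiniteDimensional k L] {Λ : H}
  (hb : HasDualBases k H L) (hΛ : IsRightIntegral k Λ) (hα : IsModularFunction Λ α)

/-- The value of the left-hand side of the bimodule condition. -/
theorem sum_leftStrLin (hp : ∀ M N, Function.Bijective (pairing hμ α hb hΛ hα M N))
    (hS : Function.Bijective (HopfAlgebra.antipode k : H →ₗ[k] H))
    {g : GroupLike k H} (hg : IsGrouplikeCointegral g μ) {lamH : H →ₗ[k] k}
    (hlamH : IsRightCointegral lamH) (hn : lamH Λ = 1) {gH : GroupLike k H}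
    (hgH : IsDistinguishedGrouplike lamH (gH : H)) {X : FDMod k H} {M N : FDMod k L}
    (ζ : ihomSpace H N ((hμ.serreFunctor α).obj (X ⊙ₗ M)))
    {ι : Type*} {s : Finset ι} {b : ι → X} {b' : ι → Module.Dual k X}
    (hbb : ∀ x, ∑ i ∈ s, b' i x • b i = x) (h : H) (n : N) :
    ∑ i ∈ s, ((leftStrLin (dualModule (dualModule X)) N ((hμ.serreFunctor α).obj M)
      (Module.Dual.eval k X (b i) ⊗ₜ serreLin hμ α hb hΛ hα hp M N
        (pairingRight hμ α hb hΛ hα ζ (b' i)))).1 (h ⊗ₜ n) :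
        Module.Dual k (Module.Dual k X) ⊗[k] (hμ.serreFunctor α).obj M) =
      twistLin hμ α (g⁻¹ * gH) X M (sliceTensor hμ α ζ n h) := by
  refine (Finset.sum_congr rfl fun i _ => leftStrLin_apply _ _ h n).trans ?_
  refine (sum_map_dualModule M (untwist hμ α M).symm.toLinearMap hbb
    ((g⁻¹ * gH : GroupLike k H) : H) (sliceTensor hμ α ζ n) (fun i => (serreLin hμ α hb hΛ hα hp M N
      (pairingRight hμ α hb hΛ hα ζ (b' i))).1 ∘ₗ (TensorProduct.mk k H N).flip n)
    (fun i h => slice_serreLin hμ α hb hΛ hα hp hS hg hlamH hn hgH ζ (b' i) n h) h).trans ?_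
  generalize sliceTensor hμ α ζ n h = w
  induction w with
  | zero => simp only [map_zero]
  | add x y hx hy => simp only [map_add, hx, hy]
  | tmul x m => rfl

end TwistedStructure

end FDMod

namespace ModCat

variable {C : Type u₁} [Category.{v₁} C] [MonoidalCategory C]
  {M : Type u₂} [Category.{v₂} M] [MonoidalLeftAction C M]

/-- Composing with the coevaluation gives the transpose of `(λₗ m).hom ≫ f`, from which `f` is
recovered. -/
theorem InternalHom.eq_of_map_eq (I : InternalHom C M) {m n : M} {f g : m ⟶ n}
    (h : (I.obj m).map f = (I.obj m).map g) : f = g := by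
  have h1 : I.coev m ≫ (I.obj m).map f = I.coev m ≫ (I.obj m).map g := by rw [h]
  have h2 : ∀ f : m ⟶ n, I.coev m ≫ (I.obj m).map f = I.curry ((λₗ m).hom ≫ f) := fun f =>
    ((I.adj m).homEquiv_naturality_right _ _).symm
  rw [h2, h2] at h1
  exact (cancel_epi (λₗ m).hom).1 (((I.adj m).homEquiv _ _).injective h1)

/-- The twisted module structure of a relative Serre functor is unique. -/
theorem IsBimoduleIso.unique [RightRigidCategory C] {I : InternalHom C M} {S : M ⥤ M}
    {φ : RelativeSerre I S} {t t' : TwistedStructure C S} (h : IsBimoduleIso φ t)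
    (h' : IsBimoduleIso φ t') : t = t' := by
  apply TwistedStructure.ext
  funext X m
  apply Iso.ext
  apply I.eq_of_map_eq
  -- The left bimodule identity at `n = S(X ⊙ₗ m)` determines the image of the structure map under
  -- `[n, -]`, and this functor is faithful on maps out of `n`.
  rw [← cancel_epi (φ.iso (X ⊙ₗ m) (S.obj (X ⊙ₗ m))).hom, h.left, h'.left]

end ModCat

/-! ### The twisted module structure on the Serre functor -/

namespace FDMod

section TwistedStructure

variable {k H L : Type u} [Field k] [Ring H] [HopfAlgebra k H]
  [Ring L] [Algebra k L] [LeftComoduleAlgebra k H L]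
  {μ : L →ₗ[k] k} (hμ : IsFrobeniusForm μ) (α : H →ₐ[k] k)

/-- The map `x ⊗ m ↦ c x ⊗ m`, as a linear equivalence between the spaces underlying
`S(X ⊙ₗ M)` and `X** ⊙ₗ S(M)`. -/
noncomputable def strLin (c : GroupLike k H) (X : FDMod k H) (M : FDMod k L) :
    (hμ.serreFunctor α).obj (X ⊙ₗ M) ≃ₗ[k]
      (ModCat.dual (ModCat.dual X) ⊙ₗ (hμ.serreFunctor α).obj M : FDMod k L) :=
  twistLin hμ α c X M

theorem dualMapLin_dualMap {X Y : FDMod k H} (f : X ⟶ Y) (x : X) :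
    dualMapLin (ModCat.dualMap f) (Module.Dual.eval k X x) =
      Module.Dual.eval k Y (Hom.hom f x) := by
  refine LinearMap.ext fun ω => ?_
  refine (dualMapLin_apply (ModCat.dualMap f) (Module.Dual.eval k X x) ω).trans ?_
  exact dualMapLin_apply f ω x

theorem act_tensor_groupLike (X Y : FDMod k H) (c : GroupLike k H) (x : X) (y : Y) :
    ((X ⊗ Y).act c (x ⊗ₜ[k] y : X ⊗[k] Y) : X ⊗[k] Y) = X.act c x ⊗ₜ Y.act c y := by
  change tensorAct X.act Y.act (Coalgebra.comul (R := k) (c : H)) (x ⊗ₜ y) = _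
  rw [c.2.comul_eq_tmul_self, tensorAct_tmul]

theorem act_unit_groupLike (c : GroupLike k H) (x : k) :
    ((𝟙_ (FDMod k H) : FDMod k H).act c x : k) = x := by
  change Coalgebra.counit (R := k) (c : H) * x = x
  rw [c.2.counit_eq_one, one_mul]

/-- A twisted module structure given by the action of a grouplike element. -/
noncomputable def twistedStructure (c : GroupLike k H)
    (hc : ∀ (X : FDMod k H) (M : FDMod k L) (a : L) v,
      strLin hμ α c X M (((hμ.serreFunctor α).obj (X ⊙ₗ M)).act a v) =
        (ModCat.dual (ModCat.dual X) ⊙ₗ (hμ.serreFunctor α).obj M : FDMod k L).act a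
          (strLin hμ α c X M v)) :
    ModCat.TwistedStructure (FDMod k H) (hμ.serreFunctor α) where
  str X M := mkIso (strLin hμ α c X M) (hc X M)
  naturality_left {X Y} f M := by
    apply hom_ext
    apply TensorProduct.ext'
    intro (x : X) (m : M)
    have h1 : Module.Dual.eval k Y (Y.act c (Hom.hom f x)) =
        dualMapLin (ModCat.dualMap f) (Module.Dual.eval k X (X.act c x)) := by
      rw [dualMapLin_dualMap, Hom.comm f]
    exact congrArg (fun v => v ⊗ₜ[k] (untwist hμ α M).symm m) h1
  naturality_right X {M N} f := by
    apply hom_ext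
    exact TensorProduct.ext' fun x m => rfl
  unit M := by
    apply hom_ext
    apply TensorProduct.ext'
    intro (x : k) (m : M)
    have h1 : doubleDualUnitLin k H (Module.Dual.eval k k
        ((𝟙_ (FDMod k H) : FDMod k H).act c x : k)) = x :=
      (doubleDualUnitLin_apply (H := H) _).trans (act_unit_groupLike c x)
    exact congrArg (fun v : k => v • (untwist hμ α M).symm m) h1
  tensor X Y M := by
    apply hom_ext
    apply TensorProduct.ext_threefold
    intro (x : X) (y : Y) (m : M)
    -- The tensor axiom amounts to `Δ(c) = c ⊗ c`, just as the unit axiom amounts to `ε(c) = 1`.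
    have h1 := (congrArg (fun w : TensorProduct k X Y => doubleDualTensorLin X Y
      (Module.Dual.eval k (TensorProduct k X Y) w)) (act_tensor_groupLike X Y c x y)).trans
        (doubleDualTensorLin_apply X Y _ _)
    exact congrArg (fun v => TensorProduct.assoc k _ _ _ (v ⊗ₜ[k] (untwist hμ α M).symm m)) h1

variable [FiniteDimensional k H] [FiniteDimensional k L] {Λ : H}
  (hb : HasDualBases k H L) (hΛ : IsRightIntegral k Λ) (hα : IsModularFunction Λ α)
  (hp : ∀ M N, Function.Bijective (pairing hμ α hb hΛ hα M N))

/-- The right-hand side of the left bimodule condition, evaluated at the functional `⟨ζ, -⟩`. -/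
noncomputable def leftSide {X : FDMod k H} {M N : FDMod k L}
    (ζ : ihomSpace H N ((hμ.serreFunctor α).obj (X ⊙ₗ M))) :
    ihomSpace H N (ModCat.dual (ModCat.dual X) ⊙ₗ (hμ.serreFunctor α).obj M) :=
  leftStrLin (dualModule (dualModule X)) N ((hμ.serreFunctor α).obj M)
    ((serreLin hμ α hb hΛ hα hp M N).lTensor (Module.Dual k (Module.Dual k X))
      (dualTensorLin (ihomModule H M N) (dualModule X)
        (dualMapLin ((internalHom k H L).rightStr X M N)
          (pairing hμ α hb hΛ hα (X ⊙ₗ M) N ζ))))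

theorem leftSide_eq {X : FDMod k H} {M N : FDMod k L}
    (ζ : ihomSpace H N ((hμ.serreFunctor α).obj (X ⊙ₗ M)))
    {ι : Type*} {s : Finset ι} {b : ι → X} {b' : ι → Module.Dual k X}
    (hbb : ∀ x, ∑ i ∈ s, b' i x • b i = x) :
    leftSide hμ α hb hΛ hα hp ζ =
      ∑ i ∈ s, leftStrLin (dualModule (dualModule X)) N ((hμ.serreFunctor α).obj M)
        (Module.Dual.eval k X (b i) ⊗ₜ serreLin hμ α hb hΛ hα hp M N
          (pairingRight hμ α hb hΛ hα ζ (b' i))) := by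
  have hbb' : ∀ f : Module.Dual k X, ∑ i ∈ s, Module.Dual.eval k X (b i) f • b' i = f := by
    intro f
    ext x
    conv_rhs => rw [← hbb x]
    simp [mul_comm]
  have h1 : dualMapLin ((internalHom k H L).rightStr X M N)
      (pairing hμ α hb hΛ hα (X ⊙ₗ M) N ζ) =
      (pairing hμ α hb hΛ hα (X ⊙ₗ M) N ζ ∘ₗ rightStrLin X M N :
        ihomSpace H M N ⊗[k] Module.Dual k X →ₗ[k] k) :=
    LinearMap.ext fun w => dualMapLin_apply _ _ w
  refine (congrArg (fun w => leftStrLin (dualModule (dualModule X)) N ((hμ.serreFunctor α).obj M)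
    ((serreLin hμ α hb hΛ hα hp M N).lTensor (Module.Dual k (Module.Dual k X)) w))
    ((congrArg _ h1).trans (dualTensorLin_apply_right (Y := dualModule X) hbb' _))).trans ?_
  refine (congrArg (leftStrLin (dualModule (dualModule X)) N ((hμ.serreFunctor α).obj M))
    (map_sum ((serreLin hμ α hb hΛ hα hp M N).lTensor (Module.Dual k (Module.Dual k X)))
      (fun i => Module.Dual.eval k X (b i) ⊗ₜ[k] pairingRight hμ α hb hΛ hα ζ (b' i)) s)).trans ?_
  exact map_sum _ _ _

/-- Summed over a dual basis of `X`, the left bimodule condition says that the structure map is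
forced to be `x ⊗ m ↦ Φ(g⁻¹ g_H x) ⊗ m`. -/
theorem leftSide_coe (hS : Function.Bijective (HopfAlgebra.antipode k : H →ₗ[k] H))
    {g : GroupLike k H} (hg : IsGrouplikeCointegral g μ) {lamH : H →ₗ[k] k}
    (hlamH : IsRightCointegral lamH) (hn : lamH Λ = 1) {gH : GroupLike k H}
    (hgH : IsDistinguishedGrouplike lamH (gH : H)) {X : FDMod k H} {M N : FDMod k L}
    (ζ : ihomSpace H N ((hμ.serreFunctor α).obj (X ⊙ₗ M))) :
    (leftSide hμ α hb hΛ hα hp ζ).1 = (strLin hμ α (g⁻¹ * gH) X M).toLinearMap ∘ₗ ζ.1 := by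
  let e := Module.finBasis k X
  have he : ∀ x, ∑ i, e.coord i x • e i = x := fun x => e.sum_repr x
  rw [leftSide_eq hμ α hb hΛ hα hp ζ he, AddSubmonoidClass.coe_finsetSum]
  apply TensorProduct.ext'
  intro h n
  rw [LinearMap.sum_apply]
  exact sum_leftStrLin hμ α hb hΛ hα hp hS hg hlamH hn hgH ζ he h n

include hb hΛ hα hp in
-- The `L`-linearity of the structure map is not checked from the action on `S`: it is inherited.
-- For `N = S(X ⊙ₗ M)` and `ζ(h ⊗ v) = ε(h) v`, `leftSide` is an `L`-module map whose value at `1 ⊗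
-- v` is the structure map at `v`.
theorem strLin_act (hS : Function.Bijective (HopfAlgebra.antipode k : H →ₗ[k] H))
    {g : GroupLike k H} (hg : IsGrouplikeCointegral g μ) {lamH : H →ₗ[k] k}
    (hlamH : IsRightCointegral lamH) (hn : lamH Λ = 1) {gH : GroupLike k H}
    (hgH : IsDistinguishedGrouplike lamH (gH : H)) (X : FDMod k H) (M : FDMod k L) (a : L) (v) :
    strLin hμ α (g⁻¹ * gH) X M (((hμ.serreFunctor α).obj (X ⊙ₗ M)).act a v) =
      (ModCat.dual (ModCat.dual X) ⊙ₗ (hμ.serreFunctor α).obj M : FDMod k L).act a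
        (strLin hμ α (g⁻¹ * gH) X M v) := by
  let N := (hμ.serreFunctor α).obj (X ⊙ₗ M)
  let ζ : ihomSpace H N N := Hom.hom ((internalHom k H L).coev N) (1 : k)
  have hζ : ζ.1 ((1 : H) ⊗ₜ v) = v := by
    change (Coalgebra.counit (R := k) (1 : H) * 1) • v = v
    rw [Bialgebra.counit_one, mul_one, one_smul]
  have h1 := (leftSide hμ α hb hΛ hα hp ζ).2 a ((1 : H) ⊗ₜ v)
  rw [leftSide_coe hμ α hb hΛ hα hp hS hg hlamH hn hgH, LinearMap.comp_apply,
    LinearMap.comp_apply, ζ.2, hζ] at h1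
  exact h1

theorem relativeSerre_isBimoduleIso (hS : Function.Bijective (HopfAlgebra.antipode k : H →ₗ[k] H))
    {g : GroupLike k H} (hg : IsGrouplikeCointegral g μ) {lamH : H →ₗ[k] k}
    (hlamH : IsRightCointegral lamH) (hn : lamH Λ = 1) {gH : GroupLike k H}
    (hgH : IsDistinguishedGrouplike lamH (gH : H)) :
    ModCat.IsBimoduleIso (relativeSerre hμ α hb hΛ hα hp)
      (twistedStructure hμ α (g⁻¹ * gH) (strLin_act hμ α hb hΛ hα hp hS hg hlamH hn hgH)) where
  left X M N := by
    rw [← cancel_epi ((relativeSerre hμ α hb hΛ hα hp).iso (X ⊙ₗ M) N).inv, Iso.inv_hom_id_assoc]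
    apply hom_ext
    refine LinearMap.ext fun (ζ : ihomSpace H N ((hμ.serreFunctor α).obj (X ⊙ₗ M))) => ?_
    apply Subtype.ext
    exact (leftSide_coe hμ α hb hΛ hα hp hS hg hlamH hn hgH ζ).symm
  right Y M N := relativeSerre_right hμ α hb hΛ hα hp Y M N

end TwistedStructure

end FDMod

/-! ### The general formula -/

section Formula

variable {k H L : Type u} [Field k] [Ring H] [HopfAlgebra k H]

open HopfAlgebra Coalgebra

/-- The right cointegral turns `μ(Λ₂) Λ₃` into `μ(Λ₂) 1`, and then `Λ₁ μ(Λ₂) = g`. -/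
theorem sum_cointegral_smul_tmul {Λ : H} {μ : H →ₗ[k] k} (hμ : IsRightCointegral μ)
    (hn : μ Λ = 1) {g : H} (hg : IsDistinguishedGrouplike μ g) {ι : Type*} {s : Finset ι}
    {x y z : ι → H} (h : ∑ i ∈ s, x i ⊗ₜ[k] (y i ⊗ₜ[k] z i) =
      (comul (R := k)).lTensor H (comul (R := k) Λ)) :
    ∑ i ∈ s, μ (y i) • (x i ⊗ₜ[k] z i) = g ⊗ₜ 1 := by
  let T : H ⊗[k] H →ₗ[k] H := (TensorProduct.lid k H).toLinearMap ∘ₗ μ.rTensor H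
  have hT : T ∘ₗ comul (R := k) = μ.smulRight (1 : H) := LinearMap.ext fun a => hμ a
  have h1 := congrArg (T.lTensor H) h
  rw [← LinearMap.comp_apply, ← LinearMap.lTensor_comp, hT, map_sum] at h1
  have h2 : ∀ w : H ⊗[k] H, (μ.smulRight (1 : H)).lTensor H w =
      TensorProduct.rid k H (μ.lTensor H w) ⊗ₜ 1 := by
    intro w
    induction w with
    | zero => simp
    | add x y hx hy => simp only [map_add, add_tmul, hx, hy]
    | tmul a b => simp [smul_tmul]
  rw [h2, hg, hn, one_smul] at h1
  rw [← h1]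
  refine Finset.sum_congr rfl fun i _ => ?_
  simp [T]

variable [Ring L] [Algebra k L]

/-- The scalar `μ(b j)` is the `j`-th coordinate of `1`, read as `μ(1 b j)` or `μ(b j 1)`. This is
why the side of the dual basis is immaterial. -/
theorem sum_dual_smul_eq_one {ι : Type*} [Fintype ι] [DecidableEq ι] (μ : L →ₗ[k] k)
    (a : Module.Basis ι k L) (b : ι → L)
    (hab : (∀ i j, μ (a i * b j) = if i = j then 1 else 0) ∨
      (∀ i j, μ (b i * a j) = if i = j then 1 else 0)) :
    ∑ j, μ (b j) • a j = 1 := by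
  conv_rhs => rw [← a.sum_repr 1]
  refine Finset.sum_congr rfl fun j _ => ?_
  congr 1
  rcases hab with h | h
  · have h1 : μ (1 * b j) = a.repr 1 j := by
      conv_lhs => rw [← a.sum_repr 1]
      simp only [Finset.sum_mul, map_sum, smul_mul_assoc, map_smul, h]
      simp
    rw [← h1, one_mul]
  · have h1 : μ (b j * 1) = a.repr 1 j := by
      conv_lhs => rw [← a.sum_repr 1]
      simp only [Finset.mul_sum, map_sum, mul_smul_comm, map_smul, h]
      simp
    rw [← h1, mul_one]

variable [LeftComoduleAlgebra k H L]

/-- The cointegral property replaces `b₍₋₁₎ λ_L(b₍₀₎)` by `λ_L(b) g_L`, after which `∑ λ_L(b j) a j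
= 1` removes the coaction of `a j`. What is left is `λ_H(Λ₂) Φ(S³(S(Λ₁) g_L) S(Λ₃) x) ⊗ m`. -/
theorem FDMod.sum_eval_tmul_eq {Λ : H} {lamH : H →ₗ[k] k} (hlamH : IsRightCointegral lamH)
    (hn : lamH Λ = 1) {gH : H} (hgH : IsDistinguishedGrouplike lamH gH) {lamL : L →ₗ[k] k}
    {gL : GroupLike k H} (hgL : IsGrouplikeCointegral gL lamL)
    (X : FDMod k H) (M : FDMod k L) (x : X) (m : M)
    {r : ℕ} (a : Module.Basis (Fin r) k L) (b : Fin r → L)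
    (hab : (∀ i j, lamL (a i * b j) = if i = j then 1 else 0) ∨
      (∀ i j, lamL (b i * a j) = if i = j then 1 else 0))
    {n : ℕ} (Λ₁ Λ₂ Λ₃ : Fin n → H)
    (h : ∑ i, Λ₁ i ⊗ₜ[k] (Λ₂ i ⊗ₜ[k] Λ₃ i) =
      (Coalgebra.comul (R := k)).lTensor H (Coalgebra.comul (R := k) Λ))
    {p : ℕ} (a₁ : Fin r → Fin p → H) (a₀ : Fin r → Fin p → L)
    (ha : ∀ j, ∑ i, a₁ j i ⊗ₜ[k] a₀ j i = LeftComoduleAlgebra.coaction (a j))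
    {q : ℕ} (b₁ : Fin r → Fin q → H) (b₀ : Fin r → Fin q → L)
    (hb : ∀ j, ∑ i, b₁ j i ⊗ₜ[k] b₀ j i = LeftComoduleAlgebra.coaction (b j)) :
    ∑ j, ∑ i, ∑ u, ∑ v,
      Module.Dual.eval k X (X.act
        ((HopfAlgebra.antipode k)^[3] (HopfAlgebra.antipode k (Λ₁ i) * b₁ j u) *
          HopfAlgebra.antipode k (Λ₃ i)) x) ⊗ₜ[k]
        ((lamL (b₀ j u) * lamH (a₁ j v * Λ₂ i)) • M.act (a₀ j v) m) =
      Module.Dual.eval k X (X.act ((gL⁻¹ : GroupLike k H) * gH) x) ⊗ₜ[k] m := by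
  have hgl := hgH.isGroupLikeElem hn
  let P (i : Fin n) : H →ₗ[k] Module.Dual k (Module.Dual k X) :=
    Module.Dual.eval k X ∘ₗ X.act.toLinearMap.flip x ∘ₗ
      LinearMap.mulRight k (antipode k (Λ₃ i)) ∘ₗ antipode k ∘ₗ antipode k ∘ₗ antipode k ∘ₗ
      LinearMap.mulLeft k (antipode k (Λ₁ i))
  let Q (i : Fin n) : H ⊗[k] L →ₗ[k] M :=
    (TensorProduct.lid k M).toLinearMap ∘ₗ TensorProduct.map (lamH ∘ₗ LinearMap.mulRight k (Λ₂ i))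
      (M.act.toLinearMap.flip m)
  have h1 : ∀ j, ∑ u, lamL (b₀ j u) • b₁ j u = lamL (b j) • (gL : H) := by
    intro j
    rw [← hgL (b j), ← hb j]
    simp
  have h2 : ∀ j i, ∑ u, ∑ v, Module.Dual.eval k X (X.act
      ((HopfAlgebra.antipode k)^[3] (HopfAlgebra.antipode k (Λ₁ i) * b₁ j u) *
        HopfAlgebra.antipode k (Λ₃ i)) x) ⊗ₜ[k]
      ((lamL (b₀ j u) * lamH (a₁ j v * Λ₂ i)) • M.act (a₀ j v) m) =
      P i gL ⊗ₜ Q i (LeftComoduleAlgebra.coaction (lamL (b j) • a j)) := by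
    intro j i
    have h3 : ∀ u v, Module.Dual.eval k X (X.act
        ((HopfAlgebra.antipode k)^[3] (HopfAlgebra.antipode k (Λ₁ i) * b₁ j u) *
          HopfAlgebra.antipode k (Λ₃ i)) x) ⊗ₜ[k]
        ((lamL (b₀ j u) * lamH (a₁ j v * Λ₂ i)) • M.act (a₀ j v) m) =
        P i (lamL (b₀ j u) • b₁ j u) ⊗ₜ Q i (a₁ j v ⊗ₜ a₀ j v) := by
      intro u v
      rw [map_smul, smul_tmul, mul_smul]
      congr 1
    simp only [h3, ← tmul_sum, ← sum_tmul, ← map_sum, h1, ha]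
    rw [map_smul, smul_tmul, map_smul, map_smul]
  simp only [h2]
  rw [Finset.sum_comm]
  simp only [← tmul_sum, ← map_sum, sum_dual_smul_eq_one lamL a b hab, map_one]
  -- Since `S³(S(Λ₁) g_L) = g_L⁻¹ S⁴(Λ₁)`, the remaining sum is the image of `λ_H(Λ₂) Λ₁ ⊗ Λ₃ = g_H
  -- ⊗ 1`, and `S⁴` fixes `g_H`.
  let F : H ⊗[k] H →ₗ[k] Module.Dual k (Module.Dual k X) ⊗[k] M :=
    (TensorProduct.mk k _ M).flip m ∘ₗ Module.Dual.eval k X ∘ₗ X.act.toLinearMap.flip x ∘ₗ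
      LinearMap.mulLeft k ((gL⁻¹ : GroupLike k H) : H) ∘ₗ LinearMap.mul' k H ∘ₗ
      TensorProduct.map (antipode k ∘ₗ antipode k ∘ₗ antipode k ∘ₗ antipode k) (antipode k)
  have h4 := congrArg F (sum_cointegral_smul_tmul hlamH hn hgH h)
  have h5 : F (gH ⊗ₜ 1) =
      Module.Dual.eval k X (X.act ((gL⁻¹ : GroupLike k H) * gH) x) ⊗ₜ[k] m := by
    simp [F, hgl.antipode_antipode]
  rw [h5, map_sum] at h4
  rw [← h4]
  refine Finset.sum_congr rfl fun i _ => ?_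
  have h6 : Q i 1 = lamH (Λ₂ i) • m := by
    rw [Algebra.TensorProduct.one_def]
    simp [Q]
  rw [h6, map_smul, tmul_smul]
  congr 1
  simp [F, P, antipode_mul_antidistrib, gL.2.antipode_antipode, mul_assoc]

end Formula

/-! ### Perfectness of the pairing and the main theorem -/

namespace FDMod

section PerfectPairing

variable {k H L : Type u} [Field k] [Ring H] [HopfAlgebra k H] [FiniteDimensional k H]
  [Ring L] [Algebra k L] [FiniteDimensional k L] [LeftComoduleAlgebra k H L]
  {μ : L →ₗ[k] k} (hμ : IsFrobeniusForm μ) (α : H →ₐ[k] k) {Λ : H}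
  (hb : HasDualBases k H L) (hΛ : IsRightIntegral k Λ) (hα : IsModularFunction Λ α)

theorem pairing_bijective
    (hS : Function.Bijective (HopfAlgebra.antipode k : H →ₗ[k] H))
    {g : GroupLike k H} (hg : IsGrouplikeCointegral g μ) {lamH : H →ₗ[k] k}
    (hlamH : IsRightCointegral lamH) (hn : lamH Λ = 1) {gH : H}
    (hgH : IsDistinguishedGrouplike lamH gH) (M N : FDMod k L) :
    Function.Bijective (pairing hμ α hb hΛ hα M N) :=
  (LinearMap.IsPerfPair.of_injective (pairing_injective hμ α hb hΛ hα hS hg hn hgH M N)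
    (pairing_flip_injective hμ α hb hΛ hα hlamH hn hgH M N)).bijective_left

end PerfectPairing

end FDMod

theorem mainTheorem2 {k H L : Type u} [Field k] [IsAlgClosed k]
    [Ring H] [HopfAlgebra k H] [FiniteDimensional k H]
    [Ring L] [Algebra k L] [FiniteDimensional k L] [LeftComoduleAlgebra k H L]
    (hexact : ModCat.IsExact (FDMod k H) (FDMod k L))
    (Λ : H) (hΛ : IsRightIntegral k Λ)
    (lamH : H →ₗ[k] k) (hlamH : IsRightCointegral lamH) (hnorm : lamH Λ = 1)
    (α : H →ₐ[k] k) (hα : IsModularFunction Λ α)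
    (gH : H) (hgH : IsDistinguishedGrouplike lamH gH)
    (lamL : L →ₗ[k] k) (hlamL : IsFrobeniusForm lamL)
    (gL : GroupLike k H) (hgL : IsGrouplikeCointegral gL lamL) :
    ∃ φ : ModCat.RelativeSerre (FDMod.internalHom k H L) (hlamL.serreFunctor α),
      φ.IsInducedByTrace ∧ HasTraceFormula Λ φ ∧
      ∃ s : ModCat.TwistedStructure (FDMod k H) (hlamL.serreFunctor α),
        ModCat.IsBimoduleIso φ s ∧ (∀ s', ModCat.IsBimoduleIso φ s' → s' = s) ∧
        (∀ (X : FDMod k H) (M : FDMod k L) (x : X) (m : M)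
          (r : ℕ) (a : Module.Basis (Fin r) k L) (b : Fin r → L)
          (_ : (∀ i j, lamL (a i * b j) = if i = j then 1 else 0) ∨
            (∀ i j, lamL (b i * a j) = if i = j then 1 else 0))
          (n : ℕ) (Λ₁ Λ₂ Λ₃ : Fin n → H)
          (_ : ∑ i, Λ₁ i ⊗ₜ[k] (Λ₂ i ⊗ₜ[k] Λ₃ i) =
            (Coalgebra.comul (R := k)).lTensor H (Coalgebra.comul (R := k) Λ))
          (p : ℕ) (a₁ : Fin r → Fin p → H) (a₀ : Fin r → Fin p → L)
          (_ : ∀ j, ∑ i, a₁ j i ⊗ₜ[k] a₀ j i = LeftComoduleAlgebra.coaction (a j))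
          (q : ℕ) (b₁ : Fin r → Fin q → H) (b₀ : Fin r → Fin q → L)
          (_ : ∀ j, ∑ i, b₁ j i ⊗ₜ[k] b₀ j i = LeftComoduleAlgebra.coaction (b j)),
          (FDMod.Hom.hom (s.str X M).hom (x ⊗ₜ[k] m) : Module.Dual k (Module.Dual k X) ⊗[k] M) =
            ∑ j, ∑ i, ∑ u, ∑ v,
              Module.Dual.eval k X (X.act
                ((HopfAlgebra.antipode k)^[3] (HopfAlgebra.antipode k (Λ₁ i) * b₁ j u) *
                  HopfAlgebra.antipode k (Λ₃ i)) x) ⊗ₜ[k]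
                ((lamL (b₀ j u) * lamH (a₁ j v * Λ₂ i)) • M.act (a₀ j v) m)) ∧
        ∀ (X : FDMod k H) (M : FDMod k L) (x : X) (m : M),
          (FDMod.Hom.hom (s.str X M).hom (x ⊗ₜ[k] m) : Module.Dual k (Module.Dual k X) ⊗[k] M) =
            Module.Dual.eval k X (X.act ((gL⁻¹ : GroupLike k H) * gH) x) ⊗ₜ[k] m := by
  -- Exactness enters only here, through projectivity of `H ⊙ₗ M`.
  have hb : FDMod.HasDualBases k H L := fun M => FDMod.exists_isDualBasis_of_isExact hexact M
  have hS := hΛ.antipode_bijective hnorm hgH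
  have hp := FDMod.pairing_bijective hlamL α hb hΛ hα hS hgL hlamH hnorm hgH
  let g : GroupLike k H := ⟨gH, hgH.isGroupLikeElem hnorm⟩
  have hs := FDMod.relativeSerre_isBimoduleIso hlamL α hb hΛ hα hp hS hgL hlamH hnorm (gH := g) hgH
  refine ⟨FDMod.relativeSerre hlamL α hb hΛ hα hp,
    FDMod.relativeSerre_isInducedByTrace hlamL α hb hΛ hα hp,
    FDMod.relativeSerre_hasTraceFormula hlamL α hb hΛ hα hp, _, hs,
    fun s' hs' => hs'.unique hs, ?_, fun X M x m => rfl⟩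
  intro X M x m r a b hab n Λ₁ Λ₂ Λ₃ h p a₁ a₀ ha q b₁ b₀ hb'
  -- The structure map is `Φ(g_L⁻¹ g_H x) ⊗ m` by construction, so the general formula is the
  -- evaluation of its right-hand side read backwards.
  exact (FDMod.sum_eval_tmul_eq hlamH hnorm hgH hgL X M x m a b hab Λ₁ Λ₂ Λ₃ h a₁ a₀ ha b₁ b₀
    hb').symm
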